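/- **Setting.** Let $n\ge 1$. A coweight $\mu$ of $\mathfrak{gl}_n$ is given by integers $\langle\mu,\varepsilon_i\rangle$, $1\le i\le n$; put $\alpha_i=\varepsilon_i-\varepsilon_{i+1}$ for $i\in I=\{1,\dots,n-1\}$, let $\alpha_i^\vee$ be the simple coroots and $(c_{ij})_{i,j\in I}$ the Cartan matrix of type $A_{n-1}$. Let $\lambda$ be a dominant coweight and $\mu$ an even coweight (all $\langle\mu,\alpha_i\rangle$ are even) with $\lambda-\mu=\sum_{i\in I}\mathbf v_i\alpha_i^\vee$, $\mathbf v_i\in\mathbb N$. Put $\mathbf w_i=\langle\lambda,\alpha_i\rangle$, $\mathfrak v_i=\lfloor \mathbf v_i/2\rfloor$, $\mathfrak w_i=\lfloor \mathbf w_i/2\rfloor$, and let $\theta_i,\varsigma_i\in\{0,1\}$ be the parities of $\mathbf v_i,\mathbf w_i$. Set $\vartheta_i=\max\{\theta_j\mid j\in I,\ c_{ij}\neq0\}$ for $i\in I$, and $\vartheta_0=0$, $\mathfrak v_0=\mathfrak v_n=\theta_0=\theta_n=0$. Assume $c_{ij}\theta_i\theta_j=0$ for all $i\ne j$ in $I$.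 **The shifted iYangian.** ${}^\imath\mathcal Y_\mu(\mathfrak{gl}_n)$ is the $\mathbb C$-algebra with generators $D_i^{(r)}$ ($1\le i\le n$, $r\ge\langle\mu,\varepsilon_i\rangle$), $\widetilde D_i^{(r)}$ ($1\le i\le n$, $r\ge-\langle\mu,\varepsilon_i\rangle$), $E_j^{(s)}$ ($j\in I$, $s\ge1$). Put $D_i(u)=\sum_r D_i^{(r)}u^{-r}$, $\widetilde D_i(u)=\sum_r\widetilde D_i^{(r)}u^{-r}$, $E_j(u)=\sum_{s\ge 1}E_j^{(s)}u^{-s}$, $B_i(u)=\sum_{r\ge1}B_i^{(r)}u^{-r}=E_i(u+\tfrac i2)$, $H_i(u)=\widetilde D_i(u+\tfrac i2)D_{i+1}(u+\tfrac i2)$, and $(\sum_r X^{(r)}u^{-r})^\star=\sum_{r>0}X^{(r)}u^{-r}$. The relations are $$D_i^{(\langle\varepsilon_i,\mu\rangle)}=1,\quad [D_i(u),D_j(v)]=0,\quad D_i(u)\widetilde D_i(u)=\widetilde D_i(u)D_i(u)=1,$$ $$\widetilde D_i(u)D_{i+1}(u)=\widetilde D_i(-u+i)D_{i+1}(-u+i),$$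 $$[D_i(u),E_i(v)]=\frac{D_i(u)(E_i(u)-E_i(v))}{u-v}+\frac{(E_i(v)-E_i(-u+i))D_i(u)}{u+v-i},$$ $$[E_i(v),D_{i+1}(u)]=\frac{D_{i+1}(u)(E_i(u)-E_i(v))}{u-v}+\frac{(E_i(v)-E_i(-u+i))D_{i+1}(u)}{u+v-i},$$ $$[E_i(u),E_{i+1}(v)]=\frac{-E_i(u)E_{i+1}(v)+[E_i^{(1)},E_{i+1}(v)]-[E_i(u),E_{i+1}^{(1)}]}{u-v},$$ $$[E_i(u),E_j(v)]=0\quad(c_{ij}=0),$$ $$[E_i(u),E_i(v)]=-\frac{(E_i(u)-E_i(v))^2}{u-v}-\frac{(\widetilde D_i(u)D_{i+1}(u))^\star-(\widetilde D_i(v)D_{i+1}(v))^\star}{u+v-i},$$ $$\big[B_i^{(1)},[B_i(u),B_j^{(1)}]\big]+\big[B_i(u),[B_i^{(1)},B_j^{(1)}]\big]=\big(B_j(-u+\tfrac12)H_i(u)-B_j(u+\tfrac12)H_i(u)\big)^\star\quad(c_{ij}=-1),$$ for all indices for which they make sense. **The algebra $\mathcal A$.** Let $\mathbb C[\boldsymbol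 z]$ be the polynomial ring in $z_{i,s}$, $i\in I$, $1\le s\le\mathfrak w_i$, and ${}^\imath\mathcal Y_\mu(\mathfrak{gl}_n)[\boldsymbol z]={}^\imath\mathcal Y_\mu(\mathfrak{gl}_n)\otimes\mathbb C[\boldsymbol z]$. Let $\mathcal A$ be the $\mathbb C[\boldsymbol z]$-algebra generated by $w_{i,r}$, $\eth_{i,r}^{\pm1}$, $(w_{i,r}\pm w_{i,r'}+m)^{-1}$, $(w_{i,r}+\tfrac12m)^{-1}$ ($i\in I$, $1\le r\ne r'\le\mathfrak v_i$, $m\in\mathbb Z$) with relations $[\eth_{i,r}^{\pm1},w_{j,r'}]=\pm\delta_{ij}\delta_{rr'}\eth_{i,r}^{\pm1}$, $[w_{i,r},w_{j,r'}]=[\eth_{i,r},\eth_{j,r'}]=0$, $\eth_{i,r}^{\pm1}\eth_{i,r}^{\mp1}=1$ (and those saying that the listed inverses are inverses). **Polynomials.** Put $W_i(u)=\prod_r(u-w_{i,r})$, $\overline W{}_i^-(u)=u^{\theta_i}\prod_r(u+w_{i,r})$, $\mathbf W_i(u)=u^{\theta_i}\prod_r(u^2-w_{i,r}^2)$, $\mathbf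 W_i^\circ(u)=\prod_r(u^2-w_{i,r}^2)$, $\mathbf W_{i,r}(u)=u^{\theta_i}(u+w_{i,r})\prod_{s\ne r}(u^2-w_{i,s}^2)$ (all equal to $1$ for $i=0,n$, where they occur), $Z_i(u)=\prod_s(u-z_{i,s})$, $\mathbf Z_i(u)=u^{\varsigma_i}\prod_s(u^2-z_{i,s}^2)$ for $i\in I$, $\varkappa(u)=1-\frac1{2u}$, $\boldsymbol\varkappa(u)=1-\frac1{4u^2}$. Finally take any $\mathbf Z_0(u)=u^{-\theta_1}\prod_{x\in\mathbb C}(u^2-x^2)^{m_x}$ with $m_x\in\mathbb Z$, almost all zero, and $\langle\lambda,\varepsilon_1\rangle=\theta_1-2\sum_xm_x$. **Theorem.** For every choice of the square roots $\sqrt{(-1)^{\mathfrak w_i+\mathfrak v_{i-1}+\mathfrak v_{i+1}}}$, $i\in I$, there is a unique homomorphism of $\mathbb C$-algebras $\Phi_\mu^\lambda:{}^\imath\mathcal Y_\mu(\mathfrak{gl}_n)[\boldsymbol z]\to\mathcal A$ that is the identity on $\mathbb C[\boldsymbol z]$ and satisfies (rational functions of $u$ being expanded in $u^{-1}$) $$D_i(u)\mapsto\frac{\mathbf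 W_i(u-\tfrac{i-1}2)}{\mathbf W_{i-1}(u-\tfrac i2)}\prod_{j=0}^{i-1}\Big(\boldsymbol\varkappa(u-\tfrac j2)^{\vartheta_j}\mathbf Z_j(u-\tfrac j2)\Big)\qquad(1\le i\le n),$$ $$\begin{aligned}E_i(u)\mapsto&-\sum_{r=1}^{\mathfrak v_i}\frac{\varkappa(w_{i,r})^{-\vartheta_i}\,\mathbf W_{i-1}(w_{i,r}-\tfrac12)\,\overline W{}^-_{i+1}(w_{i,r}-\tfrac12)}{(u-\tfrac{i-1}2-w_{i,r})\,\mathbf W_{i,r}(w_{i,r})}\,\eth_{i,r}^{-1}\\&-\sum_{r=1}^{\mathfrak v_i}\frac{\varkappa(-w_{i,r})^{-\vartheta_i}\,\mathbf Z_i(w_{i,r}+\tfrac12)\,W_{i+1}(w_{i,r}+\tfrac12)}{(u-\tfrac{i-1}2+w_{i,r})\,\mathbf W_{i,r}(w_{i,r})}\,\eth_{i,r}\\&+\sqrt{(-1)^{\mathfrak w_i+\mathfrak v_{i-1}+\mathfrak v_{i+1}}}\;\frac{\theta_i\,Z_i(0)}{(u-\tfrac i2)\,\mathbf W_i^\circ(\tfrac12)}\prod_{j\in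 I,\ |j-i|=1}W_j(0)\qquad(i\in I),\end{aligned}$$ and maps $\widetilde D_i(u)$ to the inverse of the image of $D_i(u)$. -/

import Mathlib

open scoped TensorProduct

noncomputable section

namespace IGKLO

/-! ### Coweights of `gl_n` -/

/-- The indices `1, …, n`. -/
abbrev Idx (n : ℕ) : Type := Set.Icc 1 n

/-- The nodes `1, …, n - 1` of the Dynkin diagram. -/
abbrev Node (n : ℕ) : Type := Set.Ico 1 n

/-- The node `i` regarded as an element of `{1, …, n}`. -/
def lo {n : ℕ} (i : Node n) : Idx n := ⟨i, i.2.1, i.2.2.le⟩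

/-- `i + 1` for a node `i`, regarded as an element of `{1, …, n}`. -/
def hi {n : ℕ} (i : Node n) : Idx n := ⟨i + 1, Nat.le_add_left 1 i, i.2.2⟩

/-- Integral coweights `μ` of `gl_n`, recorded by the integers `⟨μ, ε_i⟩`, `1 ≤ i ≤ n`. -/
abbrev Coweight (n : ℕ) : Type := Idx n → ℤ

/-- `⟨μ, α_i⟩`, where `α_i = ε_i - ε_{i+1}`. -/
def alphaPair {n : ℕ} (mu : Coweight n) (i : Node n) : ℤ := mu (lo i) - mu (hi i)

/-- The simple coroot `α_i^∨`. -/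
def simpleCoroot {n : ℕ} (i : Node n) : Coweight n := Pi.single (lo i) 1 - Pi.single (hi i) 1

/-- `μ` is dominant. -/
def IsDominant {n : ℕ} (mu : Coweight n) : Prop := ∀ i : Node n, 0 ≤ alphaPair mu i

/-- `μ` is even: all `⟨μ, α_i⟩` are even. -/
def IsEven {n : ℕ} (mu : Coweight n) : Prop := ∀ i : Node n, Even (alphaPair mu i)

/-- The Cartan matrix of type `A_{n-1}`. -/
def cartan {n : ℕ} (i j : Node n) : ℤ :=
  if i = j then 2 else if (i : ℕ) + 1 = j ∨ (j : ℕ) + 1 = i then -1 else 0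

/-- The numbers `⟨μ, α_i⟩` of a dominant coweight, as natural numbers. -/
def weightVec {n : ℕ} (mu : Coweight n) (i : Node n) : ℕ := (alphaPair mu i).toNat

/-! ### Laurent series in `u⁻¹`

A Laurent series `∑_r f_r u^{-r}` with coefficients in `B` (finitely many positive powers of `u`)
is an element `f` of `LaurentSeries B` with `f.coeff r = f_r`. -/

section Series

variable {B : Type} [Ring B] [Algebra ℂ B]

/-- The variable `u`. -/
def uvar (B : Type) [Ring B] : LaurentSeries B := HahnSeries.single (-1) 1

/-- The series `∑_{k ≥ 0} a_k u^{-(d + k)}`. -/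
def seriesFrom (d : ℤ) (a : ℕ → B) : LaurentSeries B :=
  HahnSeries.ofSuppBddBelow (fun r => if d ≤ r then a (r - d).toNat else 0)
    ⟨d, fun r hr => by
      by_contra h
      exact hr (if_neg h)⟩

/-- The coefficientwise image of a series under an algebra homomorphism. -/
def mapSeries {C : Type} [Ring C] [Algebra ℂ C] (φ : B →ₐ[ℂ] C) (f : LaurentSeries B) :
    LaurentSeries C :=
  HahnSeries.map f φ

/-- The principal part `(f(u))^⋆ = ∑_{r > 0} f_r u^{-r}`. -/
def principalPart (f : LaurentSeries B) : LaurentSeries B :=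
  HahnSeries.ofSuppBddBelow (fun r => if 0 < r then f.coeff r else 0)
    ⟨0, fun r hr => by
      by_contra h
      exact hr (if_neg fun h' => h h'.le)⟩

/-- The substitution `f(ε u + a) = ∑_r f_r (ε u + a)^{-r}`, with `ε = ±1`, expanded in powers of
`u⁻¹`. (For a fixed power `u^{-s}` only the `r` between the order of `f` and `s` contribute.) -/
def substAffine (ε : ℤˣ) (a : ℂ) (f : LaurentSeries B) : LaurentSeries B :=
  HahnSeries.ofSuppBddBelow
    (fun s => ∑ r ∈ Finset.Icc f.order s,
      (((HahnSeries.C (((ε : ℤ) : ℂ)) * uvar ℂ + HahnSeries.C a : LaurentSeries ℂ) ^ (-r)).coeff s) •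
        f.coeff r)
    ⟨f.order, fun s hs => by
      by_contra h
      exact hs (by simp only [Finset.Icc_eq_empty h, Finset.sum_empty])⟩

/-- Laurent series in `v⁻¹` whose coefficients are Laurent series in `u⁻¹`. In this ring `u - v`
and `u + v - i` are invertible. -/
abbrev Series₂ (B : Type) [Ring B] : Type := LaurentSeries (LaurentSeries B)

/-- `f(u)` as a series in two variables. -/
def inU (f : LaurentSeries B) : Series₂ B := HahnSeries.C f

/-- `f(v)` as a series in two variables. -/
def inV (f : LaurentSeries B) : Series₂ B :=
  HahnSeries.map f (HahnSeries.C : B →+* LaurentSeries B)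

/-- The variable `u` of the ring of series in two variables. -/
def U (B : Type) [Ring B] : Series₂ B := inU (uvar B)

/-- The variable `v` of the ring of series in two variables. -/
def V (B : Type) [Ring B] : Series₂ B := inV (uvar B)

/-- The coefficient of `u^{-p} v^{-q}`. -/
def coeff₂ (F : Series₂ B) (p q : ℤ) : B := (F.coeff q).coeff p

/-- The commutator `[a, b] = ab - ba`. -/
def comm {R : Type} [Ring R] (a b : R) : R := a * b - b * a

end Series

/-! ### The shifted iYangian of `gl_n` -/

/-- Generators of the shifted iYangian: `D i k` is `D_i^{(⟨μ,ε_i⟩+k)}`, `Dt i k` is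
`D̃_i^{(-⟨μ,ε_i⟩+k)}` and `E j k` is `E_j^{(k+1)}`. -/
inductive YGen (n : ℕ) : Type
  | D (i : Idx n) (k : ℕ)
  | Dt (i : Idx n) (k : ℕ)
  | E (j : Node n) (k : ℕ)

/-- The free algebra on the generators of the shifted iYangian. -/
abbrev YFree (n : ℕ) : Type := FreeAlgebra ℂ (YGen n)

section YFree

variable {n : ℕ}

/-- `D_i(u)` in the free algebra. -/
def freeD (mu : Coweight n) (i : Idx n) : LaurentSeries (YFree n) :=
  seriesFrom (mu i) fun k => FreeAlgebra.ι ℂ (YGen.D i k)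

/-- `D̃_i(u)` in the free algebra. -/
def freeDt (mu : Coweight n) (i : Idx n) : LaurentSeries (YFree n) :=
  seriesFrom (-mu i) fun k => FreeAlgebra.ι ℂ (YGen.Dt i k)

/-- `E_j(u)` in the free algebra. -/
def freeE (j : Node n) : LaurentSeries (YFree n) :=
  seriesFrom 1 fun k => FreeAlgebra.ι ℂ (YGen.E j k)

/-- `D̃_i(u) D_{i+1}(u)` in the free algebra. -/
def freeX (mu : Coweight n) (i : Node n) : LaurentSeries (YFree n) :=
  freeDt mu (lo i) * freeD mu (hi i)

/-- `B_i(u) = E_i(u + i/2)`. -/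
def freeB (i : Node n) : LaurentSeries (YFree n) := substAffine 1 ((i : ℂ) / 2) (freeE i)

/-- `H_i(u) = D̃_i(u + i/2) D_{i+1}(u + i/2)`. -/
def freeH (mu : Coweight n) (i : Node n) : LaurentSeries (YFree n) :=
  substAffine 1 ((i : ℂ) / 2) (freeDt mu (lo i)) * substAffine 1 ((i : ℂ) / 2) (freeD mu (hi i))

/-- `B_i^{(1)}` as a constant series. -/
def freeB₁ (i : Node n) : LaurentSeries (YFree n) := HahnSeries.C ((freeB i).coeff 1)

/-- `E_i^{(1)}` as a constant series. -/
def freeE₁ (i : Node n) : LaurentSeries (YFree n) := HahnSeries.C ((freeE i).coeff 1)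

/-- The element `u - v`. -/
def uSubV (n : ℕ) : Series₂ (YFree n) := U (YFree n) - V (YFree n)

/-- The element `u + v - i`. -/
def uAddV (i : Node n) : Series₂ (YFree n) :=
  U (YFree n) + V (YFree n) - ((i : ℕ) : Series₂ (YFree n))

/-- The defining relations of the shifted iYangian of `gl_n`. A relation between series stands for
the relations between their coefficients; the denominators `u - v` and `u + v - i` are cleared. -/
inductive YRel (n : ℕ) (mu : Coweight n) : YFree n → YFree n → Prop
  /-- `D_i^{(⟨ε_i,μ⟩)} = 1` -/
  | lead (i : Idx n) : YRel n mu ((freeD mu i).coeff (mu i)) 1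
  /-- `[D_i(u), D_j(v)] = 0` -/
  | dd (i j : Idx n) (p q : ℤ) :
      YRel n mu (coeff₂ (comm (inU (freeD mu i)) (inV (freeD mu j))) p q) 0
  /-- `D_i(u) D̃_i(u) = 1` -/
  | ddt (i : Idx n) (p : ℤ) :
      YRel n mu ((freeD mu i * freeDt mu i).coeff p) ((1 : LaurentSeries (YFree n)).coeff p)
  /-- `D̃_i(u) D_i(u) = 1` -/
  | dtd (i : Idx n) (p : ℤ) :
      YRel n mu ((freeDt mu i * freeD mu i).coeff p) ((1 : LaurentSeries (YFree n)).coeff p)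
  /-- `D̃_i(u) D_{i+1}(u) = D̃_i(-u+i) D_{i+1}(-u+i)` -/
  | even (i : Node n) (p : ℤ) :
      YRel n mu ((freeDt mu (lo i) * freeD mu (hi i)).coeff p)
        ((substAffine (-1) (i : ℂ) (freeDt mu (lo i)) *
          substAffine (-1) (i : ℂ) (freeD mu (hi i))).coeff p)
  /-- `[D_i(u), E_i(v)] = D_i(u)(E_i(u) - E_i(v))/(u-v) + (E_i(v) - E_i(-u+i))D_i(u)/(u+v-i)` -/
  | de (i : Node n) (p q : ℤ) :
      YRel n mu
        (coeff₂ (uSubV n * uAddV i * comm (inU (freeD mu (lo i))) (inV (freeE i))) p q)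
        (coeff₂ (uAddV i * (inU (freeD mu (lo i)) * (inU (freeE i) - inV (freeE i))) +
          uSubV n * ((inV (freeE i) - inU (substAffine (-1) (i : ℂ) (freeE i))) *
            inU (freeD mu (lo i)))) p q)
  /-- `[E_i(v), D_{i+1}(u)]
      = D_{i+1}(u)(E_i(u) - E_i(v))/(u-v) + (E_i(v) - E_i(-u+i))D_{i+1}(u)/(u+v-i)` -/
  | ed (i : Node n) (p q : ℤ) :
      YRel n mu
        (coeff₂ (uSubV n * uAddV i * comm (inV (freeE i)) (inU (freeD mu (hi i)))) p q)
        (coeff₂ (uAddV i * (inU (freeD mu (hi i)) * (inU (freeE i) - inV (freeE i))) +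
          uSubV n * ((inV (freeE i) - inU (substAffine (-1) (i : ℂ) (freeE i))) *
            inU (freeD mu (hi i)))) p q)
  /-- `[E_i(u), E_{i+1}(v)]
      = (-E_i(u)E_{i+1}(v) + [E_i^{(1)}, E_{i+1}(v)] - [E_i(u), E_{i+1}^{(1)}])/(u-v)` -/
  | ee_succ (i j : Node n) (hij : (j : ℕ) = i + 1) (p q : ℤ) :
      YRel n mu
        (coeff₂ (uSubV n * comm (inU (freeE i)) (inV (freeE j))) p q)
        (coeff₂ (-(inU (freeE i) * inV (freeE j)) + comm (inU (freeE₁ i)) (inV (freeE j)) -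
          comm (inU (freeE i)) (inU (freeE₁ j))) p q)
  /-- `[E_i(u), E_j(v)] = 0` if `c_{ij} = 0` -/
  | ee_zero (i j : Node n) (hij : cartan i j = 0) (p q : ℤ) :
      YRel n mu (coeff₂ (comm (inU (freeE i)) (inV (freeE j))) p q) 0
  /-- `[E_i(u), E_i(v)] = -(E_i(u) - E_i(v))²/(u-v)
      - ((D̃_i(u)D_{i+1}(u))^⋆ - (D̃_i(v)D_{i+1}(v))^⋆)/(u+v-i)` -/
  | ee (i : Node n) (p q : ℤ) :
      YRel n mu
        (coeff₂ (uSubV n * uAddV i * comm (inU (freeE i)) (inV (freeE i))) p q)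
        (coeff₂ (-(uAddV i * (inU (freeE i) - inV (freeE i)) ^ 2) -
          uSubV n * (inU (principalPart (freeX mu i)) - inV (principalPart (freeX mu i)))) p q)
  /-- `[B_i^{(1)}, [B_i(u), B_j^{(1)}]] + [B_i(u), [B_i^{(1)}, B_j^{(1)}]]
      = (B_j(-u+1/2)H_i(u) - B_j(u+1/2)H_i(u))^⋆` if `c_{ij} = -1` -/
  | serre (i j : Node n) (hij : cartan i j = -1) (p : ℤ) :
      YRel n mu
        ((comm (freeB₁ i) (comm (freeB i) (freeB₁ j)) +
          comm (freeB i) (comm (freeB₁ i) (freeB₁ j))).coeff p)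
        ((principalPart (substAffine (-1) (1 / 2) (freeB j) * freeH mu i -
          substAffine 1 (1 / 2) (freeB j) * freeH mu i)).coeff p)

end YFree

/-- The shifted iYangian of `gl_n` associated to the coweight `μ`. -/
def Y (n : ℕ) (mu : Coweight n) : Type := RingQuot (YRel n mu)

instance (n : ℕ) (mu : Coweight n) : Ring (Y n mu) := RingQuot.instRing (YRel n mu)

instance (n : ℕ) (mu : Coweight n) : Algebra ℂ (Y n mu) := RingQuot.instAlgebra (YRel n mu)

/-- The projection from the free algebra. -/
def Y.mk (n : ℕ) (mu : Coweight n) : YFree n →ₐ[ℂ] Y n mu := RingQuot.mkAlgHom ℂ (YRel n mu)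

/-- `D_i(u)` in the shifted iYangian. -/
def Y.D {n : ℕ} (mu : Coweight n) (i : Idx n) : LaurentSeries (Y n mu) :=
  mapSeries (Y.mk n mu) (freeD mu i)

/-- `D̃_i(u)` in the shifted iYangian. -/
def Y.Dt {n : ℕ} (mu : Coweight n) (i : Idx n) : LaurentSeries (Y n mu) :=
  mapSeries (Y.mk n mu) (freeDt mu i)

/-- `E_j(u)` in the shifted iYangian. -/
def Y.E {n : ℕ} (mu : Coweight n) (j : Node n) : LaurentSeries (Y n mu) :=
  mapSeries (Y.mk n mu) (freeE j)

/-! ### Dimension vectors -/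

/-- Extension by zero of a vector indexed by the nodes `1, …, n - 1`. -/
def extZero {n : ℕ} (d : Node n → ℕ) (i : ℕ) : ℕ := if h : i ∈ Set.Ico 1 n then d ⟨i, h⟩ else 0

/-- `⌊d_i / 2⌋`; zero if `i` is not a node. -/
def half {n : ℕ} (d : Node n → ℕ) (i : ℕ) : ℕ := extZero d i / 2

/-- The parity of `d_i`, as `0` or `1`; zero if `i` is not a node. -/
def parity {n : ℕ} (d : Node n → ℕ) (i : ℕ) : ℕ := extZero d i % 2

/-- `ϑ_i = max {θ_j | c_{ij} ≠ 0}` for a node `i`, with `θ = parity v`, and zero otherwise. -/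
def vartheta {n : ℕ} (v : Node n → ℕ) (i : ℕ) : ℕ :=
  if h : i ∈ Set.Ico 1 n then
    (Finset.univ.filter fun j : Node n => cartan ⟨i, h⟩ j ≠ 0).sup fun j => parity v j
  else 0

/-! ### The algebra of difference operators -/

section DifferenceOperators

variable {n : ℕ}

/-- The indices of the central variables `z_{i,s}`, `1 ≤ i < n`, `1 ≤ s ≤ ⌊w_i / 2⌋`. -/
abbrev ZIdx (w : Node n → ℕ) : Type := Σ i : ℕ, Fin (half w i)

/-- Generators of the algebra `𝒜`. Here `1 ≤ i < n` and `1 ≤ r ≤ ⌊v_i / 2⌋`, as `Fin (half v i)` is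
empty for other `i`. -/
inductive AGen (v : Node n → ℕ) : Type
  /-- `w_{i,r}` -/
  | w (i : ℕ) (r : Fin (half v i))
  /-- `ð_{i,r}` -/
  | eth (i : ℕ) (r : Fin (half v i))
  /-- `ð_{i,r}⁻¹` -/
  | ethInv (i : ℕ) (r : Fin (half v i))
  /-- `(w_{i,r} + w_{i,r'} + m)⁻¹` -/
  | addInv (i : ℕ) (r r' : Fin (half v i)) (h : r ≠ r') (m : ℤ)
  /-- `(w_{i,r} - w_{i,r'} + m)⁻¹` -/
  | subInv (i : ℕ) (r r' : Fin (half v i)) (h : r ≠ r') (m : ℤ)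
  /-- `(w_{i,r} + m/2)⁻¹` -/
  | halfInv (i : ℕ) (r : Fin (half v i)) (m : ℤ)

/-- The free algebra over `ℂ[z]` on the generators of `𝒜`. -/
abbrev AFree (v w : Node n → ℕ) : Type := FreeAlgebra (MvPolynomial (ZIdx w) ℂ) (AGen v)

/-- A generator as an element of the free algebra. -/
def afree (v w : Node n → ℕ) (x : AGen v) : AFree v w := FreeAlgebra.ι (MvPolynomial (ZIdx w) ℂ) x

/-- The defining relations of `𝒜`. -/
inductive ARel (v w : Node n → ℕ) : AFree v w → AFree v w → Prop
  | eth_w_same (i : ℕ) (r : Fin (half v i)) :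
      ARel v w (comm (afree v w (.eth i r)) (afree v w (.w i r))) (afree v w (.eth i r))
  | eth_w_ne (i j : ℕ) (r : Fin (half v i)) (s : Fin (half v j))
      (h : (⟨i, r⟩ : Σ i : ℕ, Fin (half v i)) ≠ ⟨j, s⟩) :
      ARel v w (comm (afree v w (.eth i r)) (afree v w (.w j s))) 0
  | ethInv_w_same (i : ℕ) (r : Fin (half v i)) :
      ARel v w (comm (afree v w (.ethInv i r)) (afree v w (.w i r))) (-afree v w (.ethInv i r))
  | ethInv_w_ne (i j : ℕ) (r : Fin (half v i)) (s : Fin (half v j))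
      (h : (⟨i, r⟩ : Σ i : ℕ, Fin (half v i)) ≠ ⟨j, s⟩) :
      ARel v w (comm (afree v w (.ethInv i r)) (afree v w (.w j s))) 0
  | w_w (i j : ℕ) (r : Fin (half v i)) (s : Fin (half v j)) :
      ARel v w (comm (afree v w (.w i r)) (afree v w (.w j s))) 0
  | eth_eth (i j : ℕ) (r : Fin (half v i)) (s : Fin (half v j)) :
      ARel v w (comm (afree v w (.eth i r)) (afree v w (.eth j s))) 0
  | eth_ethInv (i : ℕ) (r : Fin (half v i)) :
      ARel v w (afree v w (.eth i r) * afree v w (.ethInv i r)) 1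
  | ethInv_eth (i : ℕ) (r : Fin (half v i)) :
      ARel v w (afree v w (.ethInv i r) * afree v w (.eth i r)) 1
  | add_addInv (i : ℕ) (r r' : Fin (half v i)) (h : r ≠ r') (m : ℤ) :
      ARel v w ((afree v w (.w i r) + afree v w (.w i r') + algebraMap ℂ (AFree v w) m) *
        afree v w (.addInv i r r' h m)) 1
  | addInv_add (i : ℕ) (r r' : Fin (half v i)) (h : r ≠ r') (m : ℤ) :
      ARel v w (afree v w (.addInv i r r' h m) *
        (afree v w (.w i r) + afree v w (.w i r') + algebraMap ℂ (AFree v w) m)) 1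
  | sub_subInv (i : ℕ) (r r' : Fin (half v i)) (h : r ≠ r') (m : ℤ) :
      ARel v w ((afree v w (.w i r) - afree v w (.w i r') + algebraMap ℂ (AFree v w) m) *
        afree v w (.subInv i r r' h m)) 1
  | subInv_sub (i : ℕ) (r r' : Fin (half v i)) (h : r ≠ r') (m : ℤ) :
      ARel v w (afree v w (.subInv i r r' h m) *
        (afree v w (.w i r) - afree v w (.w i r') + algebraMap ℂ (AFree v w) m)) 1
  | half_halfInv (i : ℕ) (r : Fin (half v i)) (m : ℤ) :
      ARel v w ((afree v w (.w i r) + algebraMap ℂ (AFree v w) (m / 2)) *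
        afree v w (.halfInv i r m)) 1
  | halfInv_half (i : ℕ) (r : Fin (half v i)) (m : ℤ) :
      ARel v w (afree v w (.halfInv i r m) *
        (afree v w (.w i r) + algebraMap ℂ (AFree v w) (m / 2))) 1

/-- The algebra `𝒜` of difference operators. -/
def A (v w : Node n → ℕ) : Type := RingQuot (ARel v w)

instance (v w : Node n → ℕ) : Ring (A v w) := RingQuot.instRing (ARel v w)

instance (v w : Node n → ℕ) : Algebra ℂ (A v w) := RingQuot.instAlgebra (ARel v w)

instance (v w : Node n → ℕ) : Algebra (MvPolynomial (ZIdx w) ℂ) (A v w) :=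
  RingQuot.instAlgebra (ARel v w)

variable (v w : Node n → ℕ)

/-- The projection from the free algebra. -/
def A.mk : AFree v w →ₐ[MvPolynomial (ZIdx w) ℂ] A v w :=
  RingQuot.mkAlgHom (MvPolynomial (ZIdx w) ℂ) (ARel v w)

/-- The image in `𝒜` of a generator. -/
def A.gen (x : AGen v) : A v w := A.mk v w (afree v w x)

/-- `w_{i,r}` -/
def A.wv (i : ℕ) (r : Fin (half v i)) : A v w := A.gen v w (.w i r)

/-- `ð_{i,r}` -/
def A.eth (i : ℕ) (r : Fin (half v i)) : A v w := A.gen v w (.eth i r)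

/-- `ð_{i,r}⁻¹` -/
def A.ethInv (i : ℕ) (r : Fin (half v i)) : A v w := A.gen v w (.ethInv i r)

/-- `z_{i,s}` -/
def A.z (i : ℕ) (s : Fin (half w i)) : A v w :=
  algebraMap (MvPolynomial (ZIdx w) ℂ) (A v w) (MvPolynomial.X ⟨i, s⟩)

/-! ### The polynomials entering the formulas

All factors of the products below commute. The bold polynomials are evaluated at elements `x` of an
algebra `R` over `𝒜` through the structure map `f : 𝒜 → R`: either `R = 𝒜`, or `R` is the algebra
of Laurent series in `u⁻¹` over `𝒜`. Everything that is inverted with `Ring.inverse` is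
a unit. -/

/-- `W_i(x) = ∏_r (x - w_{i,r})` -/
def W (i : ℕ) (x : A v w) : A v w := (List.ofFn fun r => x - A.wv v w i r).prod

/-- `W̄_i^-(x) = x^{θ_i} ∏_r (x + w_{i,r})` -/
def Wbar (i : ℕ) (x : A v w) : A v w :=
  x ^ parity v i * (List.ofFn fun r => x + A.wv v w i r).prod

/-- `𝐖_i^∘(x) = ∏_r (x² - w_{i,r}²)` -/
def Wcirc (i : ℕ) (x : A v w) : A v w := (List.ofFn fun r => x ^ 2 - A.wv v w i r ^ 2).prod

/-- `𝐖_{i,r}(x) = x^{θ_i} (x + w_{i,r}) ∏_{s ≠ r} (x² - w_{i,s}²)` -/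
def Wr (i : ℕ) (r : Fin (half v i)) (x : A v w) : A v w :=
  x ^ parity v i * (x + A.wv v w i r) *
    (List.ofFn fun s => if s = r then 1 else x ^ 2 - A.wv v w i s ^ 2).prod

/-- `Z_i(x) = ∏_s (x - z_{i,s})` -/
def Z (i : ℕ) (x : A v w) : A v w := (List.ofFn fun s => x - A.z v w i s).prod

section Bold

variable {R : Type} [Ring R] [Algebra ℂ R]

variable {v w} in
/-- `𝐖_i(x) = x^{θ_i} ∏_r (x² - w_{i,r}²)` -/
def boldW (f : A v w →+* R) (i : ℕ) (x : R) : R :=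
  x ^ parity v i * (List.ofFn fun r => x ^ 2 - f (A.wv v w i r) ^ 2).prod

variable {v w} in
/-- `𝐙_i(x) = x^{ς_i} ∏_s (x² - z_{i,s}²)` for a node `i` -/
def boldZ (f : A v w →+* R) (i : ℕ) (x : R) : R :=
  x ^ parity w i * (List.ofFn fun s => x ^ 2 - f (A.z v w i s) ^ 2).prod

/-- `ϰ(x) = 1 - 1/(2x)` -/
def kap (x : R) : R := 1 - Ring.inverse (2 * x)

/-- `𝛋(x) = 1 - 1/(4x²)` -/
def boldKap (x : R) : R := 1 - Ring.inverse (4 * x ^ 2)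

/-- A complex number as an element of an algebra. -/
def sc (c : ℂ) : R := algebraMap ℂ R c

end Bold

/-- The constant series with value in `𝒜`. -/
def cst : A v w →+* LaurentSeries (A v w) := HahnSeries.C

/-- `u + c` as a Laurent series over `𝒜`. -/
def ush (c : ℂ) : LaurentSeries (A v w) := uvar (A v w) + cst v w (sc c)

/-- `𝐙_0(u) = u^{-θ_1} ∏_{x ∈ ℂ} (u² - x²)^{m_x}`, with complex coefficients. -/
def Z₀ (m : ℂ →₀ ℤ) : LaurentSeries ℂ :=
  uvar ℂ ^ (-(parity v 1 : ℤ)) * m.prod fun x k => (uvar ℂ ^ 2 - HahnSeries.C x ^ 2) ^ k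

/-- The image of `D_i(u)`,
`𝐖_i(u - (i-1)/2) / 𝐖_{i-1}(u - i/2) · ∏_{j=0}^{i-1} 𝛋(u - j/2)^{ϑ_j} 𝐙_j(u - j/2)`;
the factor of `j = 0` is `𝐙_0(u)` since `ϑ_0 = 0`, and `𝐖_0 = 𝐖_n = 1`. -/
def imageD (m : ℂ →₀ ℤ) (i : ℕ) : LaurentSeries (A v w) :=
  boldW (cst v w) i (ush v w (-(((i : ℂ) - 1) / 2))) *
    Ring.inverse (boldW (cst v w) (i - 1) (ush v w (-((i : ℂ) / 2)))) *
    mapSeries (Algebra.ofId ℂ (A v w)) (Z₀ v m) *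
    (List.ofFn fun j : Fin (i - 1) =>
      boldKap (ush v w (-((((j : ℕ) + 1 : ℕ) : ℂ) / 2))) ^ vartheta v (j + 1) *
        boldZ (cst v w) (j + 1) (ush v w (-((((j : ℕ) + 1 : ℕ) : ℂ) / 2)))).prod

/-- The coefficient
`ϰ(w_{i,r})^{-ϑ_i} 𝐖_{i-1}(w_{i,r} - 1/2) W̄_{i+1}^-(w_{i,r} - 1/2) / 𝐖_{i,r}(w_{i,r})`
of `ð_{i,r}⁻¹`. -/
def coeffMinus (i : ℕ) (r : Fin (half v i)) : A v w :=
  Ring.inverse (kap (A.wv v w i r)) ^ vartheta v i *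
    boldW (RingHom.id (A v w)) (i - 1) (A.wv v w i r - sc (1 / 2)) *
    Wbar v w (i + 1) (A.wv v w i r - sc (1 / 2)) *
    Ring.inverse (Wr v w i r (A.wv v w i r))

/-- The coefficient
`ϰ(-w_{i,r})^{-ϑ_i} 𝐙_i(w_{i,r} + 1/2) W_{i+1}(w_{i,r} + 1/2) / 𝐖_{i,r}(w_{i,r})` of `ð_{i,r}`. -/
def coeffPlus (i : ℕ) (r : Fin (half v i)) : A v w :=
  Ring.inverse (kap (-A.wv v w i r)) ^ vartheta v i *
    boldZ (RingHom.id (A v w)) i (A.wv v w i r + sc (1 / 2)) *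
    W v w (i + 1) (A.wv v w i r + sc (1 / 2)) *
    Ring.inverse (Wr v w i r (A.wv v w i r))

/-- The coefficient `c θ_i Z_i(0) W_{i-1}(0) W_{i+1}(0) / 𝐖_i^∘(1/2)`, where `c` is a square root
of `(-1)^{𝔴_i + 𝔳_{i-1} + 𝔳_{i+1}}`; a factor `W_j(0)` is `1` if `j` is not a node. -/
def coeffZero (c : ℂ) (i : ℕ) : A v w :=
  sc (c * (parity v i : ℂ)) * Z v w i 0 * Ring.inverse (Wcirc v w i (sc (1 / 2))) *
    (W v w (i - 1) 0 * W v w (i + 1) 0)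

/-- The image of `E_i(u)`. -/
def imageE (c : ℂ) (i : ℕ) : LaurentSeries (A v w) :=
  -(∑ r : Fin (half v i),
      Ring.inverse (ush v w (-(((i : ℂ) - 1) / 2)) - cst v w (A.wv v w i r)) *
        cst v w (coeffMinus v w i r * A.ethInv v w i r)) -
    (∑ r : Fin (half v i),
      Ring.inverse (ush v w (-(((i : ℂ) - 1) / 2)) + cst v w (A.wv v w i r)) *
        cst v w (coeffPlus v w i r * A.eth v w i r)) +
    Ring.inverse (ush v w (-((i : ℂ) / 2))) * cst v w (coeffZero v w c i)

end DifferenceOperators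

end IGKLO

end

/-! Uniqueness holds because the coefficients of the generating series, together with the
polynomials in `z`, generate the source, and because a two-sided inverse of the image of `D_i(u)` is
unique. The substance is existence: the images have to satisfy the defining relations.

Reduction to a field. The algebra `𝒜` is given by generators and relations, and nothing is assumed
about its size, so division in it is unavailable. Let `P` be the polynomial ring in all `w_{i,r}`
and `z_{i,s}`, localized at the nonzero polynomials that become units in `𝒜`. Pairs of a unit `x` of
`𝒜` and an automorphism `τ` of `P` with `x p = τ(p) x` in `𝒜` form a group `EvGrp`, which acts on
this localization and on its field of fractions. The skew group algebra over the localization maps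
to `𝒜` (`skewEval`) and embeds in the one over the field (`skewFracMap_injective`). The images of
the generators lift to the former, so that each relation may be checked over the field and then
carried to `𝒜` (`diffLift_rel`).

The shape of `E`. With `X = u - (i-1)/2`, the image of `E_i(u)` is `∑_p (X - w_p)⁻¹ χ_p`. Here `p`
runs over the poles `± w_{i,r}` and one extra pole `1/2`, and `χ_p` is a coefficient times a shift
operator. An involution `bar` exchanges `± w_{i,r}` and fixes the extra pole. Because `1/2 = 1 -
1/2`, the extra term obeys the rule `σ_p(w_{bar p}) = 1 - w_p` like the others. With the quadratic
exchange relation of `χ_p` and `χ_q` for `q ≠ p, bar p`, and with `χ_p χ_{bar p}` equal to a scalar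
`φ_p`, this is the content of `ShiftData`. In `[E_i(u), E_i(v)]` only products at opposite poles
survive. They leave a scalar function of `t = (u - i/2)²` with simple poles at `t_p = (w_p - 1/2)²`
and residues `2 (1 - w_p) φ_p` (`ShiftData.E_comm_E`). The same cancellation evaluates the left side
of the Serre relation (`ShiftData.Adjacent.serre`).

The shape of `D`. The image of `D_i(u)⁻¹ D_{i+1}(u)` equals `N(t) / ∏_p (t - t_p)` with a polynomial
`N` (`inv_fD_mul_fD_succ`); the factors `ϰ` and the parity assumptions enter here. This shows the
symmetry under `u ↦ -u + i`, and partial fractions give the principal part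
(`principalPart_div_prod`). The two sides meet in `ShiftRing.residue`: the residue of this function
at `t_p` is `2 (1 - w_p) φ_p`; at the extra pole this uses the chosen square root. In the Serre
relation one divides further by `t - w_q²` for a pole `q` of the adjacent node. No new pole appears,
since `N` is divisible by `t - w_q²` whenever the coefficient at `q` is nonzero
(`ShiftRing.numer_eq_mul`). -/

noncomputable section

namespace IGKLO

/-! ### Laurent series over noncommutative rings: change of coefficients and orders. -/

section LaurentGeneralities

variable {B C : Type} [Ring B] [Ring C]

/-- The coefficientwise image of a Laurent series under a ring homomorphism. -/
def mapL (φ : B →+* C) : LaurentSeries B →+* LaurentSeries C where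
  toFun f := HahnSeries.map f φ
  map_one' := HahnSeries.map_one φ.toMonoidWithZeroHom
  map_mul' _ _ := HahnSeries.map_mul (φ : B →ₙ+* C)
  map_zero' := by ext; simp
  map_add' _ _ := by ext; simp

@[simp] lemma coeff_mapL (φ : B →+* C) (f : LaurentSeries B) (r : ℤ) :
    (mapL φ f).coeff r = φ (f.coeff r) := rfl

lemma mapL_C (φ : B →+* C) (b : B) : mapL φ (HahnSeries.C b) = HahnSeries.C (φ b) :=
  HahnSeries.map_C b φ

lemma mapL_single (φ : B →+* C) (r : ℤ) (b : B) :
    mapL φ (HahnSeries.single r b) = HahnSeries.single r (φ b) := by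
  ext s
  simp only [coeff_mapL, HahnSeries.coeff_single]
  split_ifs <;> simp

lemma mapL_uvar (φ : B →+* C) : mapL φ (uvar B) = uvar C := by
  simp [uvar, mapL_single]

lemma mapL_mapL {D : Type} [Ring D] (φ : B →+* C) (ψ : C →+* D) (f : LaurentSeries B) :
    mapL ψ (mapL φ f) = mapL (ψ.comp φ) f := rfl

/-- The coefficients of `f` vanish below `N`. -/
def VanishBelow (N : ℤ) (f : LaurentSeries B) : Prop := ∀ r < N, f.coeff r = 0

lemma vanishBelow_order (f : LaurentSeries B) : VanishBelow f.order f :=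
  fun _ h => HahnSeries.coeff_eq_zero_of_lt_order h

lemma VanishBelow.mono {N M : ℤ} {f : LaurentSeries B} (h : VanishBelow N f) (hMN : M ≤ N) :
    VanishBelow M f := fun r hr => h r (hr.trans_le hMN)

lemma VanishBelow.mul {N M : ℤ} {f g : LaurentSeries B} (hf : VanishBelow N f)
    (hg : VanishBelow M g) : VanishBelow (N + M) (f * g) := by
  intro r hr
  rw [HahnSeries.coeff_mul]
  refine Finset.sum_eq_zero fun ij hij => ?_
  rw [Finset.mem_antidiagonal] at hij
  by_cases h : ij.1 < N
  · rw [hf _ h, zero_mul]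
  · rw [hg _ (by omega), mul_zero]

lemma VanishBelow.add {f g : LaurentSeries B} {N : ℤ} (hf : VanishBelow N f)
    (hg : VanishBelow N g) : VanishBelow N (f + g) := by
  intro r hr
  rw [HahnSeries.coeff_add, hf r hr, hg r hr, add_zero]

lemma VanishBelow.sub_single {N : ℤ} {f : LaurentSeries B} (hf : VanishBelow N f) :
    VanishBelow (N + 1) (f - HahnSeries.single N (f.coeff N)) := by
  intro r hr
  rcases eq_or_ne r N with rfl | h
  · simp
  · rw [HahnSeries.coeff_sub, hf r (by omega), HahnSeries.coeff_single_of_ne h, sub_zero]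

lemma vanishBelow_single (N : ℤ) (b : B) : VanishBelow N (HahnSeries.single N b) :=
  fun _ h => HahnSeries.coeff_single_of_ne h.ne

/-- An additive map which respects orders and kills the monomials is zero. -/
lemma eq_zero_of_single (T : LaurentSeries B →+ LaurentSeries C) (c : ℤ)
    (hT : ∀ N f, VanishBelow N f → VanishBelow (N + c) (T f))
    (h1 : ∀ r b, T (HahnSeries.single r b) = 0) (f : LaurentSeries B) : T f = 0 := by
  -- Removing the lowest monomial raises the order and leaves `T f` unchanged, so after finitely
  -- many removals a given coefficient lies below the order. No convergence is involved.
  have key : ∀ (n : ℕ) (N s : ℤ) (f : LaurentSeries B), VanishBelow N f → s < N + c + n →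
      (T f).coeff s = 0 := by
    intro n
    induction n with
    | zero => intro N s f hf hs; exact hT N f hf s (by simpa using hs)
    | succ n ih =>
      intro N s f hf hs
      have := ih (N + 1) s _ hf.sub_single (by push_cast at hs ⊢; omega)
      rwa [map_sub, h1, sub_zero] at this
  ext s
  exact key (s + 1 - (f.order + c)).toNat f.order s f (vanishBelow_order f) (by omega)

lemma C_mul_mapL_algebraMap [Algebra ℂ B] (b : B) (f : LaurentSeries ℂ) :
    HahnSeries.C b * mapL (algebraMap ℂ B) f = mapL (algebraMap ℂ B) f * HahnSeries.C b := by
  ext r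
  simp only [HahnSeries.C_apply, HahnSeries.coeff_single_zero_mul,
    HahnSeries.coeff_mul_single_zero, coeff_mapL, Algebra.commutes]

end LaurentGeneralities

/-! ### The substitution `u ↦ ε u + a` is a ring homomorphism. -/

section Substitution

variable {B C : Type} [Ring B] [Ring C] [Algebra ℂ B] [Algebra ℂ C]

/-- The linear polynomial `ε u + a`. -/
def affine (ε : ℤˣ) (a : ℂ) : LaurentSeries ℂ :=
  HahnSeries.C (((ε : ℤ) : ℂ)) * uvar ℂ + HahnSeries.C a

lemma coeff_C {B : Type} [Ring B] (b : B) (r : ℤ) :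
    (HahnSeries.C b : LaurentSeries B).coeff r = if r = 0 then b else 0 := by
  rw [HahnSeries.C_apply, HahnSeries.coeff_single]
  split_ifs <;> rfl

lemma coeff_uvar {B : Type} [Ring B] (r : ℤ) :
    (uvar B).coeff r = if r = -1 then 1 else 0 := by
  rw [uvar, HahnSeries.coeff_single]
  split_ifs <;> rfl

lemma affine_coeff (ε : ℤˣ) (a : ℂ) (r : ℤ) :
    (affine ε a).coeff r = (if r = -1 then ((ε : ℤ) : ℂ) else 0) + if r = 0 then a else 0 := by
  rw [affine, HahnSeries.coeff_add, coeff_C, HahnSeries.C_apply,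
    HahnSeries.coeff_single_zero_mul, coeff_uvar]
  split_ifs <;> simp

lemma affine_ne_zero (ε : ℤˣ) (a : ℂ) : affine ε a ≠ 0 := by
  intro h
  have := affine_coeff ε a (-1)
  rw [h] at this
  rcases Int.units_eq_one_or ε with rfl | rfl <;> simp at this

lemma order_affine (ε : ℤˣ) (a : ℂ) : (affine ε a).order = -1 := by
  apply le_antisymm
  · apply HahnSeries.order_le_of_coeff_ne_zero
    rw [affine_coeff]
    rcases Int.units_eq_one_or ε with rfl | rfl <;> simp
  · rw [HahnSeries.le_order_iff_forall (affine_ne_zero ε a)]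
    intro r hr
    rw [affine_coeff, if_neg (by omega), if_neg (by omega), add_zero]

lemma order_inv_laurent {F : Type} [Field F] {f : LaurentSeries F} (hf : f ≠ 0) :
    (f⁻¹).order = -f.order := by
  have h := HahnSeries.order_mul hf (inv_ne_zero hf)
  rw [mul_inv_cancel₀ hf, HahnSeries.order_one] at h
  omega

lemma order_zpow_laurent {F : Type} [Field F] {f : LaurentSeries F} (hf : f ≠ 0) (k : ℤ) :
    (f ^ k).order = k * f.order := by
  cases k with
  | ofNat k => simp
  | negSucc k =>
    rw [zpow_negSucc, order_inv_laurent (pow_ne_zero _ hf), HahnSeries.order_pow]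
    simp [Int.negSucc_eq]; ring

lemma affine_zpow_coeff (ε : ℤˣ) (a : ℂ) {r s : ℤ} (h : s < r) :
    ((affine ε a) ^ (-r)).coeff s = 0 := by
  apply HahnSeries.coeff_eq_zero_of_lt_order
  rw [order_zpow_laurent (affine_ne_zero ε a), order_affine]
  simpa using h

/-- The definition starts the sum at the order, which behaves badly under addition. Any lower bound
serves equally well, since the additional terms vanish; two bounds are compared through their
minimum. -/
lemma substAffine_coeff (ε : ℤˣ) (a : ℂ) {f : LaurentSeries B} {N : ℤ} (hf : VanishBelow N f)
    (s : ℤ) : (substAffine ε a f).coeff s =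
      ∑ r ∈ Finset.Icc N s, ((affine ε a) ^ (-r)).coeff s • f.coeff r := by
  change ∑ r ∈ Finset.Icc f.order s, ((affine ε a) ^ (-r)).coeff s • f.coeff r = _
  have h : ∀ M : ℤ, VanishBelow M f → ∀ K ≤ M,
      ∑ r ∈ Finset.Icc M s, ((affine ε a) ^ (-r)).coeff s • f.coeff r =
      ∑ r ∈ Finset.Icc K s, ((affine ε a) ^ (-r)).coeff s • f.coeff r := by
    intro M hM K hK
    apply Finset.sum_subset
    · exact Finset.Icc_subset_Icc_left hK
    · intro r hr hr'
      simp only [Finset.mem_Icc] at hr hr'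
      rw [hM r (by omega), smul_zero]
  rw [h f.order (vanishBelow_order f) (min f.order N) (min_le_left _ _),
    h N hf (min f.order N) (min_le_right _ _)]

lemma VanishBelow.substAffine {f : LaurentSeries B} {N : ℤ} (hf : VanishBelow N f) (ε : ℤˣ)
    (a : ℂ) : VanishBelow N (substAffine ε a f) := by
  intro s hs
  rw [substAffine_coeff ε a hf, Finset.Icc_eq_empty (by omega), Finset.sum_empty]

/-- Since `(ε u + a)^{-r}` has order `r`, the truncation of the sum at the coefficient `s` loses
nothing. -/
lemma substAffine_single (ε : ℤˣ) (a : ℂ) (r : ℤ) (b : B) :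
    substAffine ε a (HahnSeries.single r b) =
      mapL (algebraMap ℂ B) ((affine ε a) ^ (-r)) * HahnSeries.C b := by
  ext s
  rw [substAffine_coeff ε a (vanishBelow_single r b), HahnSeries.C_apply,
    HahnSeries.coeff_mul_single_zero, coeff_mapL, ← Algebra.smul_def]
  by_cases h : r ≤ s
  · rw [Finset.sum_eq_single_of_mem r (by simp [h])]
    · simp
    · intro k _ hk
      rw [HahnSeries.coeff_single_of_ne hk, smul_zero]
  · rw [Finset.Icc_eq_empty h, Finset.sum_empty, affine_zpow_coeff _ _ (not_le.1 h), zero_smul]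

/-- The substitution `u ↦ ε u + a` as an additive map. -/
def substAdd (ε : ℤˣ) (a : ℂ) : LaurentSeries B →+ LaurentSeries B :=
  AddMonoidHom.mk' (substAffine ε a) fun f g => by
    ext s
    have hf := (vanishBelow_order f).mono (min_le_left f.order g.order)
    have hg := (vanishBelow_order g).mono (min_le_right f.order g.order)
    rw [HahnSeries.coeff_add, substAffine_coeff ε a (hf.add hg), substAffine_coeff ε a hf,
      substAffine_coeff ε a hg, ← Finset.sum_add_distrib]
    exact Finset.sum_congr rfl fun r _ => by rw [HahnSeries.coeff_add, smul_add]

/-- Both sides are additive in each factor and respect orders, so `eq_zero_of_single`, used once for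
each factor, reduces the claim to monomials. There it is the law of exponents for `ε u + a`,
together with the fact that complex series commute with constants of `B`. -/
lemma substAffine_mul (ε : ℤˣ) (a : ℂ) (f g : LaurentSeries B) :
    substAffine ε a (f * g) = substAffine ε a f * substAffine ε a g := by
  have h1 : ∀ (r : ℤ) (b : B) (g : LaurentSeries B),
      substAffine ε a (HahnSeries.single r b * g) =
        substAffine ε a (HahnSeries.single r b) * substAffine ε a g := by
    intro r b g
    let T : LaurentSeries B →+ LaurentSeries B :=
      (substAdd ε a).comp (AddMonoidHom.mulLeft (HahnSeries.single r b)) -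
        (AddMonoidHom.mulLeft (substAffine ε a (HahnSeries.single r b))).comp (substAdd ε a)
    refine sub_eq_zero.1 (eq_zero_of_single T r ?_ ?_ g)
    · intro N f hf
      have e1 := ((vanishBelow_single r b).mul hf).substAffine ε a
      have e2 := ((vanishBelow_single r b).substAffine ε a).mul (hf.substAffine ε a)
      intro s hs
      rw [add_comm] at hs
      exact (congrArg₂ (· - ·) (e1 s hs) (e2 s hs)).trans (sub_zero 0)
    · intro q c
      refine sub_eq_zero.2 ?_
      change substAffine ε a (HahnSeries.single r b * HahnSeries.single q c) =
        substAffine ε a (HahnSeries.single r b) * substAffine ε a (HahnSeries.single q c)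
      rw [HahnSeries.single_mul_single, substAffine_single, substAffine_single, substAffine_single,
        neg_add, zpow_add₀ (affine_ne_zero ε a), map_mul, map_mul, mul_assoc, mul_assoc,
        ← mul_assoc (HahnSeries.C b), C_mul_mapL_algebraMap, mul_assoc]
  let T : LaurentSeries B →+ LaurentSeries B :=
    (substAdd ε a).comp (AddMonoidHom.mulRight g) -
      (AddMonoidHom.mulRight (substAffine ε a g)).comp (substAdd ε a)
  refine sub_eq_zero.1 (eq_zero_of_single T g.order ?_ ?_ f)
  · intro N f hf
    have e1 := (hf.mul (vanishBelow_order g)).substAffine ε a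
    have e2 := (hf.substAffine ε a).mul ((vanishBelow_order g).substAffine ε a)
    intro s hs
    exact (congrArg₂ (· - ·) (e1 s hs) (e2 s hs)).trans (sub_zero 0)
  · intro r b
    exact sub_eq_zero.2 (h1 r b g)

lemma substAffine_C (ε : ℤˣ) (a : ℂ) (b : B) :
    substAffine ε a (HahnSeries.C b) = HahnSeries.C b := by
  rw [HahnSeries.C_apply, substAffine_single]
  simp

/-- The substitution `u ↦ ε u + a` as a ring homomorphism. -/
def substHom (ε : ℤˣ) (a : ℂ) : LaurentSeries B →+* LaurentSeries B where
  toFun := substAffine ε a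
  map_one' := by
    have := substAffine_C ε a (1 : B)
    rwa [map_one] at this
  map_mul' := substAffine_mul ε a
  map_zero' := (substAdd ε a).map_zero
  map_add' := (substAdd ε a).map_add

lemma substHom_apply (ε : ℤˣ) (a : ℂ) (f : LaurentSeries B) :
    substHom ε a f = substAffine ε a f := rfl

lemma substHom_C (ε : ℤˣ) (a : ℂ) (b : B) :
    substHom ε a (HahnSeries.C b) = HahnSeries.C b := substAffine_C ε a b

lemma substHom_uvar (ε : ℤˣ) (a : ℂ) :
    substHom ε a (uvar B) =
      HahnSeries.C ((ε : ℤ) : B) * uvar B + HahnSeries.C (algebraMap ℂ B a) := by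
  conv_lhs => rw [substHom_apply, uvar, substAffine_single]
  simp only [neg_neg, zpow_one, affine, map_add, map_mul, mapL_C, mapL_uvar, map_intCast, map_one,
    mul_one]

lemma substAffine_mapL (ε : ℤˣ) (a : ℂ) (φ : B →+* C)
    (hφ : ∀ z : ℂ, φ (algebraMap ℂ B z) = algebraMap ℂ C z) (f : LaurentSeries B) :
    substAffine ε a (mapL φ f) = mapL φ (substAffine ε a f) := by
  ext s
  have hf : VanishBelow f.order (mapL φ f) := fun r hr => by
    rw [coeff_mapL, vanishBelow_order f r hr, map_zero]
  rw [substAffine_coeff ε a hf, coeff_mapL, substAffine_coeff ε a (vanishBelow_order f), map_sum]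
  refine Finset.sum_congr rfl fun r _ => ?_
  rw [Algebra.smul_def, Algebra.smul_def, map_mul, hφ, coeff_mapL]

end Substitution

/-! ### Principal parts, polynomial series and leading terms. -/

section PrincipalPart

variable {B C : Type} [Ring B] [Ring C]

lemma principalPart_coeff (f : LaurentSeries B) (r : ℤ) :
    (principalPart f).coeff r = if 0 < r then f.coeff r else 0 := rfl

lemma principalPart_mapL (φ : B →+* C) (f : LaurentSeries B) :
    principalPart (mapL φ f) = mapL φ (principalPart f) := by
  ext r
  simp only [principalPart_coeff, coeff_mapL]
  split_ifs <;> simp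

lemma principalPart_add (f g : LaurentSeries B) :
    principalPart (f + g) = principalPart f + principalPart g := by
  ext r
  simp only [principalPart_coeff, HahnSeries.coeff_add]
  split_ifs <;> simp

/-- `principalPart` as an additive map. -/
def principalPartHom : LaurentSeries B →+ LaurentSeries B :=
  AddMonoidHom.mk' principalPart principalPart_add

lemma principalPart_mul_C (f : LaurentSeries B) (b : B) :
    principalPart (f * HahnSeries.C b) = principalPart f * HahnSeries.C b := by
  ext r
  simp only [principalPart_coeff, HahnSeries.C_apply, HahnSeries.coeff_mul_single_zero]
  split_ifs <;> simp

end PrincipalPart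

section Leading

variable {K : Type} [Ring K]

/-- The series has no negative powers of `u`. -/
def NoNegPowers (f : LaurentSeries K) : Prop := ∀ r, 0 < r → f.coeff r = 0

lemma NoNegPowers.mul {f g : LaurentSeries K} (hf : NoNegPowers f) (hg : NoNegPowers g) :
    NoNegPowers (f * g) := by
  intro r hr
  rw [HahnSeries.coeff_mul]
  refine Finset.sum_eq_zero fun ij hij => ?_
  rw [Finset.mem_antidiagonal] at hij
  by_cases h : 0 < ij.1
  · rw [hf _ h, zero_mul]
  · rw [hg _ (by omega), mul_zero]

lemma NoNegPowers.add {f g : LaurentSeries K} (hf : NoNegPowers f) (hg : NoNegPowers g) :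
    NoNegPowers (f + g) := fun r hr => by rw [HahnSeries.coeff_add, hf r hr, hg r hr, add_zero]

lemma noNegPowers_C (c : K) : NoNegPowers (HahnSeries.C c) := fun r hr => by
  rw [coeff_C, if_neg hr.ne']

lemma noNegPowers_uvar : NoNegPowers (uvar K) := fun r hr => by
  rw [coeff_uvar, if_neg (by omega)]

lemma NoNegPowers.principalPart {f : LaurentSeries K} (hf : NoNegPowers f) :
    principalPart f = 0 := by
  ext r
  rw [principalPart_coeff]
  split_ifs with h
  · exact hf r h
  · rfl

lemma VanishBelow.principalPart {f : LaurentSeries K} (hf : VanishBelow 1 f) :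
    principalPart f = f := by
  ext r
  rw [principalPart_coeff]
  split_ifs with h
  · rfl
  · exact (hf r (by omega)).symm

/-- `f` has the form `u^{-d} + ⋯`. -/
def MonicOf (d : ℤ) (f : LaurentSeries K) : Prop := VanishBelow d f ∧ f.coeff d = 1

lemma coeff_mul_of_vanishBelow {d e : ℤ} {f g : LaurentSeries K} (hf : VanishBelow d f)
    (hg : VanishBelow e g) : (f * g).coeff (d + e) = f.coeff d * g.coeff e := by
  rw [HahnSeries.coeff_mul, Finset.sum_eq_single (d, e)]
  · intro ij hij hne
    rw [Finset.mem_antidiagonal] at hij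
    rcases lt_trichotomy ij.1 d with h | h | h
    · rw [hf _ h, zero_mul]
    · exact absurd (Prod.ext h (by omega)) hne
    · rw [hg _ (by omega), mul_zero]
  · intro h
    by_contra h'
    apply h
    rw [Finset.mem_antidiagonal]
    exact ⟨left_ne_zero_of_mul h', right_ne_zero_of_mul h', rfl⟩

lemma MonicOf.mul {d e : ℤ} {f g : LaurentSeries K} (hf : MonicOf d f) (hg : MonicOf e g) :
    MonicOf (d + e) (f * g) :=
  ⟨hf.1.mul hg.1, by rw [coeff_mul_of_vanishBelow hf.1 hg.1, hf.2, hg.2, one_mul]⟩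

lemma monicOf_one : MonicOf 0 (1 : LaurentSeries K) := by
  refine ⟨fun r hr => ?_, ?_⟩
  · rw [HahnSeries.coeff_one, if_neg hr.ne]
  · rw [HahnSeries.coeff_one, if_pos rfl]

lemma MonicOf.pow {d : ℤ} {f : LaurentSeries K} (hf : MonicOf d f) (n : ℕ) :
    MonicOf (n * d) (f ^ n) := by
  induction n with
  | zero => simpa using monicOf_one
  | succ n ih =>
    rw [pow_succ]
    convert ih.mul hf using 1
    push_cast; ring

lemma MonicOf.add {d : ℤ} {f g : LaurentSeries K} (hf : MonicOf d f) (hg : VanishBelow (d + 1) g) :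
    MonicOf d (f + g) := by
  refine ⟨hf.1.add (hg.mono (by omega)), ?_⟩
  rw [HahnSeries.coeff_add, hf.2, hg d (by omega), add_zero]

lemma vanishBelow_C (c : K) : VanishBelow 0 (HahnSeries.C c : LaurentSeries K) := fun r hr => by
  rw [coeff_C, if_neg hr.ne]

lemma monicOf_uvar : MonicOf (-1) (uvar K) :=
  ⟨fun r hr => by rw [coeff_uvar, if_neg hr.ne], by rw [coeff_uvar, if_pos rfl]⟩

/-- `u + c`. -/
def lin (c : K) : LaurentSeries K := uvar K + HahnSeries.C c

lemma monicOf_lin (c : K) : MonicOf (-1) (lin c) :=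
  monicOf_uvar.add (by simpa using vanishBelow_C c)

lemma monicOf_lin_sq_sub (c t : K) : MonicOf (-2) (lin c ^ 2 - HahnSeries.C t) := by
  rw [sub_eq_add_neg, ← map_neg]
  exact ((monicOf_lin c).pow 2).add ((vanishBelow_C _).mono (by norm_num))

lemma noNegPowers_lin (c : K) : NoNegPowers (lin c) := noNegPowers_uvar.add (noNegPowers_C c)

end Leading

section CommLeading

variable {K : Type} [CommRing K]

lemma NoNegPowers.eval₂ {T : LaurentSeries K} (hT : NoNegPowers T) (Q : Polynomial K) :
    NoNegPowers (Q.eval₂ (HahnSeries.C) T) := by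
  induction Q using Polynomial.induction_on with
  | C a => simpa using noNegPowers_C a
  | add p q hp hq => rw [Polynomial.eval₂_add]; exact hp.add hq
  | monomial n a h =>
    rw [pow_succ, ← mul_assoc, Polynomial.eval₂_mul, Polynomial.eval₂_X]
    exact h.mul hT

lemma MonicOf.prod {α : Type} (s : Finset α) {d : α → ℤ} {f : α → LaurentSeries K}
    (hf : ∀ i, MonicOf (d i) (f i)) : MonicOf (∑ i ∈ s, d i) (∏ i ∈ s, f i) := by
  classical
  induction s using Finset.induction_on with
  | empty => simpa using monicOf_one
  | insert a s ha ih => rw [Finset.sum_insert ha, Finset.prod_insert ha]; exact (hf a).mul ih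

/-- Over a domain a unit leading coefficient suffices. This makes the occurrences of `Ring.inverse`
genuine inverses already over the localization, which need not be a field. -/
lemma MonicOf.isUnit [IsDomain K] {d : ℤ} {f : LaurentSeries K} (hf : MonicOf d f) :
    IsUnit f := by
  have h0 : f ≠ 0 := by
    rintro rfl
    simpa using hf.2
  have ho : f.order = d := le_antisymm (HahnSeries.order_le_of_coeff_ne_zero (by simp [hf.2]))
    ((HahnSeries.le_order_iff_forall h0).2 hf.1)
  rw [HahnSeries.isUnit_iff, HahnSeries.leadingCoeff_eq, ho, hf.2]
  exact isUnit_one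

end CommLeading

/-! ### Partial fractions and principal parts of rational functions. -/

section PartialFractions

/-- Partial fractions: division by a product of distinct linear factors, evaluated in an
extension field. -/
lemma eval₂_div_prod {K L P : Type} [Field K] [Field L] [Fintype P] [DecidableEq P] (f : K →+* L)
    (t : P → K) (ht : Function.Injective t) (N : Polynomial K) (T : L) (hT : ∀ p, T - f (t p) ≠ 0) :
    ∃ Q : Polynomial K, N.eval₂ f T / ∏ p, (T - f (t p)) = Q.eval₂ f T +
      ∑ p, f (N.eval (t p) / ∏ q ∈ Finset.univ.erase p, (t p - t q)) * (T - f (t p))⁻¹ := by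
  have hm := Lagrange.nodal_monic (s := Finset.univ) (v := t)
  refine ⟨N /ₘ Lagrange.nodal Finset.univ t, ?_⟩
  -- The remainder has degree below the number of nodes and the same values at them as `N`, so it is
  -- the Lagrange interpolant. Dividing the Lagrange basis by the nodal polynomial gives the simple
  -- fractions.
  have h1 : N %ₘ Lagrange.nodal Finset.univ t =
      Lagrange.interpolate Finset.univ t (fun p => N.eval (t p)) := by
    apply Lagrange.eq_interpolate_of_eval_eq _ ht.injOn
    · rw [← Lagrange.degree_nodal (R := K) (s := Finset.univ) (v := t)]
      exact Polynomial.degree_modByMonic_lt _ hm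
    · intro p hp
      have := congrArg (Polynomial.eval (t p))
        (Polynomial.modByMonic_add_div N (Lagrange.nodal Finset.univ t))
      simpa [Lagrange.eval_nodal_at_node hp] using this
  have h2 := congrArg (Polynomial.eval₂ f T)
    (Polynomial.modByMonic_add_div N (Lagrange.nodal Finset.univ t))
  have h3 : (Lagrange.nodal Finset.univ t).eval₂ f T = ∏ p, (T - f (t p)) := by
    simp [Lagrange.nodal, Polynomial.eval₂_finsetProd]
  have h4 : ∏ p, (T - f (t p)) ≠ 0 := Finset.prod_ne_zero_iff.2 fun p _ => hT p
  rw [Polynomial.eval₂_add, Polynomial.eval₂_mul, h3, h1] at h2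
  rw [← h2, add_div, mul_div_cancel_left₀ _ h4, add_comm]
  congr 1
  rw [Lagrange.interpolate_apply, Polynomial.eval₂_finsetSum, Finset.sum_div]
  refine Finset.sum_congr rfl fun p _ => ?_
  rw [Polynomial.eval₂_mul, Polynomial.eval₂_C, Lagrange.basis, Polynomial.eval₂_finsetProd,
    ← Finset.mul_prod_erase _ _ (Finset.mem_univ p)]
  have h5 : ∏ q ∈ Finset.univ.erase p, (T - f (t q)) ≠ 0 :=
    Finset.prod_ne_zero_iff.2 fun q _ => hT q
  have h6 : ∏ q ∈ Finset.univ.erase p,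
      Polynomial.eval₂ f T (Lagrange.basisDivisor (t p) (t q)) =
      (∏ q ∈ Finset.univ.erase p, f (t p - t q))⁻¹ *
        ∏ q ∈ Finset.univ.erase p, (T - f (t q)) := by
    rw [← Finset.prod_inv_distrib, ← Finset.prod_mul_distrib]
    refine Finset.prod_congr rfl fun q _ => ?_
    simp [Lagrange.basisDivisor]
  rw [h6, map_div₀, map_prod, div_eq_mul_inv, div_eq_mul_inv, mul_inv]
  have := hT p
  field_simp

variable {K : Type} [Field K]

lemma MonicOf.ne_zero {d : ℤ} {f : LaurentSeries K} (hf : MonicOf d f) : f ≠ 0 := by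
  rintro rfl
  simpa using hf.2

lemma MonicOf.order_eq {d : ℤ} {f : LaurentSeries K} (hf : MonicOf d f) : f.order = d :=
  le_antisymm (HahnSeries.order_le_of_coeff_ne_zero (by simp [hf.2]))
    ((HahnSeries.le_order_iff_forall hf.ne_zero).2 hf.1)

lemma MonicOf.inv {d : ℤ} {f : LaurentSeries K} (hf : MonicOf d f) : MonicOf (-d) f⁻¹ := by
  have h0 := hf.ne_zero
  have ho : (f⁻¹).order = -d := by rw [order_inv_laurent h0, hf.order_eq]
  have hv : VanishBelow (-d) f⁻¹ := ho ▸ vanishBelow_order _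
  refine ⟨hv, ?_⟩
  have h1 := coeff_mul_of_vanishBelow hf.1 hv
  rwa [mul_inv_cancel₀ h0, add_neg_cancel, HahnSeries.coeff_one, if_pos rfl, hf.2, one_mul,
    eq_comm] at h1

lemma MonicOf.zpow {d : ℤ} {f : LaurentSeries K} (hf : MonicOf d f) (n : ℤ) :
    MonicOf (n * d) (f ^ n) := by
  cases n with
  | ofNat n => simpa using hf.pow n
  | negSucc n =>
    rw [zpow_negSucc]
    convert (hf.pow (n + 1)).inv using 1
    rw [Int.negSucc_eq]; push_cast; ring

lemma lin_ne_zero (c : K) : lin c ≠ 0 := (monicOf_lin c).ne_zero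

/-- The principal part of a rational function of `(u + c)²` with simple poles, multiplied by a
polynomial of degree at most one. -/
lemma principalPart_div_prod {P : Type} [Fintype P] [DecidableEq P] (c : K) (t : P → K)
    (ht : Function.Injective t) (N : Polynomial K) {e : LaurentSeries K} (he : NoNegPowers e)
    (he' : VanishBelow (-1) e) :
    principalPart (e * (N.eval₂ HahnSeries.C (lin c ^ 2) /
        ∏ p, (lin c ^ 2 - HahnSeries.C (t p)))) =
      ∑ p, e * (HahnSeries.C (N.eval (t p) / ∏ q ∈ Finset.univ.erase p, (t p - t q)) *
        (lin c ^ 2 - HahnSeries.C (t p))⁻¹) := by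
  obtain ⟨Q, hQ⟩ := eval₂_div_prod (HahnSeries.C : K →+* LaurentSeries K) t ht N (lin c ^ 2)
    fun p => (monicOf_lin_sq_sub c (t p)).ne_zero
  have hsq : NoNegPowers (lin c ^ 2) := by
    rw [sq]; exact (noNegPowers_lin c).mul (noNegPowers_lin c)
  -- The polynomial part contributes no negative power of `u`. Each fraction has order two and `e`
  -- has order at least `-1`, so the remaining sum is its own principal part.
  rw [hQ, mul_add, principalPart_add, (he.mul (hsq.eval₂ Q)).principalPart, zero_add,
    Finset.mul_sum, VanishBelow.principalPart]
  intro r hr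
  have hterm : ∀ p, VanishBelow 1 (e * (HahnSeries.C
      (N.eval (t p) / ∏ q ∈ Finset.univ.erase p, (t p - t q)) *
        (lin c ^ 2 - HahnSeries.C (t p))⁻¹)) := fun p =>
    (he'.mul ((vanishBelow_C _).mul (monicOf_lin_sq_sub c (t p)).inv.1)).mono (by norm_num)
  rw [HahnSeries.coeff_sum]
  exact Finset.sum_eq_zero fun p _ => hterm p r hr

end PartialFractions

/-! ### Commutation relations that follow from the exchange axioms alone. -/

/-- Elements `χ_p` of a ring over a field `F`, which commute past scalars up to automorphisms of
`F`, and satisfy quadratic exchange relations governed by parameters `w_p`. -/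
structure ShiftData (F T P : Type) [Field F] [Ring T] where
  ι : F →+* T
  w : P → F
  χ : P → T
  σ : P → F →+* F
  bar : P → P
  φ : P → F
  χ_mul : ∀ p f, χ p * ι f = ι (σ p f) * χ p
  bar_bar : ∀ p, bar (bar p) = p
  σ_self : ∀ p, p ≠ bar p → σ p (w p) = w p - 1
  σ_bar : ∀ p, σ p (w (bar p)) = 1 - w p
  σ_ne : ∀ p q, q ≠ p → q ≠ bar p → σ p (w q) = w q
  exch : ∀ p q, q ≠ p → q ≠ bar p →
    ι (w q - w p + 1) * (χ p * χ q) = ι (w q - w p - 1) * (χ q * χ p)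
  χ_bar : ∀ p, χ p * χ (bar p) = ι (φ p)

namespace ShiftData

variable {F T P : Type} [Field F] [Ring T] (D : ShiftData F T P)

section Basic

lemma χ_mul_assoc (p : P) (f : F) (t : T) : D.χ p * (D.ι f * t) = D.ι (D.σ p f) * (D.χ p * t) := by
  rw [← mul_assoc, D.χ_mul, mul_assoc]

/-- At a fixed point of `bar` the value is `1 - w_p` rather than `w_p - 1`. The square does not see
the sign, so the extra pole needs no separate treatment later. -/
lemma σ_w_sq (p : P) : D.σ p (D.w p) ^ 2 = (D.w p - 1) ^ 2 := by
  by_cases h : p = D.bar p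
  · have := D.σ_bar p
    rw [← h] at this
    rw [this]
    ring
  · rw [D.σ_self p h]

lemma ι_mul_ι_mul (f g : F) (t : T) : D.ι f * (D.ι g * t) = D.ι (f * g) * t := by
  rw [map_mul, mul_assoc]

variable [Fintype P]

/-- The generating function `∑_p (X - w_p)⁻¹ χ_p`. -/
def E (X : F) : T := ∑ p, D.ι ((X - D.w p)⁻¹) * D.χ p

lemma sum_mul_sum (a b : P → F) :
    (∑ p, D.ι (a p) * D.χ p) * (∑ q, D.ι (b q) * D.χ q) =
      ∑ p, ∑ q, D.ι (a p * D.σ p (b q)) * (D.χ p * D.χ q) := by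
  rw [Finset.sum_mul_sum]
  refine Finset.sum_congr rfl fun p _ => Finset.sum_congr rfl fun q _ => ?_
  rw [mul_assoc, D.χ_mul_assoc, D.ι_mul_ι_mul]

lemma eq_zero_of_add_self [CharZero F] (ι : F →+* T) {t : T} (h : t + t = 0) : t = 0 := by
  have h2 : ι 2⁻¹ * (t + t) = t := by
    rw [← two_mul, ← mul_assoc, ← map_ofNat ι 2, ← map_mul, inv_mul_cancel₀ two_ne_zero, map_one,
      one_mul]
  rw [← h2, h, mul_zero]

/-- Off the graph of the involution the summand is antisymmetric, so that part of the double sum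
equals its own negative; and `2` is invertible. -/
lemma sum_eq_sum_bar [CharZero F] (f : P → P → T)
    (h : ∀ p q, q ≠ D.bar p → f p q + f q p = 0) :
    ∑ p, ∑ q, f p q = ∑ p, f p (D.bar p) := by
  classical
  let g : P → P → T := fun p q => if q = D.bar p then 0 else f p q
  have h1 : ∀ p, ∑ q, f p q = f p (D.bar p) + ∑ q, g p q := by
    intro p
    have e : ∀ q, f p q = (if q = D.bar p then f p (D.bar p) else 0) + g p q := by
      intro q
      by_cases hq : q = D.bar p
      · simp [g, hq]
      · simp [g, hq]
    rw [Finset.sum_congr rfl fun q _ => e q, Finset.sum_add_distrib]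
    simp
  have h2 : ∑ p, ∑ q, g p q = 0 := by
    apply eq_zero_of_add_self D.ι
    nth_rw 2 [Finset.sum_comm]
    rw [← Finset.sum_add_distrib]
    refine Finset.sum_eq_zero fun p _ => ?_
    rw [← Finset.sum_add_distrib]
    refine Finset.sum_eq_zero fun q _ => ?_
    by_cases hq : q = D.bar p
    · have hp : p = D.bar q := by rw [hq, D.bar_bar]
      simp [g, if_pos hq, if_pos hp]
    · have hp : p ≠ D.bar q := fun hp => hq (by rw [hp, D.bar_bar])
      simp only [g, if_neg hq, if_neg hp]
      exact h p q hq
  rw [Finset.sum_congr rfl fun p _ => h1 p, Finset.sum_add_distrib, h2, add_zero]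

lemma E_mul_E {X Y : F} : D.E X * D.E Y =
    ∑ p, ∑ q, D.ι ((X - D.w p)⁻¹ * D.σ p ((Y - D.w q)⁻¹)) * (D.χ p * D.χ q) :=
  D.sum_mul_sum _ _

lemma E_sub_E_sq {X Y : F} : (D.E X - D.E Y) ^ 2 =
    ∑ p, ∑ q, D.ι (((X - D.w p)⁻¹ - (Y - D.w p)⁻¹) *
      D.σ p ((X - D.w q)⁻¹ - (Y - D.w q)⁻¹)) * (D.χ p * D.χ q) := by
  rw [← D.sum_mul_sum, sq]
  simp only [E, map_sub, sub_mul, Finset.sum_sub_distrib]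

end Basic

section Finite

variable [Fintype P]

/-- The function with residues `2 (1 - w_p) φ_p` at `(w_p - 1/2)²`, evaluated at `(X - 1/2)²`. -/
def G (X : F) : F := ∑ p, 2 * (1 - D.w p) * D.φ p * ((X - D.w p) * (X + D.w p - 1))⁻¹

/-- After the squared term is moved to the left, the coefficient of `χ_p χ_q` is the scalar `M p q`.
For `q = p` it vanishes because `σ_p` lowers `w_p` by one. For unrelated `p`, `q` the values `M p q`
and `-M q p` have a common factor times `w_q - w_p ± 1`, and the exchange relation cancels the pair.
Only opposite poles survive, where `χ_p χ_{bar p}` is a scalar; they sum to the difference of `G` at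
`X` and `Y`. -/
theorem E_comm_E [CharZero F] {X Y : F} (hX : ∀ p, D.σ p X = X) (hY : ∀ p, D.σ p Y = Y)
    (h1 : ∀ p, X - D.w p ≠ 0) (h2 : ∀ p, Y - D.w p ≠ 0)
    (h3 : ∀ p, X - D.w p + 1 ≠ 0) (h4 : ∀ p, Y - D.w p + 1 ≠ 0)
    (h5 : ∀ p, X + D.w p - 1 ≠ 0) (h6 : ∀ p, Y + D.w p - 1 ≠ 0) :
    D.ι ((X - Y) * (X + Y - 1)) * comm (D.E X) (D.E Y) =
      -(D.ι (X + Y - 1) * (D.E X - D.E Y) ^ 2) - D.ι (X - Y) * (D.ι (D.G X) - D.ι (D.G Y)) := by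
  let M : P → P → F := fun p q =>
    (X - Y) * (X + Y - 1) * ((X - D.w p)⁻¹ * D.σ p ((Y - D.w q)⁻¹) -
        (Y - D.w p)⁻¹ * D.σ p ((X - D.w q)⁻¹)) +
      (X + Y - 1) * (((X - D.w p)⁻¹ - (Y - D.w p)⁻¹) *
        D.σ p ((X - D.w q)⁻¹ - (Y - D.w q)⁻¹))
  have key : D.ι ((X - Y) * (X + Y - 1)) * comm (D.E X) (D.E Y) +
      D.ι (X + Y - 1) * (D.E X - D.E Y) ^ 2 = ∑ p, ∑ q, D.ι (M p q) * (D.χ p * D.χ q) := by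
    simp only [comm, E_mul_E, E_sub_E_sq, ← Finset.sum_sub_distrib, Finset.mul_sum,
      ← Finset.sum_add_distrib]
    refine Finset.sum_congr rfl fun p _ => Finset.sum_congr rfl fun q _ => ?_
    simp only [M, map_add, map_mul, map_sub]
    noncomm_ring
  rw [D.sum_eq_sum_bar] at key
  · have h : ∀ p, D.ι (M p (D.bar p)) * (D.χ p * D.χ (D.bar p)) =
        D.ι (-((X - Y) * (2 * (1 - D.w p) * D.φ p * ((X - D.w p) * (X + D.w p - 1))⁻¹ -
          2 * (1 - D.w p) * D.φ p * ((Y - D.w p) * (Y + D.w p - 1))⁻¹))) := by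
      intro p
      rw [D.χ_bar, ← map_mul]
      congr 1
      simp only [M, map_sub, map_inv₀, hX, hY, D.σ_bar]
      have e5 : X - (1 - D.w p) ≠ 0 := by convert h5 p using 1; ring
      have e6 : Y - (1 - D.w p) ≠ 0 := by convert h6 p using 1; ring
      have := h1 p; have := h2 p; have := h5 p; have := h6 p
      field_simp
      ring
    have hs : ∑ p, D.ι (M p (D.bar p)) * (D.χ p * D.χ (D.bar p)) =
        -(D.ι (X - Y) * (D.ι (D.G X) - D.ι (D.G Y))) := by
      rw [Finset.sum_congr rfl fun p _ => h p, ← map_sum, Finset.sum_neg_distrib, ← Finset.mul_sum,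
        Finset.sum_sub_distrib, map_neg, map_mul, ← map_sub]
      rfl
    rw [hs] at key
    rw [eq_sub_iff_add_eq, eq_neg_iff_add_eq_zero, add_right_comm, key, neg_add_cancel]
  · intro p q hq
    by_cases hpq : q = p
    · subst hpq
      have : M q q = 0 := by
        simp only [M, map_sub, map_inv₀, hX, hY, D.σ_self q hq]
        have e3 : X - (D.w q - 1) ≠ 0 := by convert h3 q using 1; ring
        have e4 : Y - (D.w q - 1) ≠ 0 := by convert h4 q using 1; ring
        have := h1 q; have := h2 q
        field_simp
        ring
      simp [this]
    · have hp : p ≠ D.bar q := fun hp => hq (by rw [hp, D.bar_bar])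
      let m := (X - Y) * (X + Y - 1) * (X - Y) * ((X - D.w p)⁻¹ * (Y - D.w p)⁻¹ *
        (X - D.w q)⁻¹ * (Y - D.w q)⁻¹)
      have e1 : M p q = m * (D.w q - D.w p + 1) := by
        simp only [M, m, map_sub, map_inv₀, hX, hY, D.σ_ne p q hpq hq]
        have := h1 p; have := h2 p; have := h1 q; have := h2 q
        field_simp
        ring
      have e2 : M q p = -(m * (D.w q - D.w p - 1)) := by
        simp only [M, m, map_sub, map_inv₀, hX, hY, D.σ_ne q p (Ne.symm hpq) hp]
        have := h1 p; have := h2 p; have := h1 q; have := h2 q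
        field_simp
        ring
      rw [e1, e2, map_neg, map_mul D.ι m, map_mul D.ι m, mul_assoc, D.exch p q hpq hq]
      noncomm_ring

/-- The commutation relation of `E` with an element which is rescaled like
`∏ (X² - w_p²)` by the automorphisms. -/
theorem ι_comm_E {X Y d : F}
    (hd : ∀ p, D.σ p d * ((X - D.w p) * (X + D.w p)) =
      d * ((X - D.w p + 1) * (X + D.w p - 1)))
    (h1 : ∀ p, X - D.w p ≠ 0) (h2 : ∀ p, Y - D.w p ≠ 0) (h3 : ∀ p, X + D.w p ≠ 0)
    (h4 : ∀ p, X + D.w p - 1 ≠ 0) :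
    D.ι ((X - Y) * (X + Y - 1)) * comm (D.ι d) (D.E Y) =
      D.ι (X + Y - 1) * (D.ι d * (D.E X - D.E Y)) +
        D.ι (X - Y) * ((D.E Y - D.E (1 - X)) * D.ι d) := by
  simp only [comm, E, Finset.mul_sum, Finset.sum_mul, ← Finset.sum_sub_distrib,
    ← Finset.sum_add_distrib]
  -- Each side is linear in the `χ_p`. Once all scalars stand to the left, the claim is a rational
  -- identity for each pole separately, and the exchange relation plays no role.
  refine Finset.sum_congr rfl fun p _ => ?_
  simp only [sub_mul, mul_sub, mul_assoc, D.χ_mul, D.ι_mul_ι_mul]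
  simp only [← mul_assoc]
  simp only [← sub_mul, ← map_sub, ← add_mul, ← map_add]
  have hd' : D.σ p d = d * ((X - D.w p + 1) * (X + D.w p - 1)) / ((X - D.w p) * (X + D.w p)) := by
    rw [eq_div_iff (mul_ne_zero (h1 p) (h3 p)), hd]
  rw [hd']
  have := h1 p; have := h2 p; have := h3 p; have := h4 p
  have e : 1 - X - D.w p ≠ 0 := by
    rw [← neg_ne_zero]; convert h4 p using 1; ring
  congr 2
  field_simp
  ring

/-- The commutation relation of `E` with an element which is rescaled like
`∏ ((X - 1)² - w_p²)⁻¹` by the automorphisms. -/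
theorem E_comm_ι {X Y d : F}
    (hd : ∀ p, D.σ p d * ((X - D.w p) * (X + D.w p - 2)) =
      d * ((X - D.w p - 1) * (X + D.w p - 1)))
    (h1 : ∀ p, X - D.w p ≠ 0) (h2 : ∀ p, Y - D.w p ≠ 0) (h3 : ∀ p, X + D.w p - 2 ≠ 0)
    (h4 : ∀ p, X + D.w p - 1 ≠ 0) :
    D.ι ((X - Y) * (X + Y - 1)) * comm (D.E Y) (D.ι d) =
      D.ι (X + Y - 1) * (D.ι d * (D.E X - D.E Y)) +
        D.ι (X - Y) * ((D.E Y - D.E (1 - X)) * D.ι d) := by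
  simp only [comm, E, Finset.mul_sum, Finset.sum_mul, ← Finset.sum_sub_distrib,
    ← Finset.sum_add_distrib]
  refine Finset.sum_congr rfl fun p _ => ?_
  simp only [sub_mul, mul_sub, mul_assoc, D.χ_mul, D.ι_mul_ι_mul]
  simp only [← mul_assoc]
  simp only [← sub_mul, ← map_sub, ← add_mul, ← map_add]
  have hd' : D.σ p d =
      d * ((X - D.w p - 1) * (X + D.w p - 1)) / ((X - D.w p) * (X + D.w p - 2)) := by
    rw [eq_div_iff (mul_ne_zero (h1 p) (h3 p)), hd]
  rw [hd']
  have := h1 p; have := h2 p; have := h3 p; have := h4 p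
  have e : 1 - X - D.w p ≠ 0 := by
    rw [← neg_ne_zero]; convert h4 p using 1; ring
  congr 2
  field_simp
  ring

/-- The sum of the elements `χ_p`. -/
def S : T := ∑ p, D.χ p

end Finite

variable {D} {Q : Type} {D' : ShiftData F T Q}

variable (D D') in
/-- Two families over the same field whose automorphisms fix the parameters of the other one. -/
structure Independent : Prop where
  ι_eq : D'.ι = D.ι
  σ_left : ∀ p q, D.σ p (D'.w q) = D'.w q
  σ_right : ∀ p q, D'.σ q (D.w p) = D.w p

variable (D D') in
/-- Two families which commute. -/
structure Commuting : Prop extends Independent D D' where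
  χ_comm : ∀ p q, D.χ p * D'.χ q = D'.χ q * D.χ p

variable (D D') in
/-- Two families attached to adjacent nodes. -/
structure Adjacent : Prop extends Independent D D' where
  exch : ∀ p q, D.ι (D.w p - D'.w q + 2⁻¹) * (D.χ p * D'.χ q) =
    D.ι (D.w p - D'.w q - 2⁻¹) * (D'.χ q * D.χ p)

lemma Independent.sum_mul_sum [Fintype P] [Fintype Q] (h : Independent D D') (a : P → F) (b : Q → F)
    (hb : ∀ p q, D.σ p (b q) = b q) :
    (∑ p, D.ι (a p) * D.χ p) * (∑ q, D'.ι (b q) * D'.χ q) =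
      ∑ p, ∑ q, D.ι (a p * b q) * (D.χ p * D'.χ q) := by
  rw [Finset.sum_mul_sum]
  refine Finset.sum_congr rfl fun p _ => Finset.sum_congr rfl fun q _ => ?_
  rw [h.ι_eq, mul_assoc, D.χ_mul_assoc, D.ι_mul_ι_mul, hb]

lemma Independent.sum_mul_sum' [Fintype P] [Fintype Q] (h : Independent D D') (a : P → F) (b : Q → F)
    (ha : ∀ p q, D'.σ q (a p) = a p) :
    (∑ q, D'.ι (b q) * D'.χ q) * (∑ p, D.ι (a p) * D.χ p) =
      ∑ p, ∑ q, D.ι (a p * b q) * (D'.χ q * D.χ p) := by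
  rw [Finset.sum_mul_sum, Finset.sum_comm]
  refine Finset.sum_congr rfl fun p _ => Finset.sum_congr rfl fun q _ => ?_
  rw [← h.ι_eq, mul_assoc, D'.χ_mul_assoc, D'.ι_mul_ι_mul, ha, mul_comm (a p)]

lemma Independent.σ_inv_left (h : Independent D D') {Y : F} (hY : ∀ p, D.σ p Y = Y) (p : P)
    (q : Q) : D.σ p (Y - D'.w q)⁻¹ = (Y - D'.w q)⁻¹ := by
  rw [map_inv₀, map_sub, hY, h.σ_left]

lemma Independent.σ_inv_right (h : Independent D D') {X : F} (hX : ∀ q, D'.σ q X = X) (p : P)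
    (q : Q) : D'.σ q (X - D.w p)⁻¹ = (X - D.w p)⁻¹ := by
  rw [map_inv₀, map_sub, hX, h.σ_right]

theorem Commuting.E_comm_E [Fintype P] [Fintype Q] (h : Commuting D D') {X Y : F} (hX : ∀ q, D'.σ q X = X)
    (hY : ∀ p, D.σ p Y = Y) : comm (D.E X) (D'.E Y) = 0 := by
  simp only [comm, E]
  rw [h.sum_mul_sum _ _ (h.σ_inv_left hY), h.sum_mul_sum' _ _ (h.σ_inv_right hX)]
  simp only [h.χ_comm, sub_self]

/-- Expanding `w_p - w'_q - 1/2 = (X - Y - 1/2) - (X - w_p) + (Y - w'_q)`, each summand is the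
exchange relation multiplied by `(X - w_p)⁻¹ (Y - w'_q)⁻¹`. The last two terms on the right cancel
one denominator each and produce the sums `S`. -/
theorem Adjacent.E_comm_E [Fintype P] [Fintype Q] [CharZero F] (h : Adjacent D D') {X Y : F} (hX : ∀ q, D'.σ q X = X)
    (hY : ∀ p, D.σ p Y = Y) (h1 : ∀ p, X - D.w p ≠ 0) (h2 : ∀ q, Y - D'.w q ≠ 0) :
    D.ι (X - Y - 2⁻¹) * comm (D.E X) (D'.E Y) =
      -(D.E X * D'.E Y) + comm D.S (D'.E Y) - comm (D.E X) D'.S := by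
  have hS : D.S = ∑ p, D.ι 1 * D.χ p := by simp [S]
  have hS' : D'.S = ∑ p, D'.ι 1 * D'.χ p := by simp [S]
  have hb := h.σ_inv_left hY
  have ha := h.σ_inv_right hX
  simp only [comm, E, hS, hS']
  rw [h.sum_mul_sum _ _ hb, h.sum_mul_sum' _ _ ha, h.sum_mul_sum _ _ hb,
    h.sum_mul_sum' _ _ (by simp), h.sum_mul_sum _ _ (by simp), h.sum_mul_sum' _ _ ha]
  simp only [Finset.mul_sum, ← Finset.sum_sub_distrib, ← Finset.sum_add_distrib,
    ← Finset.sum_neg_distrib]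
  refine Finset.sum_congr rfl fun p _ => Finset.sum_congr rfl fun q _ => ?_
  have e1 : D.ι ((X - D.w p)⁻¹ * (Y - D'.w q)⁻¹ * (D.w p - D'.w q + 2⁻¹)) * (D.χ p * D'.χ q) -
      D.ι ((X - D.w p)⁻¹ * (Y - D'.w q)⁻¹ * (D.w p - D'.w q - 2⁻¹)) * (D'.χ q * D.χ p) = 0 := by
    rw [map_mul, map_mul D.ι (_ * _), mul_assoc, mul_assoc, h.exch p q, sub_self]
  have e2 : (X - D.w p)⁻¹ * (Y - D'.w q)⁻¹ * (D.w p - D'.w q - 2⁻¹) =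
      (X - Y - 2⁻¹) * ((X - D.w p)⁻¹ * (Y - D'.w q)⁻¹) - 1 * (Y - D'.w q)⁻¹ +
        (X - D.w p)⁻¹ * 1 := by
    have := h1 p; have := h2 q
    field_simp
    ring
  have e3 : (X - D.w p)⁻¹ * (Y - D'.w q)⁻¹ * (D.w p - D'.w q + 2⁻¹) =
      (X - Y - 2⁻¹) * ((X - D.w p)⁻¹ * (Y - D'.w q)⁻¹) - 1 * (Y - D'.w q)⁻¹ +
        (X - D.w p)⁻¹ * 1 + (X - D.w p)⁻¹ * (Y - D'.w q)⁻¹ := by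
    have := h1 p; have := h2 q
    field_simp
    ring
  rw [← sub_eq_zero, ← e1, e2, e3]
  generalize (X - D.w p)⁻¹ * (Y - D'.w q)⁻¹ = c
  simp only [map_add, map_sub, map_mul]
  noncomm_ring

/-- The Serre combination `χ_p χ_p' χ_q - 2 χ_p χ_q χ_p' + χ_q χ_p χ_p'`. -/
def tri (D : ShiftData F T P) (c : T) (p p' : P) : T :=
  D.χ p * D.χ p' * c - 2 * (D.χ p * c * D.χ p') + c * D.χ p * D.χ p'

/-- Moving `χ'_q` to the far left costs one exchange ratio per factor `χ` that it passes. The ratio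
from `χ_{p'}` then has to cross `χ_p`, which applies `σ_p` to it. -/
lemma Adjacent.tri_eq [CharZero F] (h : Adjacent D D') (p p' : P) (q : Q)
    (hn : ∀ p, D.w p - D'.w q + 2⁻¹ ≠ 0) :
    tri D (D'.χ q) p p' = D.ι (
      D.σ p ((D.w p' - D'.w q - 2⁻¹) / (D.w p' - D'.w q + 2⁻¹)) *
        ((D.w p - D'.w q - 2⁻¹) / (D.w p - D'.w q + 2⁻¹)) -
      2 * ((D.w p - D'.w q - 2⁻¹) / (D.w p - D'.w q + 2⁻¹)) + 1) *
      (D'.χ q * (D.χ p * D.χ p')) := by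
  have e : ∀ p, D.χ p * D'.χ q =
      D.ι ((D.w p - D'.w q - 2⁻¹) / (D.w p - D'.w q + 2⁻¹)) * (D'.χ q * D.χ p) := by
    intro p
    rw [div_eq_inv_mul, map_mul, mul_assoc, ← h.exch, ← mul_assoc, ← map_mul,
      inv_mul_cancel₀ (hn p), map_one, one_mul]
  rw [tri, mul_assoc (D.χ p), e p', D.χ_mul_assoc, ← mul_assoc (D.χ p) (D'.χ q), e p]
  simp only [map_add, map_sub, map_mul, map_one, map_ofNat]
  noncomm_ring

/-- In all cases `σ_p(w_{p'})` is `± w` plus a constant for a single parameter `w` of the first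
family. -/
lemma Independent.σ_σ_w (h : Independent D D') (q : Q) (p p' : P) :
    D'.σ q (D.σ p (D.w p')) = D.σ p (D.w p') := by
  by_cases h1 : p' = D.bar p
  · rw [h1, D.σ_bar, map_sub, map_one, h.σ_right]
  · by_cases h2 : p' = p
    · rw [h2] at h1 ⊢
      rw [D.σ_self p h1, map_sub, map_one, h.σ_right]
    · rw [D.σ_ne p p' h2 h1, h.σ_right]

/-- Of the eight words in the two double commutators, four have `χ_p` to the left of the scalar and
pick up `σ_p`; these form one Serre combination. The other four form the one with `p` and `p'`
interchanged. -/
lemma Independent.serre_term (h : Independent D D') {X : F} (hp : ∀ p, D.σ p X = X)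
    (hq : ∀ q, D'.σ q X = X) (q : Q) (p p' : P) :
    comm (D.χ p) (comm (D.ι (X - D.w p')⁻¹ * D.χ p') (D'.χ q)) +
      comm (D.ι (X - D.w p')⁻¹ * D.χ p') (comm (D.χ p) (D'.χ q)) =
    D.ι (D.σ p (X - D.w p')⁻¹) * tri D (D'.χ q) p p' +
      D.ι (X - D.w p')⁻¹ * tri D (D'.χ q) p' p := by
  have e2 : D'.χ q * D.ι (X - D.w p')⁻¹ = D.ι (X - D.w p')⁻¹ * D'.χ q := by
    rw [← h.ι_eq, D'.χ_mul, h.σ_inv_right hq]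
  have e1 : D'.χ q * D.ι (D.σ p (X - D.w p')⁻¹) = D.ι (D.σ p (X - D.w p')⁻¹) * D'.χ q := by
    rw [← h.ι_eq, D'.χ_mul, map_inv₀, map_sub, hp, map_inv₀, map_sub, hq, h.σ_σ_w]
  generalize (X - D.w p')⁻¹ = f at *
  have e3 : ∀ t, D.χ p * (D.ι f * t) = D.ι (D.σ p f) * (D.χ p * t) := D.χ_mul_assoc p f
  have e4 : ∀ t, D'.χ q * (D.ι f * t) = D.ι f * (D'.χ q * t) := fun t => by
    rw [← mul_assoc, e2, mul_assoc]
  have e5 : ∀ t, D'.χ q * (D.ι (D.σ p f) * t) = D.ι (D.σ p f) * (D'.χ q * t) := fun t => by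
    rw [← mul_assoc, e1, mul_assoc]
  simp only [comm, tri, mul_sub, sub_mul, mul_add, mul_assoc, e3, e4, e5]
  noncomm_ring

lemma comm_sum_left {α : Type} [Fintype α] (a : α → T) (b : T) :
    comm (∑ i, a i) b = ∑ i, comm (a i) b := by
  simp only [comm, Finset.sum_mul, Finset.mul_sum, Finset.sum_sub_distrib]

lemma comm_sum_right {α : Type} [Fintype α] (a : α → T) (b : T) :
    comm b (∑ i, a i) = ∑ i, comm b (a i) := by
  simp only [comm, Finset.sum_mul, Finset.mul_sum, Finset.sum_sub_distrib]

/-- The left hand side of the Serre relation. -/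
theorem Adjacent.serre [Fintype P] [CharZero F] (h : Adjacent D D') {X : F}
    (hp : ∀ p, D.σ p X = X) (hq : ∀ q, D'.σ q X = X) (h1 : ∀ p, X - D.w p ≠ 0)
    (h2 : ∀ p, X + D.w p - 1 ≠ 0) (q : Q) (hn : ∀ p, (D.w p - 2⁻¹) ^ 2 - D'.w q ^ 2 ≠ 0) :
    comm D.S (comm (D.E X) (D'.χ q)) + comm (D.E X) (comm D.S (D'.χ q)) =
      -(D.ι (∑ p, D'.σ q (2 * (1 - D.w p) * D.φ p / ((D.w p - 2⁻¹) ^ 2 - D'.w q ^ 2)) *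
        ((2 * X - 1) * ((X - D.w p) * (X + D.w p - 1))⁻¹)) * D'.χ q) := by
  have h21 : (2 : F) * 2⁻¹ = 1 := mul_inv_cancel₀ two_ne_zero
  have hn1 : ∀ p, D.w p - D'.w q - 2⁻¹ ≠ 0 := by
    intro p e
    apply hn p
    linear_combination (D.w p + D'.w q - 2⁻¹) * e
  -- This is the image of `hn` under `σ_q`. It factors as `(w_p - w'_q + 1/2)(w_p + w'_q - 3/2)`,
  -- and these are the denominators met below.
  have hn' : ∀ p, (D.w p - 2⁻¹) ^ 2 - (D'.w q - 1) ^ 2 ≠ 0 := by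
    intro p
    rw [← D'.σ_w_sq, ← h.σ_right p q, ← map_ofNat (D'.σ q) 2, ← map_inv₀, ← map_sub,
      ← map_pow, ← map_pow, ← map_sub]
    exact (map_ne_zero _).2 (by simpa using hn p)
  have hn2 : ∀ p, D.w p - D'.w q + 2⁻¹ ≠ 0 := by
    intro p e
    apply hn' p
    linear_combination (D.w p + D'.w q - 3 * 2⁻¹) * e + (D.w p + D'.w q - 1 - 2⁻¹) * h21
  have hn3 : ∀ p, D.w p + D'.w q - 3 * 2⁻¹ ≠ 0 := by
    intro p e
    apply hn' p
    linear_combination (D.w p - D'.w q + 2⁻¹) * e + (D.w p + D'.w q - 1 - 2⁻¹) * h21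
  have exp : comm D.S (comm (D.E X) (D'.χ q)) + comm (D.E X) (comm D.S (D'.χ q)) =
      ∑ p, ∑ p', (D.ι (D.σ p (X - D.w p')⁻¹) * tri D (D'.χ q) p p' +
        D.ι (X - D.w p')⁻¹ * tri D (D'.χ q) p' p) := by
    simp only [← h.serre_term hp hq, Finset.sum_add_distrib]
    rw [S, E, comm_sum_left, comm_sum_left, comm_sum_left, comm_sum_left]
    simp only [comm_sum_right]
    congr 1
    exact Finset.sum_comm
  rw [exp, D.sum_eq_sum_bar]
  -- Reindexing by `bar` turns the second summand at `(p, bar p)` into a multiple of the same Serre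
  -- combination as the first.
  · let e : P ≃ P := Function.Involutive.toPerm D.bar D.bar_bar
    have hs : ∑ p, D.ι (X - D.w (D.bar p))⁻¹ * tri D (D'.χ q) (D.bar p) p =
        ∑ p, D.ι (X - D.w p)⁻¹ * tri D (D'.χ q) p (D.bar p) := by
      rw [← Equiv.sum_comp e]
      have he : ∀ x, e x = D.bar x := fun _ => rfl
      simp only [he, D.bar_bar]
    rw [Finset.sum_add_distrib, hs, ← Finset.sum_add_distrib, map_sum, Finset.sum_mul,
      ← Finset.sum_neg_distrib]
    refine Finset.sum_congr rfl fun p _ => ?_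
    rw [h.tri_eq _ _ _ hn2, D.χ_bar, ← h.ι_eq, D'.χ_mul, ← add_mul, ← map_add, ← mul_assoc,
      ← mul_assoc, ← map_mul, ← map_mul, ← neg_mul, ← map_neg]
    congr 2
    have e1 : D.σ p ((D.w (D.bar p) - D'.w q - 2⁻¹) / (D.w (D.bar p) - D'.w q + 2⁻¹)) =
        (D.w p + D'.w q - 2⁻¹) / (D.w p + D'.w q - 3 * 2⁻¹) := by
      rw [map_div₀, map_sub, map_sub, map_add, map_sub, D.σ_bar, h.σ_left, map_inv₀, map_ofNat,
        ← neg_div_neg_eq]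
      congr 1 <;> linear_combination - h21
    have e2 : D.σ p (X - D.w (D.bar p))⁻¹ = (X + D.w p - 1)⁻¹ := by
      rw [map_inv₀, map_sub, hp, D.σ_bar]
      congr 1
      ring
    have e3 : D'.σ q (2 * (1 - D.w p) * D.φ p / ((D.w p - 2⁻¹) ^ 2 - D'.w q ^ 2)) =
        2 * (1 - D.w p) * D'.σ q (D.φ p) /
          ((D.w p - D'.w q + 2⁻¹) * (D.w p + D'.w q - 3 * 2⁻¹)) := by
      simp only [map_div₀, map_mul, map_sub, map_pow, map_ofNat, map_one, map_inv₀, D'.σ_w_sq,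
        h.σ_right]
      congr 1
      linear_combination - (D.w p + D'.w q - 1 - 2⁻¹) * h21
    have e4 : (X + D.w p - 1)⁻¹ + (X - D.w p)⁻¹ =
        (2 * X - 1) * ((X - D.w p) * (X + D.w p - 1))⁻¹ := by
      have := h1 p; have := h2 p
      field_simp
      ring
    -- With `A` and `B` the two denominators, the left side is `(A + B - 1) / (A B)`, and `A + B - 1
    -- = 2 (w_p - 1)`.
    have e5 : (D.w p + D'.w q - 2⁻¹) / (D.w p + D'.w q - 3 * 2⁻¹) *
          ((D.w p - D'.w q - 2⁻¹) / (D.w p - D'.w q + 2⁻¹)) -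
        2 * ((D.w p - D'.w q - 2⁻¹) / (D.w p - D'.w q + 2⁻¹)) + 1 =
        - (2 * (1 - D.w p) / ((D.w p - D'.w q + 2⁻¹) * (D.w p + D'.w q - 3 * 2⁻¹))) := by
      have hA := hn2 p
      have hB := hn3 p
      have a1 : D.w p + D'.w q - 2⁻¹ = D.w p + D'.w q - 3 * 2⁻¹ + 1 := by linear_combination h21
      have a2 : D.w p - D'.w q - 2⁻¹ = D.w p - D'.w q + 2⁻¹ - 1 := by linear_combination h21
      have a3 : 2 * (1 - D.w p) =
          1 - (D.w p - D'.w q + 2⁻¹) - (D.w p + D'.w q - 3 * 2⁻¹) := by linear_combination h21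
      rw [a1, a2, a3]
      generalize D.w p - D'.w q + 2⁻¹ = A at hA ⊢
      generalize D.w p + D'.w q - 3 * 2⁻¹ = B at hB ⊢
      field_simp
      ring
    rw [e1, e2, e3, e4, e5]
    ring
  · intro p p' hpp
    by_cases hne : p' = p
    · rw [hne] at hpp ⊢
      -- For equal poles the shift by one makes the two exchange ratios telescope: with `A = w_p -
      -- w'_q - 1/2` the coefficient is `(A - 1)/(A + 1) - 2A/(A + 1) + 1 = 0`.
      have key : tri D (D'.χ q) p p = 0 := by
        rw [h.tri_eq _ _ _ hn2, map_div₀ (D.σ p), map_sub (D.σ p), map_sub (D.σ p),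
          map_add (D.σ p), map_sub (D.σ p), D.σ_self p hpp, h.σ_left, map_inv₀ (D.σ p),
          map_ofNat (D.σ p)]
        have hA := hn2 p
        have hB := hn1 p
        have a1 : D.w p - 1 - D'.w q - 2⁻¹ = D.w p - D'.w q - 2⁻¹ - 1 := by ring
        have a2 : D.w p - 1 - D'.w q + 2⁻¹ = D.w p - D'.w q - 2⁻¹ := by linear_combination h21
        have a3 : D.w p - D'.w q + 2⁻¹ = D.w p - D'.w q - 2⁻¹ + 1 := by linear_combination h21
        rw [a1, a2, a3]
        rw [a3] at hA
        generalize D.w p - D'.w q - 2⁻¹ = A at hA hB ⊢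
        have : (A - 1) / A * (A / (A + 1)) - 2 * (A / (A + 1)) + 1 = 0 := by
          field_simp
          ring
        rw [this, map_zero, zero_mul]
      simp [key]
    · have hpp' : p ≠ D.bar p' := fun hp => hpp (by rw [hp, D.bar_bar])
      -- The coefficient is `w_{p'} - w_p + 1` times an expression symmetric in the two poles, so
      -- the exchange relation of `χ_p` and `χ_{p'}` kills the symmetrization.
      have key : tri D (D'.χ q) p p' + tri D (D'.χ q) p' p = 0 := by
        rw [h.tri_eq _ _ _ hn2, h.tri_eq _ _ _ hn2]
        have f1 : ∀ p p', p' ≠ p → p' ≠ D.bar p →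
            D.σ p ((D.w p' - D'.w q - 2⁻¹) / (D.w p' - D'.w q + 2⁻¹)) =
              (D.w p' - D'.w q - 2⁻¹) / (D.w p' - D'.w q + 2⁻¹) := by
          intro p p' hne hpp
          rw [map_div₀, map_sub, map_sub, map_add, map_sub, D.σ_ne p p' hne hpp,
            h.σ_left, map_inv₀, map_ofNat]
        rw [f1 _ _ hne hpp, f1 _ _ (Ne.symm hne) hpp']
        have hA := hn2 p
        have hB := hn2 p'
        have g : ∀ p p', D.w p - D'.w q + 2⁻¹ ≠ 0 → D.w p' - D'.w q + 2⁻¹ ≠ 0 →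
            (D.w p' - D'.w q - 2⁻¹) / (D.w p' - D'.w q + 2⁻¹) *
              ((D.w p - D'.w q - 2⁻¹) / (D.w p - D'.w q + 2⁻¹)) -
            2 * ((D.w p - D'.w q - 2⁻¹) / (D.w p - D'.w q + 2⁻¹)) + 1 =
            (D.w p' - D.w p + 1) *
              ((D.w p - D'.w q + 2⁻¹) * (D.w p' - D'.w q + 2⁻¹))⁻¹ := by
          intro p p' hA hB
          have a1 : ∀ p, D.w p - D'.w q - 2⁻¹ = D.w p - D'.w q + 2⁻¹ - 1 := by
            intro p
            linear_combination h21
          have a2 : D.w p' - D.w p = (D.w p' - D'.w q + 2⁻¹) - (D.w p - D'.w q + 2⁻¹) := by ring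
          rw [a1, a1, a2]
          generalize D.w p - D'.w q + 2⁻¹ = A at hA ⊢
          generalize D.w p' - D'.w q + 2⁻¹ = B at hB ⊢
          field_simp
          ring
        have hx := D.exch p p' hne hpp
        rw [g p p' hA hB, g p' p hB hA, mul_comm (D.w p' - D'.w q + 2⁻¹)]
        generalize ((D.w p - D'.w q + 2⁻¹) * (D.w p' - D'.w q + 2⁻¹))⁻¹ = k
        have hc : ∀ f t, D'.σ q f = f → D.ι f * (D'.χ q * t) = D'.χ q * (D.ι f * t) := by
          intro f t hf
          rw [← h.ι_eq, ← mul_assoc (D'.χ q), D'.χ_mul, hf, mul_assoc]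
        have hk : D.w p - D.w p' + 1 = -(D.w p' - D.w p - 1) := by ring
        rw [hk, mul_comm, mul_comm _ k, map_mul, map_mul, mul_assoc, mul_assoc,
          hc (D.w p' - D.w p + 1) _ (by simp [h.σ_right]), hx, map_neg, neg_mul,
          hc (D.w p' - D.w p - 1) _ (by simp [h.σ_right])]
        simp
      rw [map_inv₀ (D.σ p), map_sub, hp, D.σ_ne p p' hne hpp, map_inv₀ (D.σ p'), map_sub, hp,
        D.σ_ne p' p (Ne.symm hne) hpp']
      rw [← mul_add, key, add_comm (D.ι (X - D.w p)⁻¹ * _), ← mul_add, key]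
      simp

end ShiftData

/-! ### The explicit formulas over an arbitrary coefficient ring, and their functoriality. -/

section Formulas

variable {n : ℕ} (v w : Node n → ℕ)

section Generic

variable {R : Type} [Ring R] (ω : ∀ i, Fin (half v i) → R) (ζ : ∀ i, Fin (half w i) → R)

/-- `x^{θ_i} ∏_r (x² - ω_{i,r}²)` -/
def fW (i : ℕ) (x : R) : R := x ^ parity v i * (List.ofFn fun r => x ^ 2 - ω i r ^ 2).prod

/-- `x^{θ_i} (x + ω_{i,r}) ∏_{s ≠ r} (x² - ω_{i,s}²)` -/
def fWr (i : ℕ) (r : Fin (half v i)) (x : R) : R :=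
  x ^ parity v i * (x + ω i r) *
    (List.ofFn fun s => if s = r then 1 else x ^ 2 - ω i s ^ 2).prod

variable [Algebra ℂ R]

/-- The coefficient of `ð_{i,r}⁻¹`. -/
def fMinus (i : ℕ) (r : Fin (half v i)) : R :=
  Ring.inverse (kap (ω i r)) ^ vartheta v i * fW v ω (i - 1) (ω i r - sc (1 / 2)) *
    ((ω i r - sc (1 / 2)) ^ parity v (i + 1) *
      (List.ofFn fun s => ω i r - sc (1 / 2) + ω (i + 1) s).prod) *
    Ring.inverse (fWr v ω i r (ω i r))

/-- The coefficient of `ð_{i,r}`. -/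
def fPlus (i : ℕ) (r : Fin (half v i)) : R :=
  Ring.inverse (kap (-ω i r)) ^ vartheta v i * fW w ζ i (ω i r + sc (1 / 2)) *
    (List.ofFn fun s => ω i r + sc (1 / 2) - ω (i + 1) s).prod *
    Ring.inverse (fWr v ω i r (ω i r))

/-- The constant coefficient. -/
def fZero (c : ℂ) (i : ℕ) : R :=
  sc (c * (parity v i : ℂ)) * (List.ofFn fun s => 0 - ζ i s).prod *
    Ring.inverse (List.ofFn fun r => sc (1 / 2) ^ 2 - ω i r ^ 2).prod *
    ((List.ofFn fun r => 0 - ω (i - 1) r).prod * (List.ofFn fun r => 0 - ω (i + 1) r).prod)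

/-- `u + c` -/
def fU (R : Type) [Ring R] [Algebra ℂ R] (c : ℂ) : LaurentSeries R := lin (sc c : R)

/-- A family of constants as a family of series. -/
def fC {d : ℕ → ℕ} (ω : ∀ i, Fin (d i) → R) (i : ℕ) (r : Fin (d i)) : LaurentSeries R :=
  HahnSeries.C (ω i r)

/-- The image of `D_i(u)`. -/
def fD (m : ℂ →₀ ℤ) (i : ℕ) : LaurentSeries R :=
  fW v (fC ω) i (fU R (-(((i : ℂ) - 1) / 2))) *
    Ring.inverse (fW v (fC ω) (i - 1) (fU R (-((i : ℂ) / 2)))) *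
    mapL (algebraMap ℂ R) (Z₀ v m) *
    (List.ofFn fun j : Fin (i - 1) =>
      boldKap (fU R (-((((j : ℕ) + 1 : ℕ) : ℂ) / 2))) ^ vartheta v (j + 1) *
        fW w (fC ζ) (j + 1) (fU R (-((((j : ℕ) + 1 : ℕ) : ℂ) / 2)))).prod

end Generic

/-- The generic formula at the ring `𝒜` unfolds to the formula in the statement of the theorem. -/
lemma imageD_eq (m : ℂ →₀ ℤ) (i : ℕ) :
    imageD v w m i = fD v w (A.wv v w) (A.z v w) m i := rfl

section Map

variable {R R' : Type} [Ring R] [Ring R']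
  (ω : ∀ i, Fin (half v i) → R) (ζ : ∀ i, Fin (half w i) → R)

lemma map_list_ofFn_prod {k : ℕ} (f : R →+* R') (g : Fin k → R) :
    f (List.ofFn g).prod = (List.ofFn fun i => f (g i)).prod := by
  rw [map_list_prod, List.map_ofFn]; rfl

/-- `Ring.inverse` is zero off the units, so a ring homomorphism respects it only under such an
assumption. -/
lemma map_ringInverse_of_isUnit (f : R →+* R') {x : R} (hx : IsUnit x) :
    f (Ring.inverse x) = Ring.inverse (f x) := by
  obtain ⟨u, rfl⟩ := hx
  rw [Ring.inverse_unit]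
  change _ = Ring.inverse ((Units.map (f : R →* R') u : R'ˣ) : R')
  rw [Ring.inverse_unit]
  rfl

lemma map_fW (f : R →+* R') (i : ℕ) (x : R) :
    f (fW v ω i x) = fW v (fun i r => f (ω i r)) i (f x) := by
  simp [fW, map_list_ofFn_prod]

lemma map_fWr (f : R →+* R') (i : ℕ) (r : Fin (half v i)) (x : R) :
    f (fWr v ω i r x) = fWr v (fun i r => f (ω i r)) i r (f x) := by
  simp [fWr, map_list_ofFn_prod, apply_ite f]

lemma map_kap (f : R →+* R') {x : R} (hx : f (Ring.inverse (2 * x)) = Ring.inverse (f (2 * x))) :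
    f (kap x) = kap (f x) := by
  rw [kap, map_sub, map_one, hx, map_mul, map_ofNat]
  rfl

variable [Algebra ℂ R] [Algebra ℂ R']

lemma map_sc (f : R →ₐ[ℂ] R') (c : ℂ) : (f : R →+* R') (sc c) = sc c := f.commutes c

/-- The hypotheses ask for compatibility with inverses rather than for units. Thus the lemma serves
both for homomorphisms of fields, where compatibility is automatic even at zero, and over the
localization, where units are known. -/
lemma map_fMinus (f : R →ₐ[ℂ] R') (i : ℕ) (r : Fin (half v i))
    (h1 : f (Ring.inverse (2 * ω i r)) = Ring.inverse (f (2 * ω i r)))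
    (h2 : f (Ring.inverse (kap (ω i r))) = Ring.inverse (f (kap (ω i r))))
    (h3 : f (Ring.inverse (fWr v ω i r (ω i r))) = Ring.inverse (f (fWr v ω i r (ω i r)))) :
    f (fMinus v ω i r) = fMinus v (fun i r => f (ω i r)) i r := by
  have e1 := map_kap (f : R →+* R') h1
  have e2 := map_fWr v ω (f : R →+* R')
  have e3 := map_fW v ω (f : R →+* R')
  have e4 := fun k (g : Fin k → R) => map_list_ofFn_prod (f : R →+* R') g
  have e5 := map_sc f
  simp only [AlgHom.coe_toRingHom] at e1 e2 e3 e4 e5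
  simp only [fMinus, map_mul, map_pow, map_sub, map_add, h2, h3, e1, e2, e3, e4, e5]

lemma map_fPlus (f : R →ₐ[ℂ] R') (i : ℕ) (r : Fin (half v i))
    (h1 : f (Ring.inverse (2 * -ω i r)) = Ring.inverse (f (2 * -ω i r)))
    (h2 : f (Ring.inverse (kap (-ω i r))) = Ring.inverse (f (kap (-ω i r))))
    (h3 : f (Ring.inverse (fWr v ω i r (ω i r))) = Ring.inverse (f (fWr v ω i r (ω i r)))) :
    f (fPlus v w ω ζ i r) = fPlus v w (fun i r => f (ω i r)) (fun i r => f (ζ i r)) i r := by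
  have e1 := map_kap (f : R →+* R') h1
  have e2 := map_fWr v ω (f : R →+* R')
  have e3 := map_fW w ζ (f : R →+* R')
  have e4 := fun k (g : Fin k → R) => map_list_ofFn_prod (f : R →+* R') g
  have e5 := map_sc f
  simp only [AlgHom.coe_toRingHom] at e1 e2 e3 e4 e5
  simp only [fPlus, map_mul, map_pow, map_sub, map_add, map_neg, h2, h3, e1, e2, e3, e4, e5]

lemma map_fZero (f : R →ₐ[ℂ] R') (c : ℂ) (i : ℕ)
    (h : f (Ring.inverse (List.ofFn fun r => sc (1 / 2) ^ 2 - ω i r ^ 2).prod) =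
      Ring.inverse (f (List.ofFn fun r => sc (1 / 2) ^ 2 - ω i r ^ 2).prod)) :
    f (fZero v w ω ζ c i) = fZero v w (fun i r => f (ω i r)) (fun i r => f (ζ i r)) c i := by
  have e4 := fun k (g : Fin k → R) => map_list_ofFn_prod (f : R →+* R') g
  have e5 := map_sc f
  simp only [AlgHom.coe_toRingHom] at e4 e5
  simp only [fZero, map_mul, map_pow, map_sub, map_zero, h, e4, e5]

end Map

section Series

variable {R : Type} [CommRing R] [Algebra ℂ R]
  (ω : ∀ i, Fin (half v i) → R) (ζ : ∀ i, Fin (half w i) → R)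

lemma monicOf_fU (c : ℂ) : MonicOf (-1) (fU R c) := monicOf_lin _

lemma monicOf_fW [Nontrivial R] (i : ℕ) (c : ℂ) :
    MonicOf (-(parity v i + 2 * half v i : ℤ)) (fW v (fC ω) i (fU R c)) := by
  rw [fW, List.prod_ofFn]
  have h : ∀ r, MonicOf (-2) (fU R c ^ 2 - fC ω i r ^ 2) := fun r => by
    rw [fC, ← map_pow]
    rw [sub_eq_add_neg, ← map_neg]
    exact ((monicOf_lin _).pow 2).add ((vanishBelow_C _).mono (by norm_num))
  convert ((monicOf_fU c).pow _).mul (MonicOf.prod Finset.univ h) using 1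
  simp; ring

lemma isUnit_four_mul_sq [IsDomain R] (c : ℂ) : IsUnit (4 * fU R c ^ 2) := by
  refine IsUnit.mul ?_ ((monicOf_fU c).pow 2).isUnit
  have h : (4 : LaurentSeries R) = HahnSeries.C (algebraMap ℂ R 4) := by
    rw [map_ofNat, map_ofNat]
  rw [h]
  exact ((isUnit_iff_ne_zero.2 (by norm_num : (4 : ℂ) ≠ 0)).map (algebraMap ℂ R)).map HahnSeries.C

lemma mapL_fU {R' : Type} [Ring R'] [Algebra ℂ R'] (f : R →ₐ[ℂ] R') (c : ℂ) :
    mapL (f : R →+* R') (fU R c) = fU R' c := by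
  rw [fU, lin, map_add, mapL_uvar, mapL_C, map_sc]
  rfl

/-- Every series inverted in the formula is a unit over the domain `R`: all have leading coefficient
one, up to the nonzero scalar `4` in `boldKap`. -/
lemma mapL_fD [IsDomain R] {R' : Type} [Ring R'] [Algebra ℂ R'] (f : R →ₐ[ℂ] R') (m : ℂ →₀ ℤ)
    (i : ℕ) : mapL (f : R →+* R') (fD v w ω ζ m i) =
      fD v w (fun i r => f (ω i r)) (fun i r => f (ζ i r)) m i := by
  have hC : ∀ {d : ℕ → ℕ} (ω : ∀ i, Fin (d i) → R) (i : ℕ) (r : Fin (d i)),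
      mapL (f : R →+* R') (fC ω i r) = fC (fun i r => f (ω i r)) i r := fun ω i r => mapL_C _ _
  have hK : ∀ c, mapL (f : R →+* R') (boldKap (fU R c)) = boldKap (fU R' c) := fun c => by
    rw [boldKap, map_sub, map_one, map_ringInverse_of_isUnit _ (isUnit_four_mul_sq c), map_mul,
      map_pow, mapL_fU, map_ofNat]
    rfl
  have hZ : mapL (f : R →+* R') (mapL (algebraMap ℂ R) (Z₀ v m)) =
      mapL (algebraMap ℂ R') (Z₀ v m) := by
    rw [mapL_mapL]
    congr 1
    exact congrArg mapL (RingHom.ext f.commutes)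
  simp only [fD, map_mul, map_fW, map_list_ofFn_prod, map_pow, hC, mapL_fU, hK, hZ,
    map_ringInverse_of_isUnit _ (monicOf_fW v ω (i - 1) _).isUnit]

end Series

end Formulas

/-! ### The poles, and the effect on coefficients of changing one parameter. -/

section Points

variable {n : ℕ} (v w : Node n → ℕ)

/-- The poles of the image of `E_i(u)`: two for each `r`, and one further. -/
abbrev Pt (i : ℕ) : Type := Option (Fin (half v i) × Bool)

variable {v}

/-- The involution of the set of poles. -/
def Pt.bar {i : ℕ} : Pt v i → Pt v i := Option.map fun x => (x.1, !x.2)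

lemma Pt.bar_bar {i : ℕ} (p : Pt v i) : p.bar.bar = p := by
  rcases p with _ | ⟨r, b⟩ <;> simp [Pt.bar]

variable {K : Type} [Field K]

/-- The parameter of a pole. -/
def ptW (ω : ∀ i, Fin (half v i) → K) (i : ℕ) : Pt v i → K
  | none => 2⁻¹
  | some (r, true) => ω i r
  | some (r, false) => -ω i r

/-- The ratio of two products that differ in one factor, cross-multiplied so that vanishing factors
do no harm. -/
lemma prod_mul_eq_of_ne {α : Type} [Fintype α] [DecidableEq α] {f g : α → K} (s₀ : α)
    (h : ∀ s, s ≠ s₀ → f s = g s) : (∏ s, f s) * g s₀ = (∏ s, g s) * f s₀ := by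
  rw [← Finset.mul_prod_erase _ f (Finset.mem_univ s₀),
    ← Finset.mul_prod_erase _ g (Finset.mem_univ s₀),
    Finset.prod_congr rfl fun s hs => h s (Finset.ne_of_mem_erase hs)]
  ring

variable [Algebra ℂ K]

/-- The coefficient at a pole. -/
def ptC (ω : ∀ i, Fin (half v i) → K) (ζ : ∀ i, Fin (half w i) → K) (c : ℂ) (i : ℕ) : Pt v i → K
  | none => fZero v w ω ζ c i
  | some (r, true) => -fMinus v ω i r
  | some (r, false) => -fPlus v w ω ζ i r

lemma sc_half : (sc (1 / 2) : K) = 2⁻¹ := by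
  rw [sc, one_div, map_inv₀, map_ofNat]

section Change

variable {ω ω' : ∀ i, Fin (half v i) → K} {ζ : ∀ i, Fin (half w i) → K} {c : ℂ} {i j : ℕ}

lemma ptC_far (hk : ∀ k, k ≠ j → ω' k = ω k) (h1 : j ≠ i - 1) (h2 : j ≠ i) (h3 : j ≠ i + 1)
    (p : Pt v i) : ptC w ω' ζ c i p = ptC w ω ζ c i p := by
  rcases p with _ | ⟨r, _ | _⟩ <;>
  simp only [ptC, fZero, fMinus, fPlus, fW, fWr, hk _ h1.symm, hk _ h2.symm, hk _ h3.symm]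

/-- The polynomial of the next node is split between the coefficients: one factor `x + w` goes with
`ð⁻¹`, one factor `x - w` with `ð`, and `W(0)` with the extra pole. In terms of the parameter of the
pole, each of these factors is `±(w_p - 1/2 + w_{i+1,s₀})`, so the three cases look alike. -/
lemma ptC_above {s₀ : Fin (half v (i + 1))} (hk : ∀ k, k ≠ i + 1 → ω' k = ω k)
    (hs : ∀ s, s ≠ s₀ → ω' (i + 1) s = ω (i + 1) s) (p : Pt v i) :
    ptC w ω' ζ c i p * (ptW ω i p - 2⁻¹ + ω (i + 1) s₀) =
      ptC w ω ζ c i p * (ptW ω i p - 2⁻¹ + ω' (i + 1) s₀) := by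
  have h1 := hk i (by omega)
  have h2 := hk (i - 1) (by omega)
  rcases p with _ | ⟨r, _ | _⟩ <;>
  simp only [ptC, ptW, fZero, fMinus, fPlus, fW, fWr, h1, h2, List.prod_ofFn, sc_half]
  · have := prod_mul_eq_of_ne (f := fun r => 0 - ω' (i + 1) r) (g := fun r => 0 - ω (i + 1) r) s₀
      fun s hs' => by rw [hs s hs']
    linear_combination (-(sc (c * (parity v i : ℂ)) * (∏ s, (0 - ζ i s)) *
      Ring.inverse (∏ r, (2⁻¹ ^ 2 - ω i r ^ 2)) * ∏ r, (0 - ω (i - 1) r))) * this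
  · have := prod_mul_eq_of_ne (f := fun s => ω i r + 2⁻¹ - ω' (i + 1) s)
      (g := fun s => ω i r + 2⁻¹ - ω (i + 1) s) s₀ fun s hs' => by rw [hs s hs']
    linear_combination (Ring.inverse (kap (-ω i r)) ^ vartheta v i * ((ω i r + 2⁻¹) ^ parity w i *
      ∏ s, ((ω i r + 2⁻¹) ^ 2 - ζ i s ^ 2)) * Ring.inverse (ω i r ^ parity v i *
        (ω i r + ω i r) * ∏ s, if s = r then 1 else ω i r ^ 2 - ω i s ^ 2)) * this
  · have := prod_mul_eq_of_ne (f := fun s => ω i r - 2⁻¹ + ω' (i + 1) s)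
      (g := fun s => ω i r - 2⁻¹ + ω (i + 1) s) s₀ fun s hs' => by rw [hs s hs']
    linear_combination (-(Ring.inverse (kap (ω i r)) ^ vartheta v i *
      ((ω i r - 2⁻¹) ^ parity v (i - 1) * ∏ s, ((ω i r - 2⁻¹) ^ 2 - ω (i - 1) s ^ 2)) *
      (ω i r - 2⁻¹) ^ parity v (i + 1) * Ring.inverse (ω i r ^ parity v i *
        (ω i r + ω i r) * ∏ s, if s = r then 1 else ω i r ^ 2 - ω i s ^ 2))) * this

/-- The polynomial of the previous node, by contrast, stands undivided in the coefficient of `ð⁻¹`,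
which makes the factor quadratic; it is absent from the coefficient of `ð`. The bound `1 ≤ i` keeps
the truncated `i - 1` distinct from `i`. -/
lemma ptC_below_true {s₀ : Fin (half v (i - 1))} (hi : 1 ≤ i) (hk : ∀ k, k ≠ (i - 1) → ω' k = ω k)
    (hs : ∀ s, s ≠ s₀ → ω' (i - 1) s = ω (i - 1) s) (r : Fin (half v i)) :
    ptC w ω' ζ c i (some (r, true)) * ((ω i r - 2⁻¹) ^ 2 - ω (i - 1) s₀ ^ 2) =
      ptC w ω ζ c i (some (r, true)) * ((ω i r - 2⁻¹) ^ 2 - ω' (i - 1) s₀ ^ 2) := by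
  have h1 := hk i (by omega)
  have h2 := hk (i + 1) (by omega)
  simp only [ptC, fMinus, fW, fWr, h1, h2, List.prod_ofFn, sc_half]
  have := prod_mul_eq_of_ne (f := fun s => (ω i r - 2⁻¹) ^ 2 - ω' (i - 1) s ^ 2)
      (g := fun s => (ω i r - 2⁻¹) ^ 2 - ω (i - 1) s ^ 2) s₀ fun s hs' => by rw [hs s hs']
  linear_combination (-(Ring.inverse (kap (ω i r)) ^ vartheta v i *
      (ω i r - 2⁻¹) ^ parity v (i - 1) * ((ω i r - 2⁻¹) ^ parity v (i + 1) *
        ∏ s, (ω i r - 2⁻¹ + ω (i + 1) s)) * Ring.inverse (ω i r ^ parity v i *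
        (ω i r + ω i r) *
          ∏ s, if s = r then 1 else ω i r ^ 2 - ω i s ^ 2))) * this

lemma ptC_below_false (hi : 1 ≤ i) (hk : ∀ k, k ≠ (i - 1) → ω' k = ω k) (r : Fin (half v i)) :
    ptC w ω' ζ c i (some (r, false)) = ptC w ω ζ c i (some (r, false)) := by
  have h1 := hk i (by omega)
  have h2 := hk (i + 1) (by omega)
  simp only [ptC, fPlus, fWr, h1, h2]

lemma ptC_below_none {s₀ : Fin (half v (i - 1))} (hi : 1 ≤ i) (hk : ∀ k, k ≠ (i - 1) → ω' k = ω k)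
    (hs : ∀ s, s ≠ s₀ → ω' (i - 1) s = ω (i - 1) s) :
    ptC w ω' ζ c i none * ω (i - 1) s₀ = ptC w ω ζ c i none * ω' (i - 1) s₀ := by
  have h1 := hk i (by omega)
  have h2 := hk (i + 1) (by omega)
  simp only [ptC, fZero, h1, h2, List.prod_ofFn, sc_half]
  have := prod_mul_eq_of_ne (f := fun r => 0 - ω' (i - 1) r) (g := fun r => 0 - ω (i - 1) r) s₀
      fun s hs' => by rw [hs s hs']
  linear_combination (-(sc (c * (parity v i : ℂ)) * (∏ s, (0 - ζ i s)) *
      Ring.inverse (∏ r, (2⁻¹ ^ 2 - ω i r ^ 2)) * ∏ r, (0 - ω (i + 1) r))) * this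

/-- At the same node a parameter enters the other coefficients through a single factor of the
denominator, so the cross-multiplication is reversed. That factor involves only the square of the
pole, which is why both signs and the extra pole share one formula. -/
lemma ptC_same {s₀ : Fin (half v i)} (hi : 1 ≤ i) (hk : ∀ k, k ≠ i → ω' k = ω k)
    (hs : ∀ s, s ≠ s₀ → ω' i s = ω i s) (p : Pt v i) (hp : ∀ b, p ≠ some (s₀, b))
    (h0 : ptW ω i p ^ 2 - ω i s₀ ^ 2 ≠ 0) (h0' : ptW ω i p ^ 2 - ω' i s₀ ^ 2 ≠ 0) :
    ptC w ω' ζ c i p * (ptW ω i p ^ 2 - ω' i s₀ ^ 2) =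
      ptC w ω ζ c i p * (ptW ω i p ^ 2 - ω i s₀ ^ 2) := by
  have h1 := hk (i - 1) (by omega)
  have h2 := hk (i + 1) (by omega)
  -- The other factors of the denominator may vanish; then `Ring.inverse` is zero on both sides.
  have inv : ∀ (a b x y k : K), x ≠ 0 → y ≠ 0 → a * y = b * x →
      Ring.inverse (k * a) * x = Ring.inverse (k * b) * y := by
    intro a b x y k hx hy h
    simp only [Ring.inverse_eq_inv', mul_inv]
    have : a⁻¹ * x = b⁻¹ * y := by
      have e : a = b * x / y := by rw [eq_div_iff hy, h]
      rw [e]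
      by_cases hb : b = 0
      · simp [hb]
      · field_simp
    rw [mul_assoc, this, mul_assoc]
  rcases p with _ | ⟨r, b⟩
  · simp only [ptW] at h0 h0'
    simp only [ptC, ptW, fZero, h1, h2, List.prod_ofFn, sc_half]
    have := inv _ _ _ _ 1 h0' h0 (prod_mul_eq_of_ne (f := fun r => 2⁻¹ ^ 2 - ω' i r ^ 2)
      (g := fun r => 2⁻¹ ^ 2 - ω i r ^ 2) s₀ fun s hs' => by rw [hs s hs'])
    rw [one_mul, one_mul] at this
    linear_combination (sc (c * (parity v i : ℂ)) * (∏ s, (0 - ζ i s)) *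
      ((∏ r, (0 - ω (i - 1) r)) * ∏ r, (0 - ω (i + 1) r))) * this
  · have hr : r ≠ s₀ := by
      rintro rfl
      exact hp b rfl
    have h3 := hs r hr
    have hsq : ptW ω i (some (r, b)) ^ 2 = ω i r ^ 2 := by
      rcases b with _ | _ <;> simp [ptW]
    rw [hsq] at h0 h0' ⊢
    have := prod_mul_eq_of_ne (f := fun s => if s = r then 1 else ω i r ^ 2 - ω' i s ^ 2)
      (g := fun s => if s = r then 1 else ω i r ^ 2 - ω i s ^ 2) s₀
      fun s hs' => by rw [hs s hs']
    simp only [if_neg hr.symm] at this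
    have := inv _ _ _ _ (ω i r ^ parity v i * (ω i r + ω i r)) h0' h0 this
    rcases b with _ | _ <;>
    simp only [ptC, fMinus, fPlus, fW, fWr, h1, h2, h3, List.prod_ofFn, sc_half]
    · linear_combination (-(Ring.inverse (kap (-ω i r)) ^ vartheta v i *
        ((ω i r + 2⁻¹) ^ parity w i * ∏ s, ((ω i r + 2⁻¹) ^ 2 - ζ i s ^ 2)) *
        ∏ s, (ω i r + 2⁻¹ - ω (i + 1) s))) * this
    · linear_combination (-(Ring.inverse (kap (ω i r)) ^ vartheta v i *
        ((ω i r - 2⁻¹) ^ parity v (i - 1) * ∏ s, ((ω i r - 2⁻¹) ^ 2 - ω (i - 1) s ^ 2)) *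
        ((ω i r - 2⁻¹) ^ parity v (i + 1) * ∏ s, (ω i r - 2⁻¹ + ω (i + 1) s)))) * this

end Change

end Points

/-! ### Shift operators over a field, and the exchange relations of the coefficients. -/

/-- A field with independent parameters `ω_{i,r}`, together with invertible operators which shift
them by one. -/
structure ShiftRing {n : ℕ} (v w : Node n → ℕ) (K S : Type) [Field K] [Algebra ℂ K] [Ring S]
    [Algebra ℂ S] where
  ω : ∀ i, Fin (half v i) → K
  ζ : ∀ i, Fin (half w i) → K
  shift : ∀ i, Fin (half v i) → Bool → K →ₐ[ℂ] K
  ι : K →ₐ[ℂ] S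
  δ : ∀ i, Fin (half v i) → Bool → S
  shift_true : ∀ i r, shift i r true (ω i r) = ω i r - 1
  shift_false : ∀ i r, shift i r false (ω i r) = ω i r + 1
  shift_ne : ∀ i r b j s, (⟨j, s⟩ : Σ i, Fin (half v i)) ≠ ⟨i, r⟩ → shift i r b (ω j s) = ω j s
  shift_ζ : ∀ i r b j s, shift i r b (ζ j s) = ζ j s
  ne_const : ∀ i r (c : ℂ), ω i r + algebraMap ℂ K c ≠ 0
  ne_sub : ∀ i r j s (c : ℂ), (⟨i, r⟩ : Σ i, Fin (half v i)) ≠ ⟨j, s⟩ →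
    ω i r - ω j s + algebraMap ℂ K c ≠ 0
  ne_add : ∀ i r j s (c : ℂ), (⟨i, r⟩ : Σ i, Fin (half v i)) ≠ ⟨j, s⟩ →
    ω i r + ω j s + algebraMap ℂ K c ≠ 0
  δ_mul : ∀ i r b f, δ i r b * ι f = ι (shift i r b f) * δ i r b
  δ_comm : ∀ i r b j s b', δ i r b * δ j s b' = δ j s b' * δ i r b
  δ_inv : ∀ i r b, δ i r b * δ i r (!b) = 1

namespace ShiftRing

variable {n : ℕ} {v w : Node n → ℕ} {K S : Type} [Field K] [Algebra ℂ K] [Ring S]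
  [Algebra ℂ S] (G : ShiftRing v w K S)

lemma charZero (G : ShiftRing v w K S) : CharZero K :=
  have := G
  charZero_of_injective_algebraMap (algebraMap ℂ K).injective

/-- The automorphism attached to a pole. -/
def pσ (i : ℕ) : Pt v i → K →ₐ[ℂ] K
  | none => AlgHom.id ℂ K
  | some (r, b) => G.shift i r b

/-- The shift operator attached to a pole. -/
def pδ (i : ℕ) : Pt v i → S
  | none => 1
  | some (r, b) => G.δ i r b

/-- The parameter of a pole. -/
def pw (i : ℕ) (p : Pt v i) : K := ptW G.ω i p

/-- The coefficient at a pole. -/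
def pc (c : ℂ) (i : ℕ) (p : Pt v i) : K := ptC w G.ω G.ζ c i p

lemma pδ_mul (i : ℕ) (p : Pt v i) (f : K) : G.pδ i p * G.ι f = G.ι (G.pσ i p f) * G.pδ i p := by
  rcases p with _ | ⟨r, b⟩
  · simp [pδ, pσ]
  · exact G.δ_mul i r b f

lemma pδ_comm (i : ℕ) (p : Pt v i) (j : ℕ) (q : Pt v j) :
    G.pδ i p * G.pδ j q = G.pδ j q * G.pδ i p := by
  rcases p with _ | ⟨r, b⟩
  · simp [pδ]
  · rcases q with _ | ⟨s, b'⟩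
    · simp [pδ]
    · exact G.δ_comm _ _ _ _ _ _

lemma pδ_bar (i : ℕ) (p : Pt v i) : G.pδ i p * G.pδ i p.bar = 1 := by
  rcases p with _ | ⟨r, b⟩
  · simp [pδ, Pt.bar]
  · exact G.δ_inv _ _ _

/-- Applying a shift to a coefficient means evaluating the same formula at shifted parameters, since
the `z` are fixed. This is how the preceding comparison lemmas become applicable. -/
lemma pσ_pc (c : ℂ) (i j : ℕ) (p : Pt v i) (q : Pt v j) :
    G.pσ i p (G.pc c j q) = ptC w (fun k s => G.pσ i p (G.ω k s)) G.ζ c j q := by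
  have hζ : ∀ k s, G.pσ i p (G.ζ k s) = G.ζ k s := by
    intro k s
    rcases p with _ | ⟨r, b⟩
    · rfl
    · exact G.shift_ζ _ _ _ _ _
  rcases q with _ | ⟨s, _ | _⟩
  · rw [pc, ptC, ptC, map_fZero _ _ _ _ _ _ _ (by simp [Ring.inverse_eq_inv'])]
    simp only [hζ]
  · rw [pc, ptC, ptC, map_neg, map_fPlus _ _ _ _ _ _ _ (by simp [Ring.inverse_eq_inv'])
      (by simp [Ring.inverse_eq_inv']) (by simp [Ring.inverse_eq_inv'])]
    simp only [hζ]
  · rw [pc, ptC, ptC, map_neg, map_fMinus _ _ _ _ _ (by simp [Ring.inverse_eq_inv'])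
      (by simp [Ring.inverse_eq_inv']) (by simp [Ring.inverse_eq_inv'])]

lemma shift_ω_ne {i : ℕ} (r : Fin (half v i)) (b : Bool) {k : ℕ} (hk : k ≠ i) :
    (fun s => G.shift i r b (G.ω k s)) = G.ω k := by
  funext s
  refine G.shift_ne _ _ _ _ _ fun h => hk ?_
  exact congrArg Sigma.fst h

lemma shift_ω_same_ne {i : ℕ} {r s : Fin (half v i)} (b : Bool) (hs : s ≠ r) :
    G.shift i r b (G.ω i s) = G.ω i s := by
  refine G.shift_ne _ _ _ _ _ fun h => hs ?_
  simpa using h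

lemma pw_bar {i : ℕ} {p : Pt v i} (hp : p ≠ none) : G.pw i p.bar = -G.pw i p := by
  rcases p with _ | ⟨r, _ | _⟩
  · exact absurd rfl hp
  · simp [Pt.bar, pw, ptW]
  · simp [Pt.bar, pw, ptW]

lemma pσ_pw_self {i : ℕ} {p : Pt v i} (hp : p ≠ none) : G.pσ i p (G.pw i p) = G.pw i p - 1 := by
  rcases p with _ | ⟨r, _ | _⟩
  · exact absurd rfl hp
  · simp only [pσ, pw, ptW, map_neg, G.shift_false]; ring
  · simp only [pσ, pw, ptW, G.shift_true]

/-- At the extra pole the shift is trivial, and the claim is `1/2 = 1 - 1/2`. -/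
lemma pσ_pw_bar {i : ℕ} (p : Pt v i) : G.pσ i p (G.pw i p.bar) = 1 - G.pw i p := by
  have := G.charZero
  by_cases hp : p = none
  · subst hp
    simp only [pσ, pw, ptW, Pt.bar, Option.map_none, AlgHom.id_apply]
    field_simp
    norm_num
  · rw [G.pw_bar hp, map_neg, G.pσ_pw_self hp]
    ring

/-- The poles have different underlying indices. -/
def Unrel {i j : ℕ} (p : Pt v i) (q : Pt v j) : Prop :=
  ∀ r s b b', p = some (r, b) → q = some (s, b') → (⟨i, r⟩ : Σ i, Fin (half v i)) ≠ ⟨j, s⟩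

lemma unrel_of_ne {i j : ℕ} (hij : i ≠ j) (p : Pt v i) (q : Pt v j) : Unrel p q :=
  fun _ _ _ _ _ _ h => hij (congrArg Sigma.fst h)

lemma unrel_of_ne_bar {i : ℕ} {p q : Pt v i} (h1 : q ≠ p) (h2 : q ≠ p.bar) : Unrel p q := by
  rintro r s b b' rfl rfl h
  obtain rfl : r = s := by simpa using h
  rcases b <;> rcases b' <;> simp [Pt.bar] at h1 h2

lemma pσ_pw_of_unrel {i j : ℕ} {p : Pt v i} {q : Pt v j} (h : Unrel p q) :
    G.pσ i p (G.pw j q) = G.pw j q := by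
  rcases p with _ | ⟨r, b⟩
  · rfl
  rcases q with _ | ⟨s, _ | _⟩
  · simp only [pw, ptW]
    rw [map_inv₀, map_ofNat]
  · simp only [pσ, pw, ptW, map_neg, G.shift_ne i r b j s (h r s _ _ rfl rfl).symm]
  · simp only [pσ, pw, ptW, G.shift_ne i r b j s (h r s _ _ rfl rfl).symm]

/-- According to the signs of the two poles this is algebraic independence for a difference, for a
sum or for a single parameter. Two extra poles have to be excluded, because their difference is a
constant. -/
lemma pw_sub_ne {i j : ℕ} {p : Pt v i} {q : Pt v j} (h : Unrel p q) (h0 : p ≠ none ∨ q ≠ none)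
    (c : ℂ) : G.pw i p - G.pw j q + algebraMap ℂ K c ≠ 0 := by
  have half : algebraMap ℂ K (2⁻¹) = 2⁻¹ := by rw [map_inv₀, map_ofNat]
  rcases p with _ | ⟨r, _ | _⟩ <;> rcases q with _ | ⟨s, _ | _⟩ <;>
  simp only [pw, ptW]
  · simp at h0
  · have := G.ne_const j s (2⁻¹ + c)
    rw [map_add, half] at this
    convert this using 1; ring
  · have := G.ne_const j s (-(2⁻¹ + c))
    rw [map_neg, map_add, half, ← neg_ne_zero] at this
    convert this using 1; ring
  · have := G.ne_const i r (2⁻¹ - c)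
    rw [map_sub, half, ← neg_ne_zero] at this
    convert this using 1; ring
  · have := G.ne_sub j s i r c (h r s _ _ rfl rfl).symm
    convert this using 1; ring
  · have := G.ne_add i r j s (-c) (h r s _ _ rfl rfl)
    rw [map_neg, ← neg_ne_zero] at this
    convert this using 1; ring
  · have := G.ne_const i r (-2⁻¹ + c)
    rw [map_add, map_neg, half] at this
    convert this using 1; ring
  · have := G.ne_add i r j s c (h r s _ _ rfl rfl)
    convert this using 1; ring
  · exact G.ne_sub i r j s c (h r s _ _ rfl rfl)

lemma pw_add_ne {i j : ℕ} {p : Pt v i} {q : Pt v j} (h : Unrel p q) (h0 : p ≠ none ∨ q ≠ none)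
    (c : ℂ) : G.pw i p + G.pw j q + algebraMap ℂ K c ≠ 0 := by
  have := G.charZero
  by_cases hq : q = none
  · subst hq
    -- Adding `1/2` is the same as subtracting `1/2` and adding `1`; for the other poles the sign is
    -- changed by `bar`.
    have h1 := G.pw_sub_ne h h0 (1 + c)
    rw [map_add, map_one] at h1
    convert h1 using 1
    simp only [pw, ptW]
    have h21 : (2 : K) * 2⁻¹ = 1 := mul_inv_cancel₀ two_ne_zero
    linear_combination h21
  · have h2 : Unrel p q.bar := by
      rcases q with _ | ⟨s, b'⟩
      · exact absurd rfl hq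
      · intro r s' b b'' h3 h4
        simp only [Pt.bar, Option.map_some, Option.some.injEq, Prod.mk.injEq] at h4
        obtain ⟨rfl, -⟩ := h4
        exact h r s b b' h3 rfl
    have h1 := G.pw_sub_ne h2 (Or.inr (by
      rcases q with _ | ⟨s, b'⟩
      · exact absurd rfl hq
      · simp [Pt.bar])) c
    rw [G.pw_bar hq] at h1
    convert h1 using 1
    ring

lemma pw_sq (i : ℕ) (r : Fin (half v i)) (b : Bool) : G.pw i (some (r, b)) ^ 2 = G.ω i r ^ 2 := by
  rcases b with _ | _ <;> simp [pw, ptW]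

lemma pw_sub_one_sq (i : ℕ) (r : Fin (half v i)) (b : Bool) :
    (G.pw i (some (r, b)) - 1) ^ 2 = G.shift i r b (G.ω i r) ^ 2 := by
  rcases b with _ | _
  · rw [G.shift_false]; simp only [pw, ptW]; ring
  · rw [G.shift_true]; simp only [pw, ptW]

/-- For either sign of the pole, `(w_p - 1)²` is the square of the shifted parameter. At the extra
pole both factors agree because `(1/2 - 1)² = (1/2)²`. -/
lemma pσ_pc_same (c : ℂ) {i : ℕ} (hi : 1 ≤ i) {p q : Pt v i} (h1 : q ≠ p) (h2 : q ≠ p.bar) :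
    G.pσ i p (G.pc c i q) * (G.pw i q ^ 2 - (G.pw i p - 1) ^ 2) =
      G.pc c i q * (G.pw i q ^ 2 - G.pw i p ^ 2) := by
  have := G.charZero
  have hu := unrel_of_ne_bar h1 h2
  rcases p with _ | ⟨r, b⟩
  · have : (G.pw i none - 1) ^ 2 = G.pw i none ^ 2 := by
      simp only [pw, ptW]; field_simp; norm_num
    rw [this]
    rfl
  · have e1 := G.pw_add_ne hu (Or.inl (by simp)) 0
    have e2 := G.pw_sub_ne hu (Or.inl (by simp)) 0
    have e3 := G.pw_add_ne hu (Or.inl (by simp)) (-1)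
    have e4 := G.pw_sub_ne hu (Or.inl (by simp)) (-1)
    simp only [map_zero, add_zero, map_neg, map_one] at e1 e2 e3 e4
    have n1 : G.pw i q ^ 2 - G.pw i (some (r, b)) ^ 2 ≠ 0 := by
      rw [← neg_ne_zero]; convert mul_ne_zero e1 e2 using 1; ring
    have n2 : G.pw i q ^ 2 - (G.pw i (some (r, b)) - 1) ^ 2 ≠ 0 := by
      rw [← neg_ne_zero]; convert mul_ne_zero e3 e4 using 1; ring
    rw [pw_sub_one_sq] at n2 ⊢
    rw [pw_sq] at n1 ⊢
    rw [pσ_pc]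
    refine ptC_same w hi (fun k hk => G.shift_ω_ne r b hk) (fun s hs => G.shift_ω_same_ne b hs)
      q ?_ n1 n2
    rintro b' rfl
    rcases b <;> rcases b' <;> simp [Pt.bar] at h1 h2

/-- The exchange relation of the coefficients at a node. -/
lemma exch_same (c : ℂ) {i : ℕ} (hi : 1 ≤ i) {p q : Pt v i} (h1 : q ≠ p) (h2 : q ≠ p.bar) :
    (G.pw i q - G.pw i p + 1) * (G.pc c i p * G.pσ i p (G.pc c i q)) =
      (G.pw i q - G.pw i p - 1) * (G.pc c i q * G.pσ i q (G.pc c i p)) := by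
  have hu := unrel_of_ne_bar h1 h2
  have h3 : p ≠ q.bar := fun h => h2 (by rw [h, Pt.bar_bar])
  have h0 : p ≠ none ∨ q ≠ none := by
    by_contra! h
    exact h1 (by rw [h.1, h.2])
  -- After solving these for the shifted coefficients, both sides become `c_p c_q (w_q² - w_p²) /
  -- (w_p + w_q - 1)`.
  have r1 := G.pσ_pc_same c hi h1 h2
  have r2 := G.pσ_pc_same c hi h1.symm h3
  have e2 := G.pw_sub_ne hu h0 (-1)
  have e3 := G.pw_add_ne hu h0 (-1)
  have e4 := G.pw_sub_ne hu h0 1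
  simp only [map_neg, map_one] at e2 e3 e4
  have n1 : G.pw i q ^ 2 - (G.pw i p - 1) ^ 2 ≠ 0 := by
    rw [← neg_ne_zero]; convert mul_ne_zero e3 e2 using 1; ring
  have n2 : G.pw i p ^ 2 - (G.pw i q - 1) ^ 2 ≠ 0 := by
    convert mul_ne_zero e4 e3 using 1; ring
  rw [← eq_div_iff n1] at r1
  rw [← eq_div_iff n2] at r2
  rw [r1, r2]
  field_simp
  ring

lemma pσ_pc_far (c : ℂ) {i j : ℕ} (h1 : j ≠ i - 1) (h2 : j ≠ i) (h3 : j ≠ i + 1) (p : Pt v i)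
    (q : Pt v j) : G.pσ j q (G.pc c i p) = G.pc c i p := by
  rcases q with _ | ⟨s, b⟩
  · rfl
  · rw [pσ_pc]
    exact ptC_far w (fun k hk => G.shift_ω_ne s b hk) h1 h2 h3 p

/-- The exchange relation of the coefficients at adjacent nodes. -/
lemma exch_adjacent (c c' : ℂ) {i : ℕ} (hpar : parity v i = 0 ∨ parity v (i + 1) = 0)
    (p : Pt v i) (q : Pt v (i + 1)) :
    (G.pw i p - G.pw (i + 1) q + 2⁻¹) * (G.pc c i p * G.pσ i p (G.pc c' (i + 1) q)) =
      (G.pw i p - G.pw (i + 1) q - 2⁻¹) *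
        (G.pc c' (i + 1) q * G.pσ (i + 1) q (G.pc c i p)) := by
  have := G.charZero
  have h21 : (2 : K) * 2⁻¹ = 1 := mul_inv_cancel₀ two_ne_zero
  have hhalf : algebraMap ℂ K (2⁻¹) = 2⁻¹ := by rw [map_inv₀, map_ofNat]
  have hu : Unrel p q := unrel_of_ne (by omega) p q
  rcases q with _ | ⟨s, b'⟩
  · rcases p with _ | ⟨r, b⟩
    -- Two adjacent extra poles would violate the exchange relation. The parity hypothesis removes
    -- this case, since one of the two coefficients is zero.
    · have h0 : G.pc c i none * G.pc c' (i + 1) none = 0 := by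
        rcases hpar with h | h <;> simp [pc, ptC, fZero, h, sc]
      simp only [pσ, AlgHom.id_apply]
      rw [mul_comm (G.pc c' _ _), h0]
      simp
    · have h1 : G.pσ i (some (r, b)) (G.pc c' (i + 1) none) * G.ω i r =
          G.pc c' (i + 1) none * G.shift i r b (G.ω i r) := by
        rw [pσ_pc]
        exact ptC_below_none w (i := i + 1) (by omega) (fun k hk => G.shift_ω_ne r b hk)
          (fun s hs => G.shift_ω_same_ne b hs)
      have h2 : G.pσ i (some (r, b)) (G.pc c' (i + 1) none) * G.pw i (some (r, b)) =
          G.pc c' (i + 1) none * (G.pw i (some (r, b)) - 1) := by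
        rcases b with _ | _
        · rw [G.shift_false] at h1
          simp only [pw, ptW]
          linear_combination -h1
        · rw [G.shift_true] at h1
          exact h1
      have hn : G.pw (i + 1) none = 2⁻¹ := rfl
      have hσ : G.pσ (i + 1) none (G.pc c i (some (r, b))) = G.pc c i (some (r, b)) := rfl
      rw [hσ, hn]
      linear_combination G.pc c i (some (r, b)) * h2 -
        G.pc c' (i + 1) none * G.pc c i (some (r, b)) * h21
  · have e1 := G.pw_add_ne hu (Or.inr (by simp)) (-2⁻¹)
    have e2 := G.pw_sub_ne hu (Or.inr (by simp)) (-2⁻¹)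
    have e3 := G.pw_sub_ne hu (Or.inr (by simp)) (2⁻¹)
    simp only [map_neg, hhalf] at e1 e2 e3
    have ha : G.pσ (i + 1) (some (s, b')) (G.pc c i p) * (G.pw i p - 2⁻¹ + G.ω (i + 1) s) =
        G.pc c i p * (G.pw i p - 2⁻¹ + G.shift (i + 1) s b' (G.ω (i + 1) s)) := by
      rw [pσ_pc]
      exact ptC_above w (fun k hk => G.shift_ω_ne s b' hk) (fun t ht => G.shift_ω_same_ne b' ht) p
    rcases b' with _ | _
    -- The coefficient of `ð` does not involve the previous node, so only the linear factor coming
    -- from the next node has to be compared.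
    · have hb : G.pσ i p (G.pc c' (i + 1) (some (s, false))) =
          G.pc c' (i + 1) (some (s, false)) := by
        rcases p with _ | ⟨r, b⟩
        · rfl
        · rw [pσ_pc]
          exact ptC_below_false w (i := i + 1) (by omega) (fun k hk => G.shift_ω_ne r b hk) s
      have hw : G.ω (i + 1) s = -G.pw (i + 1) (some (s, false)) := by simp [pw, ptW]
      rw [G.shift_false, hw] at ha
      rw [hb]
      generalize G.pw (i + 1) (some (s, false)) = y at *
      linear_combination -G.pc c' (i + 1) (some (s, false)) * ha +
        G.pc c i p * G.pc c' (i + 1) (some (s, false)) * h21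
    · have hb : G.pσ i p (G.pc c' (i + 1) (some (s, true))) *
          ((G.pw (i + 1) (some (s, true)) - 2⁻¹) ^ 2 - G.pw i p ^ 2) =
          G.pc c' (i + 1) (some (s, true)) *
          ((G.pw (i + 1) (some (s, true)) - 2⁻¹) ^ 2 - (G.pw i p - 1) ^ 2) := by
        rcases p with _ | ⟨r, b⟩
        · have : (G.pw i none - 1) ^ 2 = G.pw i none ^ 2 := by
            simp only [pw, ptW]; field_simp; norm_num
          rw [this]
          rfl
        · rw [pσ_pc, pw_sub_one_sq, pw_sq]
          exact ptC_below_true w (i := i + 1) (by omega) (fun k hk => G.shift_ω_ne r b hk)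
            (fun s hs => G.shift_ω_same_ne b hs) s
      have hw : G.ω (i + 1) s = G.pw (i + 1) (some (s, true)) := rfl
      rw [G.shift_true, hw] at ha
      generalize G.pw (i + 1) (some (s, true)) = y at *
      generalize G.pw i p = x at *
      generalize G.pσ i p (G.pc c' (i + 1) (some (s, true))) = a at *
      generalize G.pσ (i + 1) (some (s, true)) (G.pc c i p) = a' at *
      generalize G.pc c' (i + 1) (some (s, true)) = d at *
      generalize G.pc c i p = d' at *
      have e1' : x - 2⁻¹ + y ≠ 0 := by convert e1 using 1; ring
      -- The quadratic factors split into linear ones. Half of the splitting is the exchange ratio,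
      -- and the other half cancels against the linear factor in `ha`.
      have hb' : a * (x - y + 2⁻¹) * (x - 2⁻¹ + y) =
          d * (x - y - 2⁻¹) * (x - 2⁻¹ + (y - 1)) := by
        linear_combination -hb + (d * (x - y - 2⁻¹) * 0) * h21
      apply mul_right_cancel₀ e1'
      linear_combination d' * hb' - d * (x - y - 2⁻¹) * ha

end ShiftRing

/-! ### The numerator of `D_i(u)⁻¹ D_{i+1}(u)` and the residue identity. -/

/-- The possible parities around the node `i`. -/
def ParityCase {n : ℕ} (v w : Node n → ℕ) (i : ℕ) : Prop :=
  (parity v i = 1 ∧ vartheta v i = 1 ∧ parity v (i - 1) = 0 ∧ parity v (i + 1) = 0 ∧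
    parity w i = 0) ∨
  (parity v i = 0 ∧ vartheta v i = 0 ∧ parity v (i - 1) = 0 ∧ parity v (i + 1) = 0 ∧
    parity w i = 0) ∨
  (parity v i = 0 ∧ vartheta v i = 1 ∧ parity v (i - 1) + parity v (i + 1) + parity w i = 2)

section Numerator

variable {n : ℕ} (v w : Node n → ℕ) {K : Type} [Field K]
  (ω : ∀ i, Fin (half v i) → K) (ζ : ∀ i, Fin (half w i) → K)

/-- The numerator of `D_i(u)⁻¹ D_{i+1}(u)`, as a polynomial in `(u - i/2)²`. -/
def numer (i : ℕ) : Polynomial K :=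
  Polynomial.X ^ (1 - parity v i) *
    (Polynomial.X - Polynomial.C (4⁻¹)) ^ (vartheta v i - parity v i) *
    (∏ s, (Polynomial.X - Polynomial.C (ω (i - 1) s ^ 2))) *
    (∏ s, (Polynomial.X - Polynomial.C (ω (i + 1) s ^ 2))) *
    ∏ s, (Polynomial.X - Polynomial.C (ζ i s ^ 2))

variable {L : Type} [Field L] (f : K →+* L)

lemma eval₂_numer (i : ℕ) (t : L) :
    (numer v w ω ζ i).eval₂ f t =
      t ^ (1 - parity v i) * (t - 4⁻¹) ^ (vartheta v i - parity v i) *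
        (∏ s, (t - f (ω (i - 1) s) ^ 2)) * (∏ s, (t - f (ω (i + 1) s) ^ 2)) *
        ∏ s, (t - f (ζ i s) ^ 2) := by
  have h4 : f (4⁻¹) = 4⁻¹ := by rw [map_inv₀, map_ofNat]
  simp only [numer, Polynomial.eval₂_mul, Polynomial.eval₂_pow, Polynomial.eval₂_sub,
    Polynomial.eval₂_X, Polynomial.eval₂_C, Polynomial.eval₂_finsetProd, h4, map_pow]

-- If `θ_i = 1`, the factor `y² - 1/4` comes from `ϰ` and `1/y²` remains as a pole. If everything is
-- even, `N` supplies the factor `y²` that is divided out. In the last case two of the three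
-- neighbouring exponents are odd, and their `y²` cancels the pole of `ϰ`. The power of `y² - 1/4`
-- on the right is what `W_i(y + 1/2) W_i(y - 1/2)` will cancel.
variable {v w} in
lemma numer_core {i : ℕ} (hi : ParityCase v w i) {y : L} (hy : y ≠ 0) :
    ((y ^ 2 - 4⁻¹) / y ^ 2) ^ vartheta v i * fW v (fun i r => f (ω i r)) (i - 1) y *
        fW v (fun i r => f (ω i r)) (i + 1) y * fW w (fun i r => f (ζ i r)) i y =
      (y ^ 2 - 4⁻¹) ^ parity v i * ((numer v w ω ζ i).eval₂ f (y ^ 2) / y ^ 2) := by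
  rw [eval₂_numer]
  simp only [fW, List.prod_ofFn]
  generalize (∏ s, (y ^ 2 - f (ω (i - 1) s) ^ 2)) = a
  generalize (∏ s, (y ^ 2 - f (ω (i + 1) s) ^ 2)) = b
  generalize (∏ s, (y ^ 2 - f (ζ i s) ^ 2)) = c
  rcases hi with ⟨h1, h2, h3, h4, h5⟩ | ⟨h1, h2, h3, h4, h5⟩ | ⟨h1, h2, h3⟩
  · rw [h1, h2, h3, h4, h5]
    field_simp
    simp
  · rw [h1, h2, h3, h4, h5]
    field_simp
    simp
  · rw [h1, h2]
    have e : y ^ parity v (i - 1) * y ^ parity v (i + 1) * y ^ parity w i = y ^ 2 := by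
      rw [← pow_add, ← pow_add, h3]
    have : y ^ 2 ≠ 0 := pow_ne_zero _ hy
    simp only [pow_one, pow_zero, tsub_zero]
    rw [div_mul_eq_mul_div, div_mul_eq_mul_div, div_mul_eq_mul_div, one_mul]
    congr 1
    linear_combination (y ^ 2 - 4⁻¹) * a * b * c * e

end Numerator

section Residue

variable {n : ℕ} {v w : Node n → ℕ} {K : Type} [Field K]
  {ω ω' : ∀ i, Fin (half v i) → K} {ζ : ∀ i, Fin (half w i) → K} {i : ℕ}

/-- Two factors `ϰ⁻¹` at opposite poles combine to one bold `ϰ` at `x - 1/2`. This is why `E`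
carries negative and `D` positive powers. -/
lemma kap_mul_kap {x : K} (h1 : x ≠ 0) (h2 : x - 1 ≠ 0) [CharZero K] :
    Ring.inverse (kap x) * Ring.inverse (kap (-(x - 1))) =
      ((x - 2⁻¹) ^ 2 - 4⁻¹) / (x - 2⁻¹) ^ 2 := by
  have h21 : (2 : K) * 2⁻¹ = 1 := mul_inv_cancel₀ two_ne_zero
  have e1 : kap x = (x - 2⁻¹) / x := by
    rw [kap, Ring.inverse_eq_inv', mul_inv]
    field_simp
  have e2 : kap (-(x - 1)) = (x - 2⁻¹) / (x - 1) := by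
    rw [kap, Ring.inverse_eq_inv', mul_inv, inv_neg]
    field_simp
    ring
  rw [e1, e2, Ring.inverse_eq_inv', inv_div, inv_div, div_mul_div_comm, sq]
  congr 1
  field_simp
  ring

variable [Algebra ℂ K]

/-- The product of the coefficients at opposite poles. -/
lemma fMinus_mul_fPlus [CharZero K] (hi : ParityCase v w i) {r : Fin (half v i)}
    (hk : ∀ k, k ≠ i → ω' k = ω k) (hs : ∀ s, s ≠ r → ω' i s = ω i s)
    (hr : ω' i r = ω i r - 1) (h1 : ω i r ≠ 0) (h2 : ω i r - 1 ≠ 0) (h3 : ω i r - 2⁻¹ ≠ 0) :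
    fMinus v ω i r * fPlus v w ω' ζ i r * (4 * (ω i r * (ω i r - 1))) =
      (numer v w ω ζ i).eval ((ω i r - 2⁻¹) ^ 2) / (ω i r - 2⁻¹) ^ 2 *
        (∏ s, if s = r then 1 else (ω i r ^ 2 - ω i s ^ 2) * ((ω i r - 1) ^ 2 - ω i s ^ 2))⁻¹ := by
  have core := numer_core ω ζ (RingHom.id K) hi h3
  simp only [RingHom.id_apply] at core
  have e1 : (∏ s, if s = r then 1 else (ω i r ^ 2 - ω i s ^ 2) * ((ω i r - 1) ^ 2 - ω i s ^ 2)) =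
      (∏ s, if s = r then 1 else ω i r ^ 2 - ω i s ^ 2) *
        ∏ s, if s = r then 1 else (ω i r - 1) ^ 2 - ω' i s ^ 2 := by
    rw [← Finset.prod_mul_distrib]
    refine Finset.prod_congr rfl fun s _ => ?_
    split_ifs with h
    · rw [one_mul]
    · rw [hs s h]
  have e2 : ω' (i + 1) = ω (i + 1) := hk _ (by omega)
  have e3 : ω i r - 1 + 2⁻¹ = ω i r - 2⁻¹ := by field_simp; ring
  have e4 : fW v ω (i + 1) (ω i r - 2⁻¹) = (ω i r - 2⁻¹) ^ parity v (i + 1) *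
      ((∏ s, (ω i r - 2⁻¹ + ω (i + 1) s)) * ∏ s, (ω i r - 2⁻¹ - ω (i + 1) s)) := by
    rw [fW, List.prod_ofFn, ← Finset.prod_mul_distrib]
    congr 1
    refine Finset.prod_congr rfl fun s _ => ?_
    ring
  -- Thus the factors `x^{θ_i}` of the two denominators, at `w` and at `w - 1`, match the power of
  -- `y² - 1/4` in `numer_core` for `y = w - 1/2`.
  have e5 : (ω i r - 2⁻¹) ^ 2 - 4⁻¹ = ω i r * (ω i r - 1) := by field_simp; ring
  have hθ : (ω i r * (ω i r - 1)) ^ parity v i ≠ 0 := pow_ne_zero _ (mul_ne_zero h1 h2)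
  rw [← kap_mul_kap h1 h2, e4, kap_mul_kap h1 h2, e5, ← e5, ← kap_mul_kap h1 h2, e5] at core
  have core' := (eq_inv_mul_iff_mul_eq₀ hθ).2 core.symm
  change Polynomial.eval _ _ / _ = _ at core'
  have h6 : ω i r - 1 + (ω i r - 1) ≠ 0 := by rw [← two_mul]; exact mul_ne_zero two_ne_zero h2
  -- The factors `x + w` of the two denominators are `2w` and `2(w - 1)`.
  have e7 : (ω i r - 1 + (ω i r - 1))⁻¹ * (ω i r + ω i r)⁻¹ * (4 * (ω i r * (ω i r - 1))) = 1 := by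
    field_simp
    ring
  rw [core', e1]
  simp only [fMinus, fPlus, hr, e2, sc_half, e3, List.prod_ofFn, fWr]
  generalize (∏ s, if s = r then 1 else ω i r ^ 2 - ω i s ^ 2) = a
  generalize (∏ s, if s = r then 1 else (ω i r - 1) ^ 2 - ω' i s ^ 2) = b
  generalize (∏ s, (ω i r - 2⁻¹ + ω (i + 1) s)) = c
  generalize (∏ s, (ω i r - 2⁻¹ - ω (i + 1) s)) = d
  generalize Ring.inverse (kap (ω i r)) = p
  generalize Ring.inverse (kap (-(ω i r - 1))) = q
  generalize fW v ω (i - 1) (ω i r - 2⁻¹) = e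
  generalize fW w ζ i (ω i r - 2⁻¹) = g
  simp only [Ring.inverse_eq_inv', mul_inv, mul_pow] at e7 ⊢
  generalize (ω i r - 1 + (ω i r - 1))⁻¹ = k at *
  generalize (ω i r + ω i r)⁻¹ = l at *
  generalize (ω i r - 2⁻¹) ^ parity v (i + 1) = o at *
  linear_combination (p ^ vartheta v i * e * (o * c) * ((ω i r ^ parity v i)⁻¹ * a⁻¹) *
    (q ^ vartheta v i * g * d * (((ω i r - 1) ^ parity v i)⁻¹ * b⁻¹))) * e7

end Residue

namespace ShiftRing

variable {n : ℕ} {v w : Node n → ℕ} {K S : Type} [Field K] [Algebra ℂ K] [Ring S]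
  [Algebra ℂ S] (G : ShiftRing v w K S)

/-- The poles in the variable `(u - i/2)²`. -/
def pt (i : ℕ) (p : Pt v i) : K := (G.pw i p - 2⁻¹) ^ 2

/-- The product of the coefficients at opposite poles. -/
def pφ (c : ℂ) (i : ℕ) (p : Pt v i) : K := G.pc c i p * G.pσ i p (G.pc c i p.bar)

lemma pt_none (i : ℕ) : G.pt i none = 0 := by simp [pt, pw, ptW]

lemma pt_true (i : ℕ) (r : Fin (half v i)) : G.pt i (some (r, true)) = (G.ω i r - 2⁻¹) ^ 2 := rfl

lemma pt_false (i : ℕ) (r : Fin (half v i)) : G.pt i (some (r, false)) = (G.ω i r + 2⁻¹) ^ 2 := by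
  simp only [pt, pw, ptW]
  ring

/-- A coincidence means `(w_p - w_q)(w_p + w_q - 1) = 0`, which independence of the parameters
excludes. Hence the rational function has simple poles in `t`, even with the extra pole at `t = 0`.
-/
lemma pt_injective (i : ℕ) : Function.Injective (G.pt i) := by
  have := G.charZero
  intro p q h
  by_contra hpq
  have h' : (G.pw i p - G.pw i q) * (G.pw i p + G.pw i q - 1) = 0 := by
    simp only [pt] at h
    have h21 : (2 : K) * 2⁻¹ = 1 := mul_inv_cancel₀ two_ne_zero
    linear_combination h + (G.pw i p - G.pw i q) * h21
  by_cases hb : q = p.bar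
  · have hp : p ≠ none := by
      rintro rfl
      exact hpq (by rw [hb]; rfl)
    rw [hb, G.pw_bar hp] at h'
    have h0 : G.pw i p = 0 := by
      have : (2 : K) ≠ 0 := two_ne_zero
      have h'' : -2 * G.pw i p = 0 := by linear_combination h'
      simpa using h''
    rcases p with _ | ⟨r, _ | _⟩
    · exact hp rfl
    · exact G.ne_const i r 0 (by simpa [pw, ptW] using h0)
    · exact G.ne_const i r 0 (by simpa [pw, ptW] using h0)
  · have hu := unrel_of_ne_bar (Ne.symm hpq) hb
    have h0 : p ≠ none ∨ q ≠ none := by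
      by_contra! h
      exact hpq (by rw [h.1, h.2])
    have e1 := G.pw_sub_ne hu h0 0
    have e2 := G.pw_add_ne hu h0 (-1)
    rw [map_zero, add_zero] at e1
    rw [map_neg, map_one, ← sub_eq_add_neg] at e2
    exact mul_ne_zero e1 e2 h'

lemma prod_erase_pt (i : ℕ) (p : Pt v i) : ∏ q ∈ Finset.univ.erase p, (G.pt i p - G.pt i q) =
    (if none = p then 1 else G.pt i p) * ∏ s,
      ((if some (s, true) = p then 1 else G.pt i p - (G.ω i s - 2⁻¹) ^ 2) *
        (if some (s, false) = p then 1 else G.pt i p - (G.ω i s + 2⁻¹) ^ 2)) := by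
  have h1 : ∏ q ∈ Finset.univ.erase p, (G.pt i p - G.pt i q) =
      ∏ q, if q = p then 1 else G.pt i p - G.pt i q := by
    rw [← Finset.mul_prod_erase Finset.univ (fun q => if q = p then 1 else G.pt i p - G.pt i q)
      (Finset.mem_univ p), if_pos rfl, one_mul]
    exact Finset.prod_congr rfl fun q hq => by rw [if_neg (Finset.ne_of_mem_erase hq)]
  rw [h1, Fintype.prod_option, Fintype.prod_prod_type, G.pt_none, sub_zero]
  simp only [Fintype.prod_bool, pt_true, pt_false]

lemma half_ne (i : ℕ) (r : Fin (half v i)) (k : ℂ) : G.ω i r - algebraMap ℂ K k ≠ 0 := by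
  have := G.ne_const i r (-k)
  rwa [map_neg, ← sub_eq_add_neg] at this

/-- The extra pole contributes `t_p` and the opposite pole contributes `-2 w_p`. For `s ≠ r` the
four linear factors from the two poles `± w_s` regroup as `(w_p² - w_s²)((w_p - 1)² - w_s²)`. -/
lemma prod_erase_pt_some (i : ℕ) (r : Fin (half v i)) (b : Bool) :
    ∏ q ∈ Finset.univ.erase (some (r, b)), (G.pt i (some (r, b)) - G.pt i q) =
    (-2 * G.pw i (some (r, b)) * G.pt i (some (r, b))) *
      ∏ s, if s = r then 1 else (G.ω i r ^ 2 - G.ω i s ^ 2) *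
        ((G.pw i (some (r, b)) - 1) ^ 2 - G.ω i s ^ 2) := by
  have := G.charZero
  have h21 : (2 : K) * 2⁻¹ = 1 := mul_inv_cancel₀ two_ne_zero
  rw [prod_erase_pt, if_neg (by simp)]
  set y := G.pt i (some (r, b)) with hy
  rw [← Finset.mul_prod_erase _ _ (Finset.mem_univ r)]
  rw [← Finset.mul_prod_erase _ (fun s => if s = r then 1 else (G.ω i r ^ 2 - G.ω i s ^ 2) *
    ((G.pw i (some (r, b)) - 1) ^ 2 - G.ω i s ^ 2)) (Finset.mem_univ r)]
  rw [if_pos rfl, one_mul]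
  have h2 : ∀ s ∈ Finset.univ.erase r,
      ((if some (s, true) = some (r, b) then 1 else y - (G.ω i s - 2⁻¹) ^ 2) *
        (if some (s, false) = some (r, b) then 1 else y - (G.ω i s + 2⁻¹) ^ 2)) =
      if s = r then 1 else (G.ω i r ^ 2 - G.ω i s ^ 2) *
        ((G.pw i (some (r, b)) - 1) ^ 2 - G.ω i s ^ 2) := by
    intro s hs
    have hs' := Finset.ne_of_mem_erase hs
    rw [if_neg (by simp [hs']), if_neg (by simp [hs']), if_neg hs', hy]
    rw [← G.pw_sq i r b]
    simp only [pt]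
    linear_combination (0 : K) * h21
  rw [Finset.prod_congr rfl h2]
  have h3 : ((if some (r, true) = some (r, b) then 1 else y - (G.ω i r - 2⁻¹) ^ 2) *
        (if some (r, false) = some (r, b) then 1 else y - (G.ω i r + 2⁻¹) ^ 2)) =
      -2 * G.pw i (some (r, b)) := by
    rcases b with _ | _
    · rw [if_neg (by simp), if_pos rfl, hy, pt_false]
      simp only [pw, ptW]
      linear_combination 2 * G.ω i r * h21
    · rw [if_pos rfl, if_neg (by simp), hy, pt_true]
      simp only [pw, ptW]
      linear_combination -2 * G.ω i r * h21
  rw [h3]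
  ring

/-- This identity ties `E` to `D`. At the poles `± w_{i,r}` it follows from the product of opposite
coefficients. At the extra pole `2 (1 - w_p) = 1` and `φ_p` is the square of the constant
coefficient, so that the sign has to come from `c²`. -/
lemma residue {i : ℕ} (hi : ParityCase v w i) (h1i : 1 ≤ i) {c : ℂ}
    (hc : c ^ 2 = (-1) ^ (half w i + half v (i - 1) + half v (i + 1))) (p : Pt v i) :
    2 * (1 - G.pw i p) * G.pφ c i p = (numer v w G.ω G.ζ i).eval (G.pt i p) /
      ∏ q ∈ Finset.univ.erase p, (G.pt i p - G.pt i q) := by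
  have := G.charZero
  have h21 : (2 : K) * 2⁻¹ = 1 := mul_inv_cancel₀ two_ne_zero
  have hhalf : algebraMap ℂ K (2⁻¹) = 2⁻¹ := by rw [map_inv₀, map_ofNat]
  rcases p with _ | ⟨r, b⟩
  · have hpw : 2 * (1 - G.pw i none) = 1 := by
      simp only [pw, ptW]
      linear_combination -h21
    rw [hpw, one_mul, prod_erase_pt, if_pos rfl, one_mul, pφ, pt_none, Polynomial.eval,
      eval₂_numer]
    simp only [pσ, Pt.bar, Option.map_none, AlgHom.id_apply, RingHom.id_apply]
    by_cases hθ : parity v i = 1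
    · rcases hi with ⟨-, h2, -⟩ | ⟨h1, -⟩ | ⟨h1, -⟩
      · rw [hθ, h2]
        -- At `t = 0` each of the three families of linear factors is a square up to `(-1)^k`. The
        -- total sign is the value prescribed for `c²`.
        have sq : ∀ {k : ℕ} (f : Fin k → K), ∏ s, (0 - f s ^ 2) = (-1) ^ k * (∏ s, (0 - f s)) ^ 2 := by
          intro k f
          have hk : (-1 : K) ^ k = ∏ _s : Fin k, (-1) := by simp
          rw [← Finset.prod_pow, hk, ← Finset.prod_mul_distrib]
          exact Finset.prod_congr rfl fun s _ => by ring
        have hd : (∏ s, ((if some (s, true) = (none : Pt v i) then 1 else 0 - (G.ω i s - 2⁻¹) ^ 2) *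
            (if some (s, false) = (none : Pt v i) then 1 else 0 - (G.ω i s + 2⁻¹) ^ 2))) =
            (∏ s, (2⁻¹ ^ 2 - G.ω i s ^ 2)) ^ 2 := by
          rw [← Finset.prod_pow]
          refine Finset.prod_congr rfl fun s _ => ?_
          rw [if_neg (by simp), if_neg (by simp)]
          ring
        rw [hd, sq, sq, sq]
        have hc' := congrArg (algebraMap ℂ K) hc
        simp only [map_pow, map_neg, map_one] at hc'
        simp only [pc, ptC, fZero, hθ, Nat.cast_one, mul_one, List.prod_ofFn, sc_half,
          Ring.inverse_eq_inv', Nat.sub_self, pow_zero, one_mul]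
        simp only [sc]
        rw [div_eq_mul_inv]
        simp only [← inv_pow]
        generalize (∏ s, (2⁻¹ ^ 2 - G.ω i s ^ 2))⁻¹ = a
        generalize (∏ s, (0 - G.ω (i - 1) s)) = a1
        generalize (∏ s, (0 - G.ω (i + 1) s)) = a2
        generalize (∏ s, (0 - G.ζ i s)) = a3
        rw [pow_add, pow_add] at hc'
        linear_combination (a * a1 * a2 * a3) ^ 2 * hc'
      · omega
      · omega
    · have hθ' : parity v i = 0 := by
        rcases hi with h | h | h
        · exact absurd h.1 hθ
        · exact h.1
        · exact h.1
      -- For even `v_i` there is no extra term, and accordingly the numerator has a zero at `t = 0`.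
      have hz : G.pc c i none = 0 := by simp [pc, ptC, fZero, hθ', sc]
      rw [hz, hθ']
      simp
  · rw [prod_erase_pt_some]
    have key : G.pφ c i (some (r, b)) * (4 * (G.pw i (some (r, b)) *
        (G.pw i (some (r, b)) - 1))) =
        (numer v w G.ω G.ζ i).eval (G.pt i (some (r, b))) / G.pt i (some (r, b)) *
        (∏ s, if s = r then 1 else (G.ω i r ^ 2 - G.ω i s ^ 2) *
          ((G.pw i (some (r, b)) - 1) ^ 2 - G.ω i s ^ 2))⁻¹ := by
      rcases b with _ | _
      -- For the other sign the coefficient of `ð⁻¹` is the shifted one, so the product formula is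
      -- applied with the parameters `w + 1` as base point and the original ones as their shift.
      · have h := fMinus_mul_fPlus (ω := fun k s => G.shift i r false (G.ω k s)) (ω' := G.ω)
          (ζ := G.ζ) hi (r := r) (fun k hk => (G.shift_ω_ne r false hk).symm)
          (fun s hs => (G.shift_ω_same_ne false hs).symm)
          (by rw [G.shift_false, add_sub_cancel_right]) ?_ ?_ ?_
        · rw [pφ, pσ_pc]
          simp only [Pt.bar, Option.map_some, Bool.not_false, ptC, pc, pσ, neg_mul_neg]
          have hn : numer v w (fun k s => G.shift i r false (G.ω k s)) G.ζ i =
              numer v w G.ω G.ζ i := by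
            have h1 := G.shift_ω_ne r false (show i - 1 ≠ i by omega)
            have h2 := G.shift_ω_ne r false (show i + 1 ≠ i by omega)
            simp only [numer, fun s => congrFun h1 s, fun s => congrFun h2 s]
          have ht : (G.shift i r false (G.ω i r) - 2⁻¹) ^ 2 = G.pt i (some (r, false)) := by
            rw [pt_false, G.shift_false]
            congr 1
            linear_combination -h21
          have hp : (∏ s, if s = r then 1 else (G.ω i r ^ 2 - G.ω i s ^ 2) *
              ((G.pw i (some (r, false)) - 1) ^ 2 - G.ω i s ^ 2)) =
              ∏ s, if s = r then 1 else (G.shift i r false (G.ω i r) ^ 2 -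
                G.shift i r false (G.ω i s) ^ 2) * ((G.shift i r false (G.ω i r) - 1) ^ 2 -
                G.shift i r false (G.ω i s) ^ 2) := by
            refine Finset.prod_congr rfl fun s _ => ?_
            split_ifs with hs
            · rfl
            · rw [G.shift_ω_same_ne false hs, G.shift_false]
              simp only [pw, ptW]
              ring
          rw [hn, ht] at h
          rw [hp, ← h, G.shift_false]
          simp only [pw, ptW]
          ring
        · rw [G.shift_false]; simpa using G.ne_const i r 1
        · rw [G.shift_false]; simpa using G.ne_const i r 0
        · rw [G.shift_false]
          have := G.ne_const i r 2⁻¹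
          rw [hhalf] at this
          convert this using 1
          linear_combination -h21
      · have := fMinus_mul_fPlus (ω := G.ω) (ω' := fun k s => G.shift i r true (G.ω k s))
          (ζ := G.ζ) hi (r := r) (fun k hk => G.shift_ω_ne r true hk)
          (fun s hs => G.shift_ω_same_ne true hs) (G.shift_true i r) ?_ ?_ ?_
        · rw [pφ, pσ_pc]
          simp only [Pt.bar, Option.map_some, Bool.not_true, ptC, pc, pσ, neg_mul_neg]
          exact this
        · simpa using G.half_ne i r 0
        · simpa using G.half_ne i r 1
        · simpa [hhalf] using G.half_ne i r 2⁻¹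
    have hw : G.pw i (some (r, b)) ≠ 0 := by
      have := G.ne_const i r 0
      rcases b with _ | _ <;> simpa [pw, ptW] using this
    have e : 2 * (1 - G.pw i (some (r, b))) * G.pφ c i (some (r, b)) =
        -(2 * G.pw i (some (r, b)))⁻¹ * (G.pφ c i (some (r, b)) * (4 * (G.pw i (some (r, b)) *
        (G.pw i (some (r, b)) - 1)))) := by
      field_simp
      ring
    rw [e, key]
    simp only [div_eq_mul_inv, mul_inv, inv_neg]
    ring

end ShiftRing

lemma VanishBelow.mapL {B C : Type} [Ring B] [Ring C] (φ : B →+* C) {N : ℤ} {f : LaurentSeries B}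
    (hf : VanishBelow N f) : VanishBelow N (mapL φ f) := fun r hr => by
  rw [coeff_mapL, hf r hr, map_zero]

lemma MonicOf.mapL {B C : Type} [Ring B] [Ring C] (φ : B →+* C) {N : ℤ} {f : LaurentSeries B}
    (hf : MonicOf N f) : MonicOf N (mapL φ f) :=
  ⟨hf.1.mapL φ, by rw [coeff_mapL, hf.2, map_one]⟩

/-! ### Degrees of the images, and `D_i(u)⁻¹ D_{i+1}(u)` as a rational function. -/

section Field

variable {n : ℕ} {v w : Node n → ℕ} {K : Type} [Field K] [Algebra ℂ K]

lemma fU_add (a b : ℂ) : fU K (a + b) = fU K a + HahnSeries.C (sc b) := by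
  simp only [fU, lin, sc, map_add, add_assoc]

lemma monicOf_Z₀ (v : Node n → ℕ) (m : ℂ →₀ ℤ) :
    MonicOf (parity v 1 - 2 * m.sum fun _ k => k : ℤ) (Z₀ v m) := by
  have h : ∀ x : ℂ, MonicOf (-2) (uvar ℂ ^ 2 - HahnSeries.C x ^ 2) := fun x => by
    have := monicOf_lin_sq_sub (0 : ℂ) (x ^ 2)
    simpa [lin] using this
  have h2 : ∀ x : ℂ, MonicOf (m x * -2) ((uvar ℂ ^ 2 - HahnSeries.C x ^ 2) ^ m x) :=
    fun x => (h x).zpow _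
  have h1 := (monicOf_uvar (K := ℂ)).zpow (-(parity v 1 : ℤ))
  have h3 := h1.mul (MonicOf.prod m.support h2)
  have e : (parity v 1 - 2 * m.sum fun _ k => k : ℤ) =
      -(parity v 1 : ℤ) * -1 + ∑ x ∈ m.support, m x * -2 := by
    rw [← Finset.sum_mul, Finsupp.sum]
    ring
  rw [e]
  exact h3

lemma boldKap_eq [CharZero K] (c : ℂ) :
    boldKap (fU K c) = (fU K c ^ 2 - 4⁻¹) / fU K c ^ 2 := by
  have h0 : fU K c ≠ 0 := lin_ne_zero _
  have : CharZero (LaurentSeries K) :=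
    charZero_of_injective_ringHom (HahnSeries.C_injective (Γ := ℤ) (R := K))
  rw [boldKap, Ring.inverse_eq_inv', mul_inv]
  field_simp

lemma monicOf_boldKap [CharZero K] (c : ℂ) : MonicOf 0 (boldKap (fU K c)) := by
  have h4 : (4⁻¹ : LaurentSeries K) = HahnSeries.C 4⁻¹ := by rw [map_inv₀, map_ofNat]
  rw [boldKap_eq, div_eq_mul_inv, h4]
  exact (monicOf_lin_sq_sub (sc c) (4⁻¹ : K)).mul ((monicOf_fU c).pow 2).inv

variable (v w) (ω : ∀ i, Fin (half v i) → K) (ζ : ∀ i, Fin (half w i) → K)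

lemma half_parity (d : Node n → ℕ) (i : ℕ) : (parity d i + 2 * half d i : ℤ) = extZero d i := by
  rw [parity, half]; omega

/-- The degree in `u` is counted factor by factor; `θ + 2 ⌊d/2⌋ = d` restores the original
dimensions. -/
lemma monicOf_fD [CharZero K] (m : ℂ →₀ ℤ) (i : ℕ) :
    MonicOf (-(extZero v i : ℤ) + extZero v (i - 1) + (parity v 1 - 2 * m.sum fun _ k => k) +
      ∑ j : Fin (i - 1), -(extZero w (j + 1) : ℤ)) (fD v w ω ζ m i) := by
  rw [fD, List.prod_ofFn, Ring.inverse_eq_inv']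
  have h1 := monicOf_fW v ω i (-(((i : ℂ) - 1) / 2))
  have h2 := (monicOf_fW v ω (i - 1) (-((i : ℂ) / 2))).inv
  rw [half_parity] at h1 h2
  rw [neg_neg] at h2
  refine ((h1.mul h2).mul ((monicOf_Z₀ v m).mapL _)).mul (MonicOf.prod _ fun j => ?_)
  have h3 := monicOf_fW w ζ (j + 1) (-((((j : ℕ) + 1 : ℕ) : ℂ) / 2))
  rw [half_parity] at h3
  simpa using ((monicOf_boldKap (K := K) _).pow (vartheta v (j + 1))).mul h3

lemma fD_ne_zero [CharZero K] (m : ℂ →₀ ℤ) (i : ℕ) : fD v w ω ζ m i ≠ 0 :=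
  (monicOf_fD v w ω ζ m i).ne_zero

variable {v w}

/-- The products over `j` telescope to the factor `j = i`. In the variable `y = u - i/2` the
polynomials of the nodes `i ± 1` are evaluated at `y`, and those of node `i` at `y ± 1/2`. -/
lemma inv_fD_mul_fD_succ_aux [CharZero K] (m : ℂ →₀ ℤ) {i : ℕ} (h1i : 1 ≤ i) :
    (fD v w ω ζ m i)⁻¹ * fD v w ω ζ m (i + 1) =
      (boldKap (fU K (-((i : ℂ) / 2))) ^ vartheta v i *
        fW v (fC ω) (i - 1) (fU K (-((i : ℂ) / 2))) *
        fW v (fC ω) (i + 1) (fU K (-((i : ℂ) / 2))) * fW w (fC ζ) i (fU K (-((i : ℂ) / 2)))) /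
      (fW v (fC ω) i (fU K (-((i : ℂ) / 2)) + HahnSeries.C 2⁻¹) *
        fW v (fC ω) i (fU K (-((i : ℂ) / 2)) - HahnSeries.C 2⁻¹)) := by
  obtain ⟨k, rfl⟩ : ∃ k, i = k + 1 := ⟨i - 1, by omega⟩
  have h0 := fD_ne_zero v w ω ζ m (k + 1)
  have e1 : fU K (-((((k + 1 : ℕ) : ℂ) - 1) / 2)) =
      fU K (-(((k + 1 : ℕ) : ℂ) / 2)) + HahnSeries.C 2⁻¹ := by
    rw [← sc_half, ← fU_add]
    congr 1
    ring
  have e2 : fU K (-(((k + 1 + 1 : ℕ) : ℂ) / 2)) =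
      fU K (-(((k + 1 : ℕ) : ℂ) / 2)) - HahnSeries.C 2⁻¹ := by
    rw [← sc_half, sub_eq_add_neg, ← map_neg, sc, ← map_neg, ← sc, ← fU_add]
    congr 1
    push_cast
    ring
  have e3 : fU K (-((((k + 1 + 1 : ℕ) : ℂ) - 1) / 2)) = fU K (-(((k + 1 : ℕ) : ℂ) / 2)) := by
    congr 1
    push_cast
    ring
  have n1 := (monicOf_fW v ω (k + 1) (-((((k + 1 : ℕ) : ℂ) - 1) / 2))).ne_zero
  have n2 := (monicOf_fW v ω (k + 1) (-(((k + 1 + 1 : ℕ) : ℂ) / 2))).ne_zero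
  have n3 := (monicOf_fW v ω (k + 1 - 1) (-(((k + 1 : ℕ) : ℂ) / 2))).ne_zero
  rw [e1] at n1
  rw [e2] at n2
  rw [inv_mul_eq_iff_eq_mul₀ h0]
  rw [add_tsub_cancel_right] at n3
  simp only [fD, List.prod_ofFn, Ring.inverse_eq_inv', e1, e2, e3, add_tsub_cancel_right]
  rw [Fin.prod_univ_castSucc]
  simp only [Fin.val_cast, Fin.val_castSucc, Fin.val_last]
  generalize (∏ x : Fin k, (_ : LaurentSeries K)) = e at *
  generalize fU K (-(((k + 1 : ℕ) : ℂ) / 2)) = x at *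
  generalize fW v (fC ω) (k + 1) (x + HahnSeries.C 2⁻¹) = a at *
  generalize fW v (fC ω) (k + 1) (x - HahnSeries.C 2⁻¹) = b at *
  generalize fW v (fC ω) k x = d at *
  field_simp

/-- `D_i(u)⁻¹ D_{i+1}(u)` as a rational function of `(u - i/2)²`. -/
lemma inv_fD_mul_fD_succ [CharZero K] {S : Type} [Ring S] [Algebra ℂ S] (G : ShiftRing v w K S)
    (m : ℂ →₀ ℤ) {i : ℕ} (hi : ParityCase v w i) (h1i : 1 ≤ i) :
    (fD v w G.ω G.ζ m i)⁻¹ * fD v w G.ω G.ζ m (i + 1) =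
      (numer v w G.ω G.ζ i).eval₂ HahnSeries.C (fU K (-((i : ℂ) / 2)) ^ 2) /
        ∏ p, (fU K (-((i : ℂ) / 2)) ^ 2 - HahnSeries.C (G.pt i p)) := by
  rw [inv_fD_mul_fD_succ_aux _ _ m h1i, boldKap_eq]
  have h0 : fU K (-((i : ℂ) / 2)) ≠ 0 := lin_ne_zero _
  have core : ((fU K (-((i : ℂ) / 2)) ^ 2 - 4⁻¹) / fU K (-((i : ℂ) / 2)) ^ 2) ^ vartheta v i *
      fW v (fC G.ω) (i - 1) (fU K (-((i : ℂ) / 2))) *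
        fW v (fC G.ω) (i + 1) (fU K (-((i : ℂ) / 2))) * fW w (fC G.ζ) i (fU K (-((i : ℂ) / 2))) =
      (fU K (-((i : ℂ) / 2)) ^ 2 - 4⁻¹) ^ parity v i *
        ((numer v w G.ω G.ζ i).eval₂ HahnSeries.C (fU K (-((i : ℂ) / 2)) ^ 2) /
          fU K (-((i : ℂ) / 2)) ^ 2) :=
    numer_core G.ω G.ζ (HahnSeries.C : K →+* LaurentSeries K) hi h0
  rw [core]
  have hx : fU K (-((i : ℂ) / 2)) ^ 2 - 4⁻¹ ≠ 0 := by
    have h4 : (4⁻¹ : LaurentSeries K) = HahnSeries.C 4⁻¹ := by rw [map_inv₀, map_ofNat]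
    rw [h4]
    exact (monicOf_lin_sq_sub _ _).ne_zero
  set x := fU K (-((i : ℂ) / 2)) with hxdef
  have h21 : (HahnSeries.C 2⁻¹ : LaurentSeries K) = 2⁻¹ := by rw [map_inv₀, map_ofNat]
  have : CharZero (LaurentSeries K) :=
    charZero_of_injective_ringHom (HahnSeries.C_injective (Γ := ℤ) (R := K))
  -- The four linear factors for each `s` pair up into the two differences `y² - t_p` for the poles
  -- `± w_s`; the extra pole accounts for the division by `y²`.
  have hd : fW v (fC G.ω) i (x + HahnSeries.C 2⁻¹) * fW v (fC G.ω) i (x - HahnSeries.C 2⁻¹) =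
      (x ^ 2 - 4⁻¹) ^ parity v i * ((∏ p, (x ^ 2 - HahnSeries.C (G.pt i p))) / x ^ 2) := by
    rw [Fintype.prod_option, Fintype.prod_prod_type, G.pt_none, map_zero, sub_zero,
      mul_div_cancel_left₀ _ (pow_ne_zero 2 h0)]
    simp only [fW, List.prod_ofFn, h21]
    rw [mul_mul_mul_comm, ← mul_pow, ← Finset.prod_mul_distrib]
    have e1 : (x + 2⁻¹) * (x - 2⁻¹) = x ^ 2 - 4⁻¹ := by
      field_simp
      ring
    have e2 : ∀ s, ((x + 2⁻¹) ^ 2 - fC G.ω i s ^ 2) * ((x - 2⁻¹) ^ 2 - fC G.ω i s ^ 2) =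
        ∏ b, (x ^ 2 - HahnSeries.C (G.pt i (some (s, b)))) := by
      intro s
      rw [Fintype.prod_bool, G.pt_true, G.pt_false]
      simp only [map_pow, map_sub, map_add, h21, fC]
      ring
    simp only [e1, e2]
  rw [hd, mul_div_mul_left _ _ (pow_ne_zero _ hx), div_div_div_cancel_right₀ (pow_ne_zero 2 h0)]

end Field

/-! ### The effect of the shifts on the images of `D_i(u)` and `D_{i+1}(u)`. -/

section Change

variable {n : ℕ} {v w : Node n → ℕ} {K : Type} [Field K]
  {ω ω' : ∀ i, Fin (half v i) → K} {ζ : ∀ i, Fin (half w i) → K} {i : ℕ} {r : Fin (half v i)}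

lemma fW_change (hs : ∀ s, s ≠ r → ω' i s = ω i s) (x : LaurentSeries K) :
    fW v (fC ω') i x * (x ^ 2 - HahnSeries.C (ω i r) ^ 2) =
      fW v (fC ω) i x * (x ^ 2 - HahnSeries.C (ω' i r) ^ 2) := by
  simp only [fW, List.prod_ofFn, fC, mul_assoc]
  rw [prod_mul_eq_of_ne (f := fun s => x ^ 2 - HahnSeries.C (ω' i s) ^ 2)
    (g := fun s => x ^ 2 - HahnSeries.C (ω i s) ^ 2) r fun s h => by rw [hs s h]]

lemma fW_congr {j : ℕ} (h : ω' j = ω j) (x : LaurentSeries K) :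
    fW v (fC ω') j x = fW v (fC ω) j x := by
  simp only [fW, fC, h]

variable [Algebra ℂ K]

lemma fD_change_self (m : ℂ →₀ ℤ) (h1i : 1 ≤ i) (hk : ∀ k, k ≠ i → ω' k = ω k)
    (hs : ∀ s, s ≠ r → ω' i s = ω i s) :
    fD v w ω' ζ m i * (fU K (-(((i : ℂ) - 1) / 2)) ^ 2 - HahnSeries.C (ω i r) ^ 2) =
      fD v w ω ζ m i * (fU K (-(((i : ℂ) - 1) / 2)) ^ 2 - HahnSeries.C (ω' i r) ^ 2) := by
  rw [fD, fD, fW_congr (hk (i - 1) (by omega))]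
  have := fW_change hs (fU K (-(((i : ℂ) - 1) / 2)))
  generalize Ring.inverse (_ : LaurentSeries K) = a
  generalize (List.prod _ : LaurentSeries K) = b
  generalize mapL (algebraMap ℂ K) (Z₀ v m) = c
  linear_combination a * b * c * this

lemma fU_sub_one (i : ℕ) : fU K (-(((i + 1 : ℕ) : ℂ) / 2)) = fU K (-(((i : ℂ) - 1) / 2)) - 1 := by
  rw [← map_one HahnSeries.C, sub_eq_add_neg, ← map_neg, ← map_one (algebraMap ℂ K), ← map_neg,
    ← sc, ← fU_add]
  congr 1
  push_cast
  ring

/-- Here the polynomial of node `i` stands in the denominator and is evaluated one step lower, at `X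
- 1` with `X = u - (i-1)/2`. -/
lemma fD_change_succ (m : ℂ →₀ ℤ) (hk : ∀ k, k ≠ i → ω' k = ω k)
    (hs : ∀ s, s ≠ r → ω' i s = ω i s) :
    fD v w ω' ζ m (i + 1) *
        ((fU K (-(((i : ℂ) - 1) / 2)) - 1) ^ 2 - HahnSeries.C (ω' i r) ^ 2) =
      fD v w ω ζ m (i + 1) *
        ((fU K (-(((i : ℂ) - 1) / 2)) - 1) ^ 2 - HahnSeries.C (ω i r) ^ 2) := by
  rw [fD, fD, fW_congr (hk (i + 1) (by omega)), ← fU_sub_one]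
  have h := fW_change hs (fU K (-(((i + 1 : ℕ) : ℂ) / 2)))
  have n1 := (monicOf_fW v ω i (-(((i + 1 : ℕ) : ℂ) / 2))).ne_zero
  have n2 := (monicOf_fW v ω' i (-(((i + 1 : ℕ) : ℂ) / 2))).ne_zero
  rw [add_tsub_cancel_right, Ring.inverse_eq_inv']
  generalize fU K (-(((i + 1 : ℕ) : ℂ) / 2)) = x at *
  generalize (List.prod _ : LaurentSeries K) = b
  generalize mapL (algebraMap ℂ K) (Z₀ v m) = c
  field_simp
  linear_combination -fW v (fC ω) (i + 1) (fU K (-((((i + 1 : ℕ) : ℂ) - 1) / 2))) * b * c * h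

end Change

namespace ShiftRing

variable {n : ℕ} {v w : Node n → ℕ} {K S : Type} [Field K] [Algebra ℂ K] [Ring S]
  [Algebra ℂ S] (G : ShiftRing v w K S)

lemma pσ_ζ (i : ℕ) (p : Pt v i) (j : ℕ) (s : Fin (half w j)) :
    G.pσ i p (G.ζ j s) = G.ζ j s := by
  rcases p with _ | ⟨r, b⟩
  · rfl
  · exact G.shift_ζ _ _ _ _ _

lemma mapL_pσ_fD (m : ℂ →₀ ℤ) (i : ℕ) (p : Pt v i) (j : ℕ) :
    mapL (G.pσ i p : K →+* K) (fD v w G.ω G.ζ m j) =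
      fD v w (fun k s => G.pσ i p (G.ω k s)) G.ζ m j := by
  rw [mapL_fD]
  simp only [pσ_ζ]

/-- This is the rescaling hypothesis of `ShiftData.ι_comm_E`. At the extra pole the shift is
trivial, and the two quadratic factors agree because `2 w_p = 1`. -/
lemma σ_fD_self (m : ℂ →₀ ℤ) {i : ℕ} (h1i : 1 ≤ i) (p : Pt v i) :
    mapL (G.pσ i p : K →+* K) (fD v w G.ω G.ζ m i) *
      ((fU K (-(((i : ℂ) - 1) / 2)) - HahnSeries.C (G.pw i p)) *
        (fU K (-(((i : ℂ) - 1) / 2)) + HahnSeries.C (G.pw i p))) =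
    fD v w G.ω G.ζ m i *
      ((fU K (-(((i : ℂ) - 1) / 2)) - HahnSeries.C (G.pw i p) + 1) *
        (fU K (-(((i : ℂ) - 1) / 2)) + HahnSeries.C (G.pw i p) - 1)) := by
  have := G.charZero
  rw [mapL_pσ_fD]
  rcases p with _ | ⟨r, b⟩
  · have h : (HahnSeries.C (G.pw i none) : LaurentSeries K) + HahnSeries.C (G.pw i none) = 1 := by
      rw [← map_add, ← map_one HahnSeries.C]
      congr 1
      simp only [pw, ptW]
      rw [← two_mul, mul_inv_cancel₀ two_ne_zero]
    simp only [pσ, AlgHom.id_apply]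
    generalize fU K (-(((i : ℂ) - 1) / 2)) = X
    linear_combination -fD v w (fun k s => G.ω k s) G.ζ m i * h
  · have h := fD_change_self (w := w) (ζ := G.ζ) (r := r) m h1i
      (fun k hk => G.shift_ω_ne r b hk) (fun s hs => G.shift_ω_same_ne b hs)
    rw [← map_pow HahnSeries.C, ← map_pow HahnSeries.C, ← G.pw_sub_one_sq, ← G.pw_sq i r b] at h
    simp only [map_pow, map_sub, map_one] at h
    simp only [pσ]
    linear_combination h

lemma σ_fD_succ (m : ℂ →₀ ℤ) {i : ℕ} (p : Pt v i) :
    mapL (G.pσ i p : K →+* K) (fD v w G.ω G.ζ m (i + 1)) *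
      ((fU K (-(((i : ℂ) - 1) / 2)) - HahnSeries.C (G.pw i p)) *
        (fU K (-(((i : ℂ) - 1) / 2)) + HahnSeries.C (G.pw i p) - 2)) =
    fD v w G.ω G.ζ m (i + 1) *
      ((fU K (-(((i : ℂ) - 1) / 2)) - HahnSeries.C (G.pw i p) - 1) *
        (fU K (-(((i : ℂ) - 1) / 2)) + HahnSeries.C (G.pw i p) - 1)) := by
  have := G.charZero
  rw [mapL_pσ_fD]
  rcases p with _ | ⟨r, b⟩
  · have h : (HahnSeries.C (G.pw i none) : LaurentSeries K) + HahnSeries.C (G.pw i none) = 1 := by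
      rw [← map_add, ← map_one HahnSeries.C]
      congr 1
      simp only [pw, ptW]
      rw [← two_mul, mul_inv_cancel₀ two_ne_zero]
    simp only [pσ, AlgHom.id_apply]
    generalize fU K (-(((i : ℂ) - 1) / 2)) = X
    linear_combination fD v w (fun k s => G.ω k s) G.ζ m (i + 1) * h
  · have h := fD_change_succ (w := w) (ζ := G.ζ) (r := r) m
      (fun k hk => G.shift_ω_ne r b hk) (fun s hs => G.shift_ω_same_ne b hs)
    rw [← map_pow HahnSeries.C, ← map_pow HahnSeries.C, ← G.pw_sub_one_sq, ← G.pw_sq i r b] at h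
    simp only [map_pow, map_sub, map_one] at h
    simp only [pσ]
    linear_combination h

variable [CharZero K]

lemma substHom_neg_fU (i : ℕ) :
    substHom (-1) (i : ℂ) (fU K (-((i : ℂ) / 2))) = -fU K (-((i : ℂ) / 2)) := by
  rw [fU, lin, map_add, substHom_uvar, substHom_C]
  simp only [sc, Units.val_neg, Units.val_one, Int.cast_neg, Int.cast_one, map_neg, map_one,
    neg_mul, one_mul, neg_add, neg_neg, add_assoc]
  congr 1
  rw [← map_neg, ← map_add, ← map_neg, ← map_add]
  congr 2
  ring

/-- Under `u ↦ -u + i` the variable `u - i/2` changes sign, and only its square occurs. -/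
lemma substHom_inv_fD_mul_fD_succ (m : ℂ →₀ ℤ) {i : ℕ} (hi : ParityCase v w i) (h1i : 1 ≤ i) :
    substHom (-1) (i : ℂ) ((fD v w G.ω G.ζ m i)⁻¹ * fD v w G.ω G.ζ m (i + 1)) =
      (fD v w G.ω G.ζ m i)⁻¹ * fD v w G.ω G.ζ m (i + 1) := by
  have hc : (substHom (-1) (i : ℂ)).comp (HahnSeries.C : K →+* LaurentSeries K) =
      HahnSeries.C := RingHom.ext fun b => substHom_C _ _ b
  rw [inv_fD_mul_fD_succ G m hi h1i, map_div₀, map_prod, Polynomial.hom_eval₂, hc]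
  simp only [map_pow, map_sub, substHom_neg_fU, substHom_C, even_two, Even.neg_pow]

end ShiftRing

lemma coeff_mul_C {B : Type} [Ring B] (f : LaurentSeries B) (b : B) (r : ℤ) :
    (f * HahnSeries.C b).coeff r = f.coeff r * b := by
  rw [HahnSeries.C_apply, HahnSeries.coeff_mul_single_zero]

/-! ### The shift data attached to a node, and their extension to Laurent series. -/

namespace ShiftRing

variable {n : ℕ} {v w : Node n → ℕ} {K S : Type} [Field K] [Algebra ℂ K] [Ring S]
  [Algebra ℂ S] (G : ShiftRing v w K S)

lemma ι_pc_mul_ι_pc (c c' : ℂ) (i j : ℕ) (p : Pt v i) (q : Pt v j) :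
    G.ι (G.pc c i p) * G.pδ i p * (G.ι (G.pc c' j q) * G.pδ j q) =
      G.ι (G.pc c i p * G.pσ i p (G.pc c' j q)) * (G.pδ i p * G.pδ j q) := by
  rw [mul_assoc, ← mul_assoc (G.pδ i p), G.pδ_mul, map_mul]
  simp only [mul_assoc]

/-- The shift data of a node. -/
def data (c : ℂ) {i : ℕ} (h1i : 1 ≤ i) : ShiftData K S (Pt v i) where
  ι := G.ι
  w := G.pw i
  χ p := G.ι (G.pc c i p) * G.pδ i p
  σ p := G.pσ i p
  bar := Pt.bar
  φ := G.pφ c i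
  χ_mul p f := by
    change _ * G.ι f = G.ι (G.pσ i p f) * _
    rw [mul_assoc, G.pδ_mul, ← mul_assoc, ← mul_assoc, ← map_mul, ← map_mul, mul_comm]
  bar_bar := Pt.bar_bar
  σ_self p hp := G.pσ_pw_self fun h => hp (by rw [h]; rfl)
  σ_bar := G.pσ_pw_bar
  σ_ne p q h1 h2 := G.pσ_pw_of_unrel (unrel_of_ne_bar h1 h2)
  exch p q h1 h2 := by
    change G.ι _ * _ = G.ι _ * _
    rw [ι_pc_mul_ι_pc, ι_pc_mul_ι_pc, ← mul_assoc (G.ι _), ← mul_assoc (G.ι _), ← map_mul,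
      ← map_mul, G.exch_same c h1i h1 h2, G.pδ_comm]
  χ_bar p := by
    change _ = G.ι _
    rw [ι_pc_mul_ι_pc, G.pδ_bar, mul_one]
    rfl

lemma independent (c c' : ℂ) {i j : ℕ} (h1i : 1 ≤ i) (h1j : 1 ≤ j) (hij : i ≠ j) :
    ShiftData.Independent (G.data c h1i) (G.data c' h1j) where
  ι_eq := rfl
  σ_left p q := G.pσ_pw_of_unrel (unrel_of_ne hij p q)
  σ_right p q := G.pσ_pw_of_unrel (unrel_of_ne hij.symm q p)

lemma commuting (c c' : ℂ) {i j : ℕ} (h1i : 1 ≤ i) (h1j : 1 ≤ j) (hij : i ≠ j)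
    (h1 : i + 1 ≠ j) (h2 : j + 1 ≠ i) :
    ShiftData.Commuting (G.data c h1i) (G.data c' h1j) where
  toIndependent := G.independent c c' h1i h1j hij
  χ_comm p q := by
    change G.ι _ * _ * (G.ι _ * _) = G.ι _ * _ * (G.ι _ * _)
    rw [ι_pc_mul_ι_pc, ι_pc_mul_ι_pc, G.pσ_pc_far c (by omega) (by omega) (by omega),
      G.pσ_pc_far c' (by omega) (by omega) (by omega), G.pδ_comm, mul_comm (G.pc _ _ _)]

lemma adjacent (c c' : ℂ) {i : ℕ} (h1i : 1 ≤ i) (h1i' : 1 ≤ i + 1)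
    (hpar : parity v i = 0 ∨ parity v (i + 1) = 0) :
    ShiftData.Adjacent (G.data c h1i) (G.data c' h1i') where
  toIndependent := G.independent c c' h1i h1i' (by omega)
  exch p q := by
    change G.ι _ * (G.ι _ * _ * (G.ι _ * _)) = G.ι _ * (G.ι _ * _ * (G.ι _ * _))
    rw [ι_pc_mul_ι_pc, ι_pc_mul_ι_pc, ← mul_assoc (G.ι _), ← mul_assoc (G.ι _), ← map_mul,
      ← map_mul, G.pδ_comm]
    congr 2
    exact G.exch_adjacent c c' hpar p q

end ShiftRing

namespace ShiftData

variable {F T P Q : Type} [Field F] [Ring T]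

/-- Exchanging the roles only changes signs. The Serre relation needs the neighbour on either side.
-/
lemma Adjacent.symm {D : ShiftData F T P} {D' : ShiftData F T Q} (h : Adjacent D D') :
    Adjacent D' D where
  ι_eq := h.ι_eq.symm
  σ_left q p := h.σ_right p q
  σ_right q p := h.σ_left p q
  exch q p := by
    have e1 : D'.w q - D.w p + 2⁻¹ = -(D.w p - D'.w q - 2⁻¹) := by ring
    have e2 : D'.w q - D.w p - 2⁻¹ = -(D.w p - D'.w q + 2⁻¹) := by ring
    rw [h.ι_eq, e1, e2, map_neg, map_neg, neg_mul, neg_mul, h.exch]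

lemma C_mul_mapL (b : T) (σ : F →+* F) (ι : F →+* T) (h : ∀ f, b * ι f = ι (σ f) * b)
    (f : LaurentSeries F) :
    HahnSeries.C b * mapL ι f = mapL ι (mapL σ f) * HahnSeries.C b := by
  ext r
  simp only [HahnSeries.C_apply, HahnSeries.coeff_single_zero_mul,
    HahnSeries.coeff_mul_single_zero, coeff_mapL, h]

/-- The extension of scalars to Laurent series. -/
def series (D : ShiftData F T P) : ShiftData (LaurentSeries F) (LaurentSeries T) P where
  ι := mapL D.ι
  w p := HahnSeries.C (D.w p)
  χ p := HahnSeries.C (D.χ p)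
  σ p := mapL (D.σ p)
  bar := D.bar
  φ p := HahnSeries.C (D.φ p)
  χ_mul p := C_mul_mapL _ _ _ (D.χ_mul p)
  bar_bar := D.bar_bar
  σ_self p hp := by rw [mapL_C, D.σ_self p hp, map_sub, map_one]
  σ_bar p := by rw [mapL_C, D.σ_bar, map_sub, map_one]
  σ_ne p q h1 h2 := by rw [mapL_C, D.σ_ne p q h1 h2]
  exch p q h1 h2 := by
    rw [← map_sub, ← map_one HahnSeries.C, ← map_add, ← map_sub, ← map_mul, ← map_mul, mapL_C,
      mapL_C, ← map_mul, ← map_mul, D.exch p q h1 h2]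
  χ_bar p := by rw [mapL_C, ← map_mul, D.χ_bar]

lemma Independent.series {D : ShiftData F T P} {D' : ShiftData F T Q} (h : Independent D D') :
    Independent D.series D'.series where
  ι_eq := congrArg mapL h.ι_eq
  σ_left p q := (mapL_C _ _).trans (congrArg _ (h.σ_left p q))
  σ_right p q := (mapL_C _ _).trans (congrArg _ (h.σ_right p q))

lemma Commuting.series {D : ShiftData F T P} {D' : ShiftData F T Q} (h : Commuting D D') :
    Commuting D.series D'.series where
  toIndependent := h.toIndependent.series
  χ_comm p q := by
    change HahnSeries.C _ * HahnSeries.C _ = HahnSeries.C _ * HahnSeries.C _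
    rw [← map_mul, h.χ_comm, map_mul]

lemma Adjacent.series {D : ShiftData F T P} {D' : ShiftData F T Q} (h : Adjacent D D') :
    Adjacent D.series D'.series where
  toIndependent := h.toIndependent.series
  exch p q := by
    have h2 : (2⁻¹ : LaurentSeries F) = HahnSeries.C 2⁻¹ := by rw [map_inv₀, map_ofNat]
    change mapL _ (HahnSeries.C _ - HahnSeries.C _ + _) * (HahnSeries.C _ * HahnSeries.C _) =
      mapL _ (HahnSeries.C _ - HahnSeries.C _ - _) * (HahnSeries.C _ * HahnSeries.C _)
    rw [h2, ← map_sub, ← map_add, ← map_sub, mapL_C, mapL_C, ← map_mul, ← map_mul, ← map_mul,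
      ← map_mul, h.exch]

variable [Fintype P] (D : ShiftData F T P)

lemma C_E (X : F) : HahnSeries.C (D.E X) = D.series.E (HahnSeries.C X) := by
  simp only [E, map_sum, map_mul]
  refine Finset.sum_congr rfl fun p _ => ?_
  change _ = mapL D.ι (_ - HahnSeries.C _)⁻¹ * HahnSeries.C _
  rw [← map_sub, ← map_inv₀, mapL_C]

/-- Together with `C_E` this exhibits `E(u)` and `E(v)` as values of one and the same function, over
the field of iterated Laurent series, at two elements of that field. The identities proved for
arbitrary `X` and `Y` can then be specialized. -/
lemma mapL_C_E (X : LaurentSeries F) :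
    mapL (HahnSeries.C : T →+* LaurentSeries T) (D.series.E X) =
      D.series.series.E (mapL (HahnSeries.C : F →+* LaurentSeries F) X) := by
  simp only [E, map_sum, map_mul]
  refine Finset.sum_congr rfl fun p _ => ?_
  change mapL HahnSeries.C (mapL D.ι (_ - HahnSeries.C _)⁻¹) * mapL HahnSeries.C (HahnSeries.C _) =
    mapL (mapL D.ι) (_ - HahnSeries.C (HahnSeries.C _))⁻¹ * HahnSeries.C (HahnSeries.C _)
  rw [mapL_C]
  congr 1
  have : mapL (HahnSeries.C : F →+* LaurentSeries F) X - HahnSeries.C (HahnSeries.C (D.w p)) =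
      mapL (HahnSeries.C : F →+* LaurentSeries F) (X - HahnSeries.C (D.w p)) := by
    rw [map_sub, mapL_C]
  rw [this, ← map_inv₀, mapL_mapL, mapL_mapL]
  congr 2
  ext1 x
  simp only [RingHom.comp_apply, mapL_C]

lemma substHom_E (ε : ℤˣ) (a : ℂ) [Algebra ℂ F] [Algebra ℂ T]
    (hι : ∀ z : ℂ, D.ι (algebraMap ℂ F z) = algebraMap ℂ T z) (X : LaurentSeries F) :
    substHom ε a (D.series.E X) = D.series.E (substHom ε a X) := by
  simp only [E, map_sum, map_mul]
  refine Finset.sum_congr rfl fun p _ => ?_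
  change substHom ε a (mapL D.ι (_ - HahnSeries.C _)⁻¹) * substHom ε a (HahnSeries.C _) =
    mapL D.ι (_ - HahnSeries.C _)⁻¹ * HahnSeries.C _
  rw [substHom_C, substHom_apply, substAffine_mapL ε a _ hι, ← substHom_apply, map_inv₀, map_sub,
    substHom_C]

/-- Each `(X - w_p)⁻¹` begins with `u⁻¹`. -/
lemma coeff_one_E (X : LaurentSeries F) (hX : ∀ p, MonicOf (-1) (X - HahnSeries.C (D.w p))) :
    (D.series.E X).coeff 1 = D.S := by
  rw [E, HahnSeries.coeff_sum]
  refine Finset.sum_congr rfl fun p _ => ?_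
  change (mapL D.ι (_ - HahnSeries.C _)⁻¹ * HahnSeries.C _).coeff 1 = _
  have h : ((X - HahnSeries.C (D.w p))⁻¹).coeff 1 = 1 := (hX p).inv.2
  rw [coeff_mul_C, coeff_mapL, h, map_one, one_mul]

lemma C_S : HahnSeries.C D.S = D.series.S := by
  rw [S, map_sum]
  rfl

lemma vanishBelow_E (X : LaurentSeries F) (hX : ∀ p, MonicOf (-1) (X - HahnSeries.C (D.w p))) :
    VanishBelow 1 (D.series.E X) := by
  intro r hr
  rw [E, HahnSeries.coeff_sum]
  refine Finset.sum_eq_zero fun p _ => ?_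
  change (mapL D.ι (_ - HahnSeries.C _)⁻¹ * HahnSeries.C _).coeff r = _
  rw [coeff_mul_C, coeff_mapL, (hX p).inv.1 r hr, map_zero,
    zero_mul]

end ShiftData

/-! ### Series in two variables. -/

section TwoVariables

variable {B C : Type} [Ring B] [Ring C]

lemma mapL_inU (φ : B →+* C) (f : LaurentSeries B) :
    mapL (mapL φ) (inU f) = inU (mapL φ f) := mapL_C _ _

lemma mapL_inV (φ : B →+* C) (f : LaurentSeries B) :
    mapL (mapL φ) (inV f) = inV (mapL φ f) := by
  change mapL (mapL φ) (mapL HahnSeries.C f) = mapL HahnSeries.C (mapL φ f)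
  rw [mapL_mapL, mapL_mapL]
  congr 2
  ext1 x
  simp only [RingHom.comp_apply, mapL_C]

lemma inU_eq (f : LaurentSeries B) : inU f = HahnSeries.C f := rfl

lemma inV_eq (f : LaurentSeries B) :
    inV f = mapL (HahnSeries.C : B →+* LaurentSeries B) f := rfl

lemma map_comm (φ : B →+* C) (a b : B) : φ (comm a b) = comm (φ a) (φ b) := by
  simp only [comm, map_sub, map_mul]

variable {K : Type} [Field K]

lemma inU_lin_ne (a b : K) : inU (lin a) + HahnSeries.C (HahnSeries.C b) ≠ 0 := by
  rw [inU_eq, ← map_add, lin, add_assoc, ← map_add]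
  exact (map_ne_zero _).2 (lin_ne_zero _)

lemma inV_lin_ne (a b : K) : inV (lin a) + HahnSeries.C (HahnSeries.C b) ≠ 0 := by
  rw [inV_eq, ← mapL_C, ← map_add, lin, add_assoc, ← map_add]
  exact (map_ne_zero _).2 (lin_ne_zero _)

end TwoVariables

/-! ### The defining relations over the field. -/

lemma Node.one_le {n : ℕ} (i : Node n) : 1 ≤ (i : ℕ) := i.2.1

/-- The images of the generating series under a homomorphism. -/
structure ShiftRing.IsImage {n : ℕ} {v w : Node n → ℕ} {K S : Type} [Field K] [Algebra ℂ K]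
    [Ring S] [Algebra ℂ S] (G : ShiftRing v w K S) (mu : Coweight n) (m : ℂ →₀ ℤ)
    (c : Node n → ℂ) (F : YFree n →ₐ[ℂ] S) : Prop where
  D : ∀ i : Idx n, mapL (F : YFree n →+* S) (freeD mu i) =
    mapL (G.ι : K →+* S) (fD v w G.ω G.ζ m i)
  Dt : ∀ i : Idx n, mapL (F : YFree n →+* S) (freeDt mu i) =
    mapL (G.ι : K →+* S) (fD v w G.ω G.ζ m i)⁻¹
  E : ∀ i : Node n, mapL (F : YFree n →+* S) (freeE i) =
    (G.data (c i) (Node.one_le i)).series.E (fU K (-(((i : ℕ) - 1 : ℂ) / 2)))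
  monic : ∀ i : Idx n, MonicOf (mu i) (fD v w G.ω G.ζ m i)
  parityCase : ∀ i : Node n, ParityCase v w i
  adjacent : ∀ i j : Node n, (j : ℕ) = i + 1 → parity v i = 0 ∨ parity v j = 0
  sq : ∀ i : Node n, c i ^ 2 = (-1) ^ (half w i + half v (i - 1) + half v (i + 1))

namespace ShiftRing.IsImage

variable {n : ℕ} {v w : Node n → ℕ} {K S : Type} [Field K] [Algebra ℂ K]
    [Ring S] [Algebra ℂ S] {G : ShiftRing v w K S} {mu : Coweight n} {m : ℂ →₀ ℤ}
    {c : Node n → ℂ} {F : YFree n →ₐ[ℂ] S}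

/-- The variable `u - (i-1)/2`. -/
abbrev cen (K : Type) [Field K] [Algebra ℂ K] (i : ℕ) : LaurentSeries K :=
  fU K (-(((i : ℂ) - 1) / 2))

lemma lead (h : G.IsImage mu m c F) (i : Idx n) : F ((freeD mu i).coeff (mu i)) = F 1 := by
  have := congrArg (fun f => HahnSeries.coeff f (mu i)) (h.D i)
  simp only [coeff_mapL, (h.monic i).2] at this
  rw [map_one, ← map_one (G.ι : K →+* S), ← this]
  rfl

lemma ddt (h : G.IsImage mu m c F) (i : Idx n) : mapL (F : YFree n →+* S) (freeD mu i * freeDt mu i) = 1 := by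
  rw [map_mul, h.D, h.Dt, ← map_mul, mul_inv_cancel₀ (h.monic i).ne_zero, map_one]

lemma dtd (h : G.IsImage mu m c F) (i : Idx n) : mapL (F : YFree n →+* S) (freeDt mu i * freeD mu i) = 1 := by
  rw [map_mul, h.D, h.Dt, ← map_mul, inv_mul_cancel₀ (h.monic i).ne_zero, map_one]

lemma dd (h : G.IsImage mu m c F) (i j : Idx n) : mapL (mapL (F : YFree n →+* S))
    (comm (inU (freeD mu i)) (inV (freeD mu j))) = 0 := by
  rw [map_comm, mapL_inU, mapL_inV, h.D, h.D, ← mapL_inU, ← mapL_inV, ← map_comm, comm, mul_comm,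
    sub_self, map_zero]

lemma even (h : G.IsImage mu m c F) (i : Node n) : mapL (F : YFree n →+* S) (freeDt mu (lo i) * freeD mu (hi i)) =
    mapL (F : YFree n →+* S) (substAffine (-1) (i : ℂ) (freeDt mu (lo i)) *
          substAffine (-1) (i : ℂ) (freeD mu (hi i))) := by
  have := G.charZero
  have e := G.substHom_inv_fD_mul_fD_succ m (h.parityCase i) (Node.one_le i)
  rw [map_mul, map_mul, ← substAffine_mapL _ _ (F : YFree n →+* S) F.commutes, ← substAffine_mapL _ _ (F : YFree n →+* S) F.commutes,
    h.Dt, h.D, substAffine_mapL _ _ (G.ι : K →+* S) G.ι.commutes, substAffine_mapL _ _ (G.ι : K →+* S) G.ι.commutes,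
    ← map_mul, ← map_mul, ← substAffine_mul]
  exact congrArg _ e.symm

lemma map_uSubV (G : ShiftRing v w K S) (F : YFree n →ₐ[ℂ] S) (i : Node n) :
    mapL (mapL (F : YFree n →+* S)) (uSubV n) =
    mapL (mapL (G.ι : K →+* S)) (inU (cen K i) - inV (cen K i)) := by
  have : inU (cen K i) - inV (cen K i) = U K - V K := by
    simp only [cen, fU, lin, inU_eq, inV_eq, map_add, mapL_C, U, V]
    ring
  rw [this]
  simp only [uSubV, U, V, map_sub, mapL_inU, mapL_inV, mapL_uvar]

/-- In the centred variables `X = u - (i-1)/2` and `Y = v - (i-1)/2`, the sum `u + v - i` becomes `X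
+ Y - 1`. -/
lemma map_uAddV (G : ShiftRing v w K S) (F : YFree n →ₐ[ℂ] S) (i : Node n) :
    mapL (mapL (F : YFree n →+* S)) (uAddV i) =
    mapL (mapL (G.ι : K →+* S)) (inU (cen K i) + inV (cen K i) - 1) := by
  have : inU (cen K i) + inV (cen K i) - 1 = U K + V K - ((i : ℕ) : Series₂ K) := by
    simp only [cen, fU, lin, inU_eq, inV_eq, map_add, mapL_C, U, V]
    have e : (HahnSeries.C (HahnSeries.C (sc (-(((i : ℕ) - 1 : ℂ) / 2)) : K)) : Series₂ K) +
        HahnSeries.C (HahnSeries.C (sc (-(((i : ℕ) - 1 : ℂ) / 2)))) - 1 = -((i : ℕ) : Series₂ K) := by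
      rw [← map_add, ← map_add, sc, ← map_add]
      have : (-(((i : ℕ) - 1 : ℂ) / 2) + -(((i : ℕ) - 1 : ℂ) / 2)) = 1 - (i : ℕ) := by ring
      rw [this]
      simp only [map_sub, map_one, map_natCast]
      ring
    linear_combination e
  rw [this]
  simp only [uAddV, U, V, map_sub, map_add, mapL_inU, mapL_inV, mapL_uvar, map_natCast]

lemma map_inU_E (h : G.IsImage mu m c F) (i : Node n) : mapL (mapL (F : YFree n →+* S)) (inU (freeE i)) =
    (G.data (c i) (Node.one_le i)).series.series.E (inU (cen K i)) := by
  rw [mapL_inU, h.E, inU_eq, ShiftData.C_E]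
  rfl

lemma map_inV_E (h : G.IsImage mu m c F) (i : Node n) : mapL (mapL (F : YFree n →+* S)) (inV (freeE i)) =
    (G.data (c i) (Node.one_le i)).series.series.E (inV (cen K i)) := by
  rw [mapL_inV, h.E, inV_eq, ShiftData.mapL_C_E]
  rfl

/-- The substitution `u ↦ -u + i` sends `X` to `1 - X`. -/
lemma map_subst_E (h : G.IsImage mu m c F) (i : Node n) :
    mapL (mapL (F : YFree n →+* S)) (inU (substAffine (-1) (i : ℂ) (freeE i))) =
    (G.data (c i) (Node.one_le i)).series.series.E (1 - inU (cen K i)) := by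
  rw [mapL_inU, ← substAffine_mapL _ _ (F : YFree n →+* S) F.commutes, h.E, ← substHom_apply,
    ShiftData.substHom_E _ _ _ G.ι.commutes, inU_eq, ShiftData.C_E, inU_eq]
  congr 1
  rw [← map_one HahnSeries.C, ← map_sub]
  congr 1
  rw [cen, fU, lin, map_add, substHom_uvar, substHom_C]
  have : (sc (-(((i : ℕ) - 1 : ℂ) / 2)) : K) = 1 - sc (-(((i : ℕ) - 1 : ℂ) / 2)) - algebraMap ℂ K i := by
    simp only [sc]
    rw [← map_one (algebraMap ℂ K), ← map_sub, ← map_sub]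
    congr 1
    ring
  simp only [Units.val_neg, Units.val_one, Int.cast_neg, Int.cast_one, map_neg, map_one,
    neg_mul, one_mul]
  nth_rw 1 [this]
  simp only [map_sub, map_one]
  ring

lemma map_inU_D (h : G.IsImage mu m c F) (i : Idx n) : mapL (mapL (F : YFree n →+* S)) (inU (freeD mu i)) =
    mapL (mapL (G.ι : K →+* S)) (inU (fD v w G.ω G.ζ m i)) := by
  rw [mapL_inU, h.D, mapL_inU]

end ShiftRing.IsImage

namespace ShiftRing.IsImage

variable {n : ℕ} {v w : Node n → ℕ} {K S : Type} [Field K] [Algebra ℂ K]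
    [Ring S] [Algebra ℂ S] {G : ShiftRing v w K S} {mu : Coweight n} {m : ℂ →₀ ℤ}
    {c : Node n → ℂ} {F : YFree n →ₐ[ℂ] S}

lemma inU_cen_ne (i : ℕ) {x : Series₂ K} (b : K)
    (hx : x = inU (cen K i) + HahnSeries.C (HahnSeries.C b)) : x ≠ 0 :=
  hx ▸ inU_lin_ne (sc (-(((i : ℕ) - 1 : ℂ) / 2)) : K) b

lemma inV_cen_ne (i : ℕ) {x : Series₂ K} (b : K)
    (hx : x = inV (cen K i) + HahnSeries.C (HahnSeries.C b)) : x ≠ 0 :=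
  hx ▸ inV_lin_ne (sc (-(((i : ℕ) - 1 : ℂ) / 2)) : K) b

lemma charZero_laurent (F : Type) [Field F] [CharZero F] : CharZero (LaurentSeries F) :=
  charZero_of_injective_ringHom (HahnSeries.C_injective (Γ := ℤ) (R := F))

lemma de (h : G.IsImage mu m c F) (i : Node n) : mapL (mapL (F : YFree n →+* S))
      (uSubV n * uAddV i * comm (inU (freeD mu (lo i))) (inV (freeE i))) =
    mapL (mapL (F : YFree n →+* S))
      (uAddV i * (inU (freeD mu (lo i)) * (inU (freeE i) - inV (freeE i))) +
          uSubV n * ((inV (freeE i) - inU (substAffine (-1) (i : ℂ) (freeE i))) *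
            inU (freeD mu (lo i)))) := by
  simp only [map_add, map_mul, map_sub, map_comm, h.map_inU_D, h.map_inU_E, h.map_inV_E,
    h.map_subst_E, map_uSubV G F i, map_uAddV G F i]
  simp only [← map_add, ← map_mul, ← map_sub]
  refine (G.data (c i) (Node.one_le i)).series.series.ι_comm_E (X := inU (cen K i))
    (Y := inV (cen K i)) (d := inU (fD v w G.ω G.ζ m i)) ?_ ?_ ?_ ?_ ?_
  · intro p
    have := congrArg (HahnSeries.C : LaurentSeries K →+* Series₂ K)
      (G.σ_fD_self m (Node.one_le i) p)
    simp only [map_mul, map_add, map_sub, map_one] at this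
    exact (congrArg (· * _) (mapL_C _ _)).trans this
  · exact fun p => inU_cen_ne i (-G.pw i p) (by rw [map_neg, map_neg]; exact sub_eq_add_neg _ _)
  · exact fun p => inV_cen_ne i (-G.pw i p) (by rw [map_neg, map_neg]; exact sub_eq_add_neg _ _)
  · exact fun p => inU_cen_ne i (G.pw i p) rfl
  · exact fun p => inU_cen_ne i (G.pw i p - 1) (by
      simp only [map_sub, map_one]
      exact add_sub_assoc _ _ _)

lemma ed (h : G.IsImage mu m c F) (i : Node n) : mapL (mapL (F : YFree n →+* S))
      (uSubV n * uAddV i * comm (inV (freeE i)) (inU (freeD mu (hi i)))) =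
    mapL (mapL (F : YFree n →+* S))
      (uAddV i * (inU (freeD mu (hi i)) * (inU (freeE i) - inV (freeE i))) +
          uSubV n * ((inV (freeE i) - inU (substAffine (-1) (i : ℂ) (freeE i))) *
            inU (freeD mu (hi i)))) := by
  simp only [map_add, map_mul, map_sub, map_comm, h.map_inU_D, h.map_inU_E, h.map_inV_E,
    h.map_subst_E, map_uSubV G F i, map_uAddV G F i]
  simp only [← map_add, ← map_mul, ← map_sub]
  refine (G.data (c i) (Node.one_le i)).series.series.E_comm_ι (X := inU (cen K i))
    (Y := inV (cen K i)) (d := inU (fD v w G.ω G.ζ m (i + 1))) ?_ ?_ ?_ ?_ ?_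
  · intro p
    have := congrArg (HahnSeries.C : LaurentSeries K →+* Series₂ K)
      (G.σ_fD_succ m (i := i) p)
    simp only [map_mul, map_add, map_sub, map_one, map_ofNat] at this
    exact (congrArg (· * _) (mapL_C _ _)).trans this
  · exact fun p => inU_cen_ne i (-G.pw i p) (by rw [map_neg, map_neg]; exact sub_eq_add_neg _ _)
  · exact fun p => inV_cen_ne i (-G.pw i p) (by rw [map_neg, map_neg]; exact sub_eq_add_neg _ _)
  · exact fun p => inU_cen_ne i (G.pw i p - 2) (by
      simp only [map_sub, map_ofNat]
      exact add_sub_assoc _ _ _)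
  · exact fun p => inU_cen_ne i (G.pw i p - 1) (by
      simp only [map_sub, map_one]
      exact add_sub_assoc _ _ _)

lemma mapL_cen (f : K →ₐ[ℂ] K) (i : ℕ) : mapL (f : K →+* K) (cen K i) = cen K i := mapL_fU f _

lemma σ_inU_cen (i j : ℕ) (p : Pt v i) :
    mapL (mapL (G.pσ i p : K →+* K)) (inU (cen K j)) = inU (cen K j) := by
  rw [mapL_inU, mapL_cen]

lemma σ_inV_cen (i j : ℕ) (p : Pt v i) :
    mapL (mapL (G.pσ i p : K →+* K)) (inV (cen K j)) = inV (cen K j) := by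
  rw [mapL_inV, mapL_cen]

lemma ee_zero (h : G.IsImage mu m c F) (i j : Node n) (hij : cartan i j = 0) :
    mapL (mapL (F : YFree n →+* S)) (comm (inU (freeE i)) (inV (freeE j))) = 0 := by
  have h1 : i ≠ j := by
    rintro rfl
    simp [cartan] at hij
  have h2 : ¬((i : ℕ) + 1 = j ∨ (j : ℕ) + 1 = i) := by
    intro h2
    simp [cartan, h1, h2] at hij
  push Not at h2
  rw [map_comm, h.map_inU_E, h.map_inV_E]
  exact (G.commuting (c i) (c j) (Node.one_le i) (Node.one_le j) (fun e => h1 (Subtype.ext e))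
    h2.1 h2.2).series.series.E_comm_E (fun q => σ_inU_cen j i q) (fun p => σ_inV_cen i j p)

lemma monicOf_cen_sub (i : ℕ) (a : K) : MonicOf (-1) (cen K i - HahnSeries.C a) := by
  rw [cen, fU, lin, add_sub_assoc, ← map_sub]
  exact monicOf_lin _

lemma coeff_one_E (h : G.IsImage mu m c F) (i : Node n) :
    mapL (mapL (F : YFree n →+* S)) (inU (freeE₁ i)) =
      (G.data (c i) (Node.one_le i)).series.series.S := by
  rw [mapL_inU, freeE₁, mapL_C, inU_eq]
  have e := congrArg (fun f => HahnSeries.coeff f 1) (h.E i)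
  simp only [coeff_mapL] at e
  rw [e, ShiftData.coeff_one_E, ShiftData.C_S, ShiftData.C_S]
  exact fun p => monicOf_cen_sub i _

lemma ee_succ (h : G.IsImage mu m c F) (i j : Node n) (hij : (j : ℕ) = i + 1) :
    mapL (mapL (F : YFree n →+* S)) (uSubV n * comm (inU (freeE i)) (inV (freeE j))) =
    mapL (mapL (F : YFree n →+* S)) (-(inU (freeE i) * inV (freeE j)) +
      comm (inU (freeE₁ i)) (inV (freeE j)) - comm (inU (freeE i)) (inU (freeE₁ j))) := by
  have := G.charZero
  have := charZero_laurent K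
  have := charZero_laurent (LaurentSeries K)
  simp only [map_add, map_mul, map_sub, map_neg, map_comm, h.map_inU_E, h.map_inV_E, h.coeff_one_E]
  -- The centres of adjacent nodes differ by `1/2`, which accounts for the `1/2` in the abstract
  -- relation.
  have hX : inU (cen K i) - inV (cen K i) = inU (cen K i) - inV (cen K j) - 2⁻¹ := by
    have e1 : cen K i = cen K j + HahnSeries.C 2⁻¹ := by
      rw [← sc_half, cen, cen, ← fU_add, hij]
      congr 1
      push_cast
      ring
    nth_rw 2 [e1]
    rw [inV_eq, map_add, mapL_C, map_inv₀, map_inv₀, map_ofNat, map_ofNat, ← inV_eq]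
    ring
  rw [map_uSubV G F i, hX]
  have hadj : ShiftData.Adjacent (G.data (c i) (Node.one_le i)) (G.data (c j) (Node.one_le j)) := by
    obtain ⟨j, hj⟩ := j
    simp only at hij
    subst hij
    exact G.adjacent _ _ _ _ (h.adjacent i ⟨_, hj⟩ rfl)
  refine hadj.series.series.E_comm_E (X := inU (cen K i)) (Y := inV (cen K j))
    (fun q => σ_inU_cen j i q) (fun p => σ_inV_cen i j p) ?_ ?_
  · exact fun p => inU_cen_ne i (-G.pw i p) (by rw [map_neg, map_neg]; exact sub_eq_add_neg _ _)
  · exact fun p => inV_cen_ne j (-G.pw j p) (by rw [map_neg, map_neg]; exact sub_eq_add_neg _ _)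

end ShiftRing.IsImage

/-! ### The relation for `[E_i(u), E_i(v)]`. -/

namespace ShiftData

variable {F T P : Type} [Field F] [Ring T] [Fintype P] (D : ShiftData F T P)

lemma map_G (f : F →+* LaurentSeries F) (hf : ∀ a, f a = HahnSeries.C a) (X : F) :
    f (D.G X) = D.series.G (f X) := by
  simp only [G, map_sum, map_mul, map_sub, map_add, map_inv₀, map_one, map_ofNat, hf]
  rfl

lemma mapL_C_G (X : LaurentSeries F) :
    mapL (HahnSeries.C : F →+* LaurentSeries F) (D.series.G X) =
      D.series.series.G (mapL (HahnSeries.C : F →+* LaurentSeries F) X) := by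
  have e : ∀ a : F, mapL (HahnSeries.C : F →+* LaurentSeries F) (HahnSeries.C a) =
      HahnSeries.C (HahnSeries.C a) := fun a => mapL_C _ _
  have e1 : ∀ p, D.series.w p = HahnSeries.C (D.w p) := fun _ => rfl
  have e2 : ∀ p, D.series.φ p = HahnSeries.C (D.φ p) := fun _ => rfl
  simp only [G, map_sum, map_mul, map_sub, map_add, map_inv₀, map_one, map_ofNat, e, e1, e2]
  rfl

end ShiftData

namespace ShiftRing

variable {n : ℕ} {v w : Node n → ℕ} {K S : Type} [Field K] [Algebra ℂ K]
    [Ring S] [Algebra ℂ S] (G : ShiftRing v w K S)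

lemma fU_half_add (i : ℕ) [CharZero K] :
    IsImage.cen K i = fU K (-((i : ℂ) / 2)) + HahnSeries.C 2⁻¹ := by
  rw [← sc_half, ← fU_add, IsImage.cen]
  congr 1
  ring

lemma sub_mul_add_sub_one {L : Type} [Field L] [CharZero L] (x a : L) :
    (x + 2⁻¹ - a) * (x + 2⁻¹ + a - 1) = x ^ 2 - (a - 2⁻¹) ^ 2 := by
  have h21 : (2 : L) * 2⁻¹ = 1 := mul_inv_cancel₀ two_ne_zero
  linear_combination (x + 2⁻¹ - a) * h21

/-- Partial fractions in `t = (u - i/2)²`, with the residues identified by `residue`. The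
denominators agree because `(X - w_p)(X + w_p - 1) = t - t_p`. -/
lemma principalPart_inv_fD_mul_fD_succ (m : ℂ →₀ ℤ) {i : ℕ} (hi : ParityCase v w i)
    (h1i : 1 ≤ i) {c : ℂ} (hc : c ^ 2 = (-1) ^ (half w i + half v (i - 1) + half v (i + 1))) :
    principalPart ((fD v w G.ω G.ζ m i)⁻¹ * fD v w G.ω G.ζ m (i + 1)) =
      (G.data c h1i).series.G (IsImage.cen K i) := by
  have := G.charZero
  have := IsImage.charZero_laurent K
  rw [inv_fD_mul_fD_succ G m hi h1i, ← one_mul (_ / _), fU,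
    principalPart_div_prod _ _ (G.pt_injective i) _ ?_ ?_]
  · refine Finset.sum_congr rfl fun p _ => ?_
    rw [one_mul, ← G.residue hi h1i hc]
    change _ = 2 * (1 - HahnSeries.C (G.pw i p)) * HahnSeries.C (G.pφ c i p) *
      ((_ - HahnSeries.C (G.pw i p)) * (_ + HahnSeries.C (G.pw i p) - 1))⁻¹
    rw [fU_half_add, map_inv₀, map_ofNat, sub_mul_add_sub_one, pt]
    simp only [map_mul, map_sub, map_one, map_ofNat, map_pow, map_inv₀]
    rfl
  · exact (map_one (HahnSeries.C : K →+* LaurentSeries K)) ▸ noNegPowers_C _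
  · exact monicOf_one.1.mono (by norm_num)

namespace IsImage

variable {G} {mu : Coweight n} {m : ℂ →₀ ℤ} {c : Node n → ℂ} {F : YFree n →ₐ[ℂ] S}

lemma principalPart_freeX (h : G.IsImage mu m c F) (i : Node n) :
    mapL (F : YFree n →+* S) (principalPart (freeX mu i)) =
      mapL (G.ι : K →+* S) ((G.data (c i) (Node.one_le i)).series.G (cen K i)) := by
  rw [← principalPart_mapL, freeX, map_mul, h.D, h.Dt, ← map_mul, principalPart_mapL,
    ← G.principalPart_inv_fD_mul_fD_succ m (h.parityCase i) (Node.one_le i) (h.sq i)]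
  rfl

lemma ee (h : G.IsImage mu m c F) (i : Node n) : mapL (mapL (F : YFree n →+* S))
      (uSubV n * uAddV i * comm (inU (freeE i)) (inV (freeE i))) =
    mapL (mapL (F : YFree n →+* S))
      (-(uAddV i * (inU (freeE i) - inV (freeE i)) ^ 2) -
          uSubV n * (inU (principalPart (freeX mu i)) - inV (principalPart (freeX mu i)))) := by
  have := G.charZero
  have := charZero_laurent K
  have := charZero_laurent (LaurentSeries K)
  have hG : mapL (mapL (F : YFree n →+* S)) (inU (principalPart (freeX mu i))) =
      mapL (mapL (G.ι : K →+* S))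
        ((G.data (c i) (Node.one_le i)).series.series.G (inU (cen K i))) := by
    rw [mapL_inU, h.principalPart_freeX, ← mapL_inU]
    exact congrArg _ (ShiftData.map_G _ _ (fun _ => rfl) _)
  have hG' : mapL (mapL (F : YFree n →+* S)) (inV (principalPart (freeX mu i))) =
      mapL (mapL (G.ι : K →+* S))
        ((G.data (c i) (Node.one_le i)).series.series.G (inV (cen K i))) := by
    rw [mapL_inV, h.principalPart_freeX, ← mapL_inV]
    exact congrArg _ (ShiftData.mapL_C_G _ _)
  simp only [map_add, map_mul, map_sub, map_neg, map_pow, map_one, map_comm, h.map_inU_E, h.map_inV_E,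
    map_uSubV G F i, map_uAddV G F i, hG, hG']
  have hι : (G.data (c i) (Node.one_le i)).series.series.ι = mapL (mapL (G.ι : K →+* S)) := rfl
  have key := (G.data (c i) (Node.one_le i)).series.series.E_comm_E (X := inU (cen K i))
    (Y := inV (cen K i)) (fun q => σ_inU_cen i i q) (fun p => σ_inV_cen i i p)
    (fun p => inU_cen_ne i (-G.pw i p) (by rw [map_neg, map_neg]; exact sub_eq_add_neg _ _))
    (fun p => inV_cen_ne i (-G.pw i p) (by rw [map_neg, map_neg]; exact sub_eq_add_neg _ _))
    (fun p => inU_cen_ne i (-G.pw i p + 1) (by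
      simp only [map_add, map_neg, map_one, ← add_assoc, ← sub_eq_add_neg]; rfl))
    (fun p => inV_cen_ne i (-G.pw i p + 1) (by
      simp only [map_add, map_neg, map_one, ← add_assoc, ← sub_eq_add_neg]; rfl))
    (fun p => inU_cen_ne i (G.pw i p - 1) (by
      simp only [map_sub, map_one]
      exact add_sub_assoc _ _ _))
    (fun p => inV_cen_ne i (G.pw i p - 1) (by
      simp only [map_sub, map_one]
      exact add_sub_assoc _ _ _))
  simp only [hι, map_mul, map_sub, map_add, map_one] at key
  exact key

end IsImage

end ShiftRing

/-! ### The Serre relation. -/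

namespace ShiftRing

variable {n : ℕ} {v w : Node n → ℕ} {K S : Type} [Field K] [Algebra ℂ K]
    [Ring S] [Algebra ℂ S] (G : ShiftRing v w K S)

lemma pt_sub_pw_sq_ne {i j : ℕ} (hij : i ≠ j) (p : Pt v i) (q : Pt v j) :
    G.pt i p - G.pw j q ^ 2 ≠ 0 := by
  have := G.charZero
  have hhalf : algebraMap ℂ K (2⁻¹) = 2⁻¹ := by rw [map_inv₀, map_ofNat]
  by_cases h0 : p ≠ none ∨ q ≠ none
  · have hu := unrel_of_ne hij p q
    have e1 := G.pw_sub_ne hu h0 (-2⁻¹)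
    have e2 := G.pw_add_ne hu h0 (-2⁻¹)
    rw [map_neg, hhalf] at e1 e2
    rw [pt]
    convert mul_ne_zero e1 e2 using 1
    ring
  · push Not at h0
    rw [h0.1, h0.2, pt_none]
    simp [pw, ptW]

/-- For a pole `± w_{j,s}` the factor is visible in the numerator. For the extra pole a nonzero
coefficient means `θ_j = 1`, which forces `ϑ_i = 1` and `θ_i = 0`; the factor is then the remaining
`t - 1/4` of `ϰ`. -/
lemma numer_eq_mul {i j : ℕ} (hij : j = i - 1 ∨ j = i + 1) (hi : ParityCase v w i) (c : ℂ)
    (q : Pt v j) (hq : G.pc c j q ≠ 0) :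
    ∃ N', numer v w G.ω G.ζ i = N' * (Polynomial.X - Polynomial.C (G.pw j q ^ 2)) := by
  suffices h : (Polynomial.X - Polynomial.C (G.pw j q ^ 2)) ∣ numer v w G.ω G.ζ i by
    obtain ⟨N', h⟩ := h
    exact ⟨N', by rw [h, mul_comm]⟩
  rcases q with _ | ⟨s, b⟩
  · have hθ : parity v j = 1 := by
      have : parity v j ≠ 0 := fun h => hq (by simp [pc, ptC, fZero, h, sc])
      have h2 : parity v j < 2 := Nat.mod_lt _ (by norm_num)
      omega
    have h1 : vartheta v i - parity v i = 1 := by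
      rcases hi with ⟨h1, h2, h3, h4, h5⟩ | ⟨h1, h2, h3, h4, h5⟩ | ⟨h1, h2, h3⟩
      · rcases hij with rfl | rfl <;> omega
      · rcases hij with rfl | rfl <;> omega
      · omega
    have h2 : G.pw j none ^ 2 = 4⁻¹ := by simp only [pw, ptW]; norm_num
    rw [h2, numer, h1, pow_one]
    exact Dvd.intro_left _ rfl |>.mul_right _ |>.mul_right _ |>.mul_right _
  · rw [pw_sq, numer]
    rcases hij with rfl | rfl
    · exact (((Finset.dvd_prod_of_mem (fun s => Polynomial.X - Polynomial.C (G.ω (i - 1) s ^ 2))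
        (Finset.mem_univ s)).mul_left _).mul_right _).mul_right _
    · exact ((Finset.dvd_prod_of_mem (fun s => Polynomial.X - Polynomial.C (G.ω (i + 1) s ^ 2))
        (Finset.mem_univ s)).mul_left _).mul_right _

lemma substHom_half_fU (i : ℕ) : substHom 1 ((i : ℂ) / 2) (fU K (-((i : ℂ) / 2))) = uvar K := by
  rw [fU, lin, map_add, substHom_uvar, substHom_C, add_assoc, ← map_add, sc, ← map_add]
  simp

lemma substHom_half_cen (i : ℕ) :
    substHom 1 ((i : ℂ) / 2) (IsImage.cen K i) = uvar K + HahnSeries.C (algebraMap ℂ K 2⁻¹) := by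
  rw [IsImage.cen, fU, lin, map_add, substHom_uvar, substHom_C, add_assoc, ← map_add, sc,
    ← map_add]
  simp only [Units.val_one, Int.cast_one, map_one, one_mul]
  congr 3
  ring

lemma substHom_half_inv_fD_mul_fD_succ (m : ℂ →₀ ℤ) {i : ℕ} (hi : ParityCase v w i)
    (h1i : 1 ≤ i) :
    substHom 1 ((i : ℂ) / 2) ((fD v w G.ω G.ζ m i)⁻¹ * fD v w G.ω G.ζ m (i + 1)) =
      (numer v w G.ω G.ζ i).eval₂ HahnSeries.C (uvar K ^ 2) /
        ∏ p, (uvar K ^ 2 - HahnSeries.C (G.pt i p)) := by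
  have := G.charZero
  have hc : (substHom 1 ((i : ℂ) / 2)).comp (HahnSeries.C : K →+* LaurentSeries K) =
      HahnSeries.C := RingHom.ext fun b => substHom_C _ _ b
  rw [inv_fD_mul_fD_succ G m hi h1i, map_div₀, map_prod, Polynomial.hom_eval₂, hc]
  simp only [map_pow, map_sub, substHom_half_fU, substHom_C]

/-- One summand on the right hand side of the Serre relation. -/
lemma principalPart_serre_term {i j : ℕ} (hij : j = i - 1 ∨ j = i + 1) (hne : i ≠ j)
    (hi : ParityCase v w i)
    (h1i : 1 ≤ i) {c : ℂ} (hc : c ^ 2 = (-1) ^ (half w i + half v (i - 1) + half v (i + 1)))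
    (c' : ℂ) (q : Pt v j) (hq : G.pc c' j q ≠ 0) :
    principalPart (2 * uvar K * (((numer v w G.ω G.ζ i).eval₂ HahnSeries.C (uvar K ^ 2) /
        ∏ p, (uvar K ^ 2 - HahnSeries.C (G.pt i p))) /
        (uvar K ^ 2 - HahnSeries.C (G.pw j q ^ 2)))) =
      ∑ p, 2 * uvar K * (HahnSeries.C (2 * (1 - G.pw i p) * G.pφ c i p /
        (G.pt i p - G.pw j q ^ 2)) * (uvar K ^ 2 - HahnSeries.C (G.pt i p))⁻¹) := by
  obtain ⟨N', hN⟩ := G.numer_eq_mul hij hi c' q hq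
  have hu : uvar K = lin 0 := by rw [lin, map_zero, add_zero]
  have hn : uvar K ^ 2 - HahnSeries.C (G.pw j q ^ 2) ≠ 0 := by
    rw [hu]; exact (monicOf_lin_sq_sub _ _).ne_zero
  -- Cancelling the factor first leaves exactly the poles `t_p`, so the partial fraction lemma
  -- applies without a pole at `w_q²`.
  have h1 : ((numer v w G.ω G.ζ i).eval₂ HahnSeries.C (uvar K ^ 2) /
        ∏ p, (uvar K ^ 2 - HahnSeries.C (G.pt i p))) /
          (uvar K ^ 2 - HahnSeries.C (G.pw j q ^ 2)) =
      N'.eval₂ HahnSeries.C (uvar K ^ 2) / ∏ p, (uvar K ^ 2 - HahnSeries.C (G.pt i p)) := by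
    rw [hN, Polynomial.eval₂_mul, Polynomial.eval₂_sub, Polynomial.eval₂_X, Polynomial.eval₂_C,
      div_right_comm, mul_div_cancel_right₀ _ hn]
  rw [h1, hu, principalPart_div_prod _ _ (G.pt_injective i) _ ?_ ?_]
  · refine Finset.sum_congr rfl fun p _ => ?_
    have hp := G.pt_sub_pw_sq_ne hne p q
    rw [G.residue hi h1i hc, hN, Polynomial.eval_mul, Polynomial.eval_sub, Polynomial.eval_X,
      Polynomial.eval_C, div_right_comm, mul_div_cancel_right₀ _ hp]
  · rw [← hu]
    refine NoNegPowers.mul ?_ noNegPowers_uvar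
    rw [← map_ofNat HahnSeries.C]
    exact noNegPowers_C _
  · rw [← hu]
    have : VanishBelow 0 (2 : LaurentSeries K) := by
      rw [← map_ofNat HahnSeries.C]
      exact vanishBelow_C _
    simpa using this.mul monicOf_uvar.1

end ShiftRing

namespace ShiftRing.IsImage

variable {n : ℕ} {v w : Node n → ℕ} {K S : Type} [Field K] [Algebra ℂ K]
    [Ring S] [Algebra ℂ S] {G : ShiftRing v w K S} {mu : Coweight n} {m : ℂ →₀ ℤ}
    {c : Node n → ℂ} {F : YFree n →ₐ[ℂ] S}

lemma mapL_freeB (h : G.IsImage mu m c F) (i : Node n) : mapL (F : YFree n →+* S) (freeB i) =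
    (G.data (c i) (Node.one_le i)).series.E (uvar K + HahnSeries.C (algebraMap ℂ K 2⁻¹)) := by
  rw [freeB, ← substAffine_mapL _ _ (F : YFree n →+* S) F.commutes, h.E, ← substHom_apply,
    ShiftData.substHom_E _ _ _ G.ι.commutes, ← substHom_half_cen]

lemma mapL_freeB₁ (h : G.IsImage mu m c F) (i : Node n) :
    mapL (F : YFree n →+* S) (freeB₁ i) = (G.data (c i) (Node.one_le i)).series.S := by
  rw [freeB₁, mapL_C]
  have e := congrArg (fun f => HahnSeries.coeff f 1) (h.mapL_freeB i)
  simp only [coeff_mapL] at e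
  rw [e, ShiftData.coeff_one_E, ShiftData.C_S]
  intro p
  rw [add_sub_assoc, ← map_sub]
  exact monicOf_lin _

lemma mapL_freeH (h : G.IsImage mu m c F) (i : Node n) : mapL (F : YFree n →+* S) (freeH mu i) =
    mapL (G.ι : K →+* S) ((numer v w G.ω G.ζ i).eval₂ HahnSeries.C (uvar K ^ 2) /
        ∏ p, (uvar K ^ 2 - HahnSeries.C (G.pt i p))) := by
  rw [← G.substHom_half_inv_fD_mul_fD_succ m (h.parityCase i) (Node.one_le i), freeH, map_mul,
    ← substAffine_mapL _ _ (F : YFree n →+* S) F.commutes,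
    ← substAffine_mapL _ _ (F : YFree n →+* S) F.commutes, h.D, h.Dt,
    substAffine_mapL _ _ (G.ι : K →+* S) G.ι.commutes,
    substAffine_mapL _ _ (G.ι : K →+* S) G.ι.commutes, ← map_mul, ← substAffine_mul]
  rfl

lemma mapL_subst_freeB (h : G.IsImage mu m c F) (ε : ℤˣ) (a : ℂ) (i : Node n) :
    mapL (F : YFree n →+* S) (substAffine ε a (freeB i)) =
    (G.data (c i) (Node.one_le i)).series.E
      (HahnSeries.C ((ε : ℤ) : K) * uvar K + HahnSeries.C (algebraMap ℂ K (a + 2⁻¹))) := by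
  rw [← substAffine_mapL _ _ (F : YFree n →+* S) F.commutes, h.mapL_freeB, ← substHom_apply,
    ShiftData.substHom_E _ _ _ G.ι.commutes, map_add, substHom_uvar, substHom_C, add_assoc,
    ← map_add, ← map_add]

lemma E_mul_ι {F T P : Type} [Field F] [Ring T] [Fintype P] (D : ShiftData F T P) (X f : F) :
    D.E X * D.ι f = ∑ p, D.ι ((X - D.w p)⁻¹ * D.σ p f) * D.χ p := by
  rw [ShiftData.E, Finset.sum_mul]
  refine Finset.sum_congr rfl fun p _ => ?_
  rw [mul_assoc, D.χ_mul, ← mul_assoc, ← map_mul]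

lemma adjacent_data (h : G.IsImage mu m c F) (i j : Node n) (hij : (j : ℕ) + 1 = i ∨ (i : ℕ) + 1 = j) :
    ShiftData.Adjacent (G.data (c i) (Node.one_le i)) (G.data (c j) (Node.one_le j)) := by
  have key : ∀ i j : Node n, (i : ℕ) + 1 = j →
      ShiftData.Adjacent (G.data (c i) (Node.one_le i)) (G.data (c j) (Node.one_le j)) := by
    rintro i ⟨j, hj⟩ hij
    simp only at hij
    subst hij
    exact G.adjacent _ _ _ _ (h.adjacent i ⟨_, hj⟩ rfl)
  rcases hij with hij | hij
  · exact (key j i hij).symm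
  · exact key i j hij

/-- Partial fractions in the variable of the Serre relation. -/
lemma inv_sub_inv_eq {L : Type} [Field L] (u a : L) (h1 : 1 - u - a ≠ 0) (h2 : u + 1 - a ≠ 0) :
    (1 - u - a)⁻¹ - (u + 1 - a)⁻¹ = -(2 * u * (u ^ 2 - (a - 1) ^ 2)⁻¹) := by
  have h3 : u ^ 2 - (a - 1) ^ 2 = -((1 - u - a) * (u + 1 - a)) := by ring
  rw [h3, inv_neg, mul_inv]
  field_simp
  ring

/-- Both sides are compared for each pole `q` of the node `j`. The left side is evaluated by
`ShiftData.Adjacent.serre`. The right side is minus the `σ_q`-image of the principal part of `2u H /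
(u² - w_q²)`, times `χ_q`, where `H` is the function of `u²` to which `freeH` is mapped. -/
lemma serre (h : G.IsImage mu m c F) (i j : Node n) (hij : cartan i j = -1) :
    mapL (F : YFree n →+* S) (comm (freeB₁ i) (comm (freeB i) (freeB₁ j)) +
          comm (freeB i) (comm (freeB₁ i) (freeB₁ j))) =
    mapL (F : YFree n →+* S) (principalPart (substAffine (-1) (1 / 2) (freeB j) * freeH mu i -
          substAffine 1 (1 / 2) (freeB j) * freeH mu i)) := by
  have := G.charZero
  have := charZero_laurent K
  have hne : (i : ℕ) ≠ j := by
    intro e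
    have : i = j := Subtype.ext e
    simp [cartan, this] at hij
  have hij' : (j : ℕ) + 1 = i ∨ (i : ℕ) + 1 = j := by
    by_contra h0
    have h1 : i ≠ j := fun e => hne (congrArg _ e)
    rw [cartan, if_neg h1, if_neg (by tauto)] at hij
    norm_num at hij
  have hj : (j : ℕ) = i - 1 ∨ (j : ℕ) = i + 1 := by omega
  have hadj := (h.adjacent_data i j hij').series
  have hhalf : (HahnSeries.C (algebraMap ℂ K 2⁻¹) : LaurentSeries K) = 2⁻¹ := by
    rw [map_inv₀, map_inv₀, map_ofNat, map_ofNat]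
  have h21 : (2 : LaurentSeries K) * 2⁻¹ = 1 := mul_inv_cancel₀ two_ne_zero
  have hone : (HahnSeries.C (algebraMap ℂ K (1 / 2)) : LaurentSeries K) = 2⁻¹ := by
    rw [one_div, hhalf]
  rw [← principalPart_mapL]
  simp only [map_add, map_sub, map_mul, map_comm, h.mapL_freeB, h.mapL_freeB₁, h.mapL_freeH,
    h.mapL_subst_freeB, hone, hhalf]
  set D := (G.data (c i) (Node.one_le i)).series with hD
  set D' := (G.data (c j) (Node.one_le j)).series with hD'
  set H := (numer v w G.ω G.ζ i).eval₂ HahnSeries.C (uvar K ^ 2) /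
        ∏ p, (uvar K ^ 2 - HahnSeries.C (G.pt i p)) with hH
  have hι : mapL (G.ι : K →+* S) = D'.ι := rfl
  have hS : D'.S = ∑ q, D'.χ q := rfl
  rw [hι, E_mul_ι, E_mul_ι, hS]
  simp only [ShiftData.comm_sum_right]
  rw [← Finset.sum_add_distrib, ← Finset.sum_sub_distrib]
  change _ = principalPartHom _
  rw [map_sum]
  refine Finset.sum_congr rfl fun q _ => ?_
  have hu : uvar K = lin 0 := by rw [lin, map_zero, add_zero]
  have hσ : ∀ (k : ℕ) (p : Pt v k), mapL (G.pσ k p : K →+* K) (uvar K) = uvar K :=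
    fun k p => mapL_uvar _
  have hσ' : ∀ (k : ℕ) (p : Pt v k), mapL (G.pσ k p : K →+* K) (uvar K + 2⁻¹) = uvar K + 2⁻¹ :=
    fun k p => by rw [map_add, hσ, map_inv₀, map_ofNat]
  -- A zero coefficient makes both sides vanish; a nonzero one is needed for the divisibility of the
  -- numerator.
  by_cases hq : G.pc (c j) j q = 0
  · have hχ : D'.χ q = 0 := by
      change HahnSeries.C (G.ι (G.pc (c j) j q) * G.pδ j q) = 0
      rw [hq, map_zero, zero_mul, map_zero]
    simp only [hχ, comm, mul_zero, zero_mul, sub_zero, add_zero, map_zero]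
  have hpt : ∀ p, (HahnSeries.C (G.pt i p) : LaurentSeries K) =
      (HahnSeries.C (G.pw i p) - 2⁻¹) ^ 2 := fun p => by
    rw [pt, map_pow, map_sub, map_inv₀, map_ofNat]
  have hσpt : ∀ p, G.pσ j q (G.pt i p) = G.pt i p := fun p => by
    rw [pt, map_pow, map_sub, G.pσ_pw_of_unrel (unrel_of_ne hne.symm q p), map_inv₀, map_ofNat]
  rw [hadj.serre (X := uvar K + 2⁻¹) (hσ' i) (hσ' j) ?_ ?_ q ?_]
  · have hw : D'.w q = HahnSeries.C (G.pw j q) := rfl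
    have hsum : ∑ p, D'.σ q (2 * (1 - D.w p) * D.φ p / ((D.w p - 2⁻¹) ^ 2 - D'.w q ^ 2)) *
        ((2 * (uvar K + 2⁻¹) - 1) * ((uvar K + 2⁻¹ - D.w p) * (uvar K + 2⁻¹ + D.w p - 1))⁻¹) =
        ∑ p, mapL (G.pσ j q : K →+* K) (2 * uvar K *
          (HahnSeries.C (2 * (1 - G.pw i p) * G.pφ (c i) i p / (G.pt i p - G.pw j q ^ 2)) *
            (uvar K ^ 2 - HahnSeries.C (G.pt i p))⁻¹)) := by
      refine Finset.sum_congr rfl fun p _ => ?_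
      have hw' : D.w p = HahnSeries.C (G.pw i p) := rfl
      have hφ' : D.φ p = HahnSeries.C (G.pφ (c i) i p) := rfl
      have hσ'' : D'.σ q = mapL (G.pσ j q : K →+* K) := rfl
      have e4 : (2 * (1 - HahnSeries.C (G.pw i p)) * HahnSeries.C (G.pφ (c i) i p) /
        ((HahnSeries.C (G.pw i p) - 2⁻¹) ^ 2 - HahnSeries.C (G.pw j q) ^ 2) : LaurentSeries K) =
        HahnSeries.C (2 * (1 - G.pw i p) * G.pφ (c i) i p / (G.pt i p - G.pw j q ^ 2)) := by
        rw [map_div₀, map_sub, hpt]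
        simp only [map_mul, map_sub, map_one, map_ofNat, map_pow]
      have e5 : 2 * (uvar K + 2⁻¹) - 1 = 2 * uvar K := by linear_combination h21
      have e6 : mapL (G.pσ j q : K →+* K) ((HahnSeries.C (G.pw i p) - 2⁻¹) ^ 2) =
          (HahnSeries.C (G.pw i p) - 2⁻¹) ^ 2 := by
        rw [← hpt, mapL_C]
        exact congrArg _ (hσpt p)
      rw [hw, hw', hφ', hσ'', sub_mul_add_sub_one, ← hpt, e5, hpt, e4]
      generalize 2 * (1 - G.pw i p) * G.pφ (c i) i p / (G.pt i p - G.pw j q ^ 2) = z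
      rw [map_mul, map_mul, map_mul, map_inv₀, map_sub, map_pow,
        hσ, map_ofNat, mapL_C, e6]
      ring
    -- The difference of the two simple fractions is `-2u / (u² - (w_q - 1)²)`, and `σ_q` sends
    -- `w_q²` to `(w_q - 1)²`.
    have hY : (HahnSeries.C (((-1 : ℤˣ) : ℤ) : K) * uvar K + (2⁻¹ + 2⁻¹) - D'.w q)⁻¹ -
        (HahnSeries.C (((1 : ℤˣ) : ℤ) : K) * uvar K + (2⁻¹ + 2⁻¹) - D'.w q)⁻¹ =
        mapL (G.pσ j q : K →+* K)
          (-(2 * uvar K * (uvar K ^ 2 - HahnSeries.C (G.pw j q ^ 2))⁻¹)) := by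
      have e1 : (HahnSeries.C (((-1 : ℤˣ) : ℤ) : K) * uvar K + (2⁻¹ + 2⁻¹) - D'.w q) =
          1 - uvar K - D'.w q := by
        simp only [Units.val_neg, Units.val_one, Int.cast_neg, Int.cast_one, map_neg, map_one]
        linear_combination h21
      have e2 : (HahnSeries.C (((1 : ℤˣ) : ℤ) : K) * uvar K + (2⁻¹ + 2⁻¹) - D'.w q) =
          uvar K + 1 - D'.w q := by
        simp only [Units.val_one, Int.cast_one, map_one]
        linear_combination h21
      have e3 : mapL (G.pσ j q : K →+* K) (HahnSeries.C (G.pw j q)) ^ 2 = (D'.w q - 1) ^ 2 :=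
        D'.σ_w_sq q
      rw [e1, e2, inv_sub_inv_eq, map_neg, map_mul, map_mul, map_inv₀, map_sub, map_pow, map_pow,
        hσ, map_pow, map_ofNat, e3]
      · rw [← neg_ne_zero, hw]
        have := lin_ne_zero (G.pw j q - 1)
        rw [lin, map_sub, map_one] at this
        convert this using 1
        ring
      · rw [hw]
        have := lin_ne_zero (1 - G.pw j q)
        rw [lin, map_sub, map_one] at this
        convert this using 1
        ring
    rw [← sub_mul, ← map_sub, ← sub_mul, hY]
    have hcomb : mapL (G.pσ j q : K →+* K)
          (-(2 * uvar K * (uvar K ^ 2 - HahnSeries.C (G.pw j q ^ 2))⁻¹)) * D'.σ q H =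
        -mapL (G.pσ j q : K →+* K)
          (2 * uvar K * (H / (uvar K ^ 2 - HahnSeries.C (G.pw j q ^ 2)))) := by
      change _ * mapL (G.pσ j q : K →+* K) H = _
      rw [← map_mul, ← map_neg]
      congr 1
      rw [div_eq_mul_inv]
      ring
    rw [hcomb, map_neg, neg_mul, map_neg]
    congr 1
    change _ = principalPart (mapL (G.ι : K →+* S) _ * HahnSeries.C _)
    rw [principalPart_mul_C, principalPart_mapL, principalPart_mapL,
      G.principalPart_serre_term hj hne (h.parityCase i) (Node.one_le i) (h.sq i) (c j) q hq,
      map_sum (mapL (G.pσ j q : K →+* K)), hsum]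
    rfl
  · intro p
    have := lin_ne_zero (2⁻¹ - G.pw i p)
    rw [lin, map_sub, map_inv₀, map_ofNat, ← add_sub_assoc] at this
    exact this
  · intro p
    have := lin_ne_zero (2⁻¹ + G.pw i p - 1)
    rw [lin, map_sub, map_add, map_inv₀, map_ofNat, map_one, ← add_sub_assoc, ← add_assoc] at this
    exact this
  · intro p
    change (HahnSeries.C (G.pw i p) - 2⁻¹) ^ 2 - HahnSeries.C (G.pw j q) ^ 2 ≠ 0
    rw [← hpt, ← map_pow, ← map_sub]
    exact (map_ne_zero _).2 (G.pt_sub_pw_sq_ne hne p q)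

end ShiftRing.IsImage

namespace ShiftRing.IsImage

variable {n : ℕ} {v w : Node n → ℕ} {K S : Type} [Field K] [Algebra ℂ K]
    [Ring S] [Algebra ℂ S] {G : ShiftRing v w K S} {mu : Coweight n} {m : ℂ →₀ ℤ}
    {c : Node n → ℂ} {F : YFree n →ₐ[ℂ] S}

lemma rel (h : G.IsImage mu m c F) {a b : YFree n} (hab : YRel n mu a b) : F a = F b := by
  have e2 : ∀ {f g : Series₂ (YFree n)}, mapL (mapL (F : YFree n →+* S)) f =
      mapL (mapL (F : YFree n →+* S)) g → ∀ p q, F (coeff₂ f p q) = F (coeff₂ g p q) := by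
    intro f g hfg p q
    exact congrArg (fun x => coeff₂ x p q) hfg
  have e1 : ∀ {f g : LaurentSeries (YFree n)}, mapL (F : YFree n →+* S) f =
      mapL (F : YFree n →+* S) g → ∀ p, F (f.coeff p) = F (g.coeff p) := by
    intro f g hfg p
    exact congrArg (fun x => HahnSeries.coeff x p) hfg
  have z2 : ∀ {f : Series₂ (YFree n)}, mapL (mapL (F : YFree n →+* S)) f = 0 →
      ∀ p q, F (coeff₂ f p q) = F 0 := by
    intro f hf p q
    rw [map_zero]
    exact congrArg (fun x => coeff₂ x p q) hf
  cases hab with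
  | lead i => exact h.lead i
  | dd i j p q => exact z2 (h.dd i j) p q
  | ddt i p => exact e1 ((h.ddt i).trans (map_one _).symm) p
  | dtd i p => exact e1 ((h.dtd i).trans (map_one _).symm) p
  | even i p => exact e1 (h.even i) p
  | de i p q => exact e2 (h.de i) p q
  | ed i p q => exact e2 (h.ed i) p q
  | ee_succ i j hij p q => exact e2 (h.ee_succ i j hij) p q
  | ee_zero i j hij p q => exact z2 (h.ee_zero i j hij) p q
  | ee i p q => exact e2 (h.ee i) p q
  | serre i j hij p => exact e1 (h.serre i j hij) p

end ShiftRing.IsImage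

/-! ### Parities and degrees determined by the coweights. -/

section Weights

variable {n : ℕ} {lam mu : Coweight n} {v : Node n → ℕ}

lemma sum_smul_simpleCoroot_apply (v : Node n → ℕ) (i : Idx n) :
    (∑ j, v j • simpleCoroot j : Coweight n) i =
      (extZero v i : ℤ) - extZero v ((i : ℕ) - 1) := by
  have h1 : ∀ k : Node n, (v k • simpleCoroot k : Coweight n) i =
      (if (k : ℕ) = i then (v k : ℤ) else 0) - if (k : ℕ) + 1 = i then (v k : ℤ) else 0 := by
    intro k
    simp only [simpleCoroot, Pi.smul_apply, Pi.sub_apply, Pi.single_apply, nsmul_eq_mul, mul_sub,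
      lo, hi, Subtype.ext_iff, eq_comm (a := (i : ℕ)), mul_ite, mul_one, mul_zero]
  rw [Finset.sum_apply, Finset.sum_congr rfl fun k _ => h1 k, Finset.sum_sub_distrib]
  have h2 : ∀ l : ℕ, (∑ k : Node n, if (k : ℕ) = l then (v k : ℤ) else 0) = extZero v l := by
    intro l
    rw [extZero]
    split_ifs with hl
    · rw [Finset.sum_eq_single ⟨l, hl⟩]
      · simp
      · exact fun k _ hk => if_neg fun e => hk (Subtype.ext e)
      · exact fun hk => absurd (Finset.mem_univ _) hk
    · simp only [Nat.cast_zero]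
      exact Finset.sum_eq_zero fun k _ => if_neg fun (e : (k : ℕ) = l) => hl (e ▸ k.2)
  rw [h2]
  congr 1
  have h3 := i.2.1
  rw [← h2]
  exact Finset.sum_congr rfl fun k _ => if_congr (by omega) rfl rfl

lemma extZero_node (d : Node n → ℕ) (i : Node n) : extZero d i = d i := dif_pos i.2

lemma extZero_weightVec (hdom : IsDominant lam) (i : Node n) :
    (extZero (weightVec lam) i : ℤ) = lam (lo i) - lam (hi i) := by
  rw [extZero_node]
  exact Int.toNat_of_nonneg (hdom i)

lemma parity_zero_of_not_mem (d : Node n → ℕ) {i : ℕ} (hi : i ∉ Set.Ico 1 n) : parity d i = 0 := by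
  rw [parity, extZero, dif_neg hi]

lemma parity_le_one (d : Node n → ℕ) (i : ℕ) : parity d i ≤ 1 :=
  Nat.lt_succ_iff.1 (Nat.mod_lt _ two_pos)

lemma parity_adjacent (hpar : ∀ i j : Node n, i ≠ j →
      cartan i j * (parity v i : ℤ) * (parity v j : ℤ) = 0) (i : ℕ) :
    parity v i = 0 ∨ parity v (i + 1) = 0 := by
  by_cases hi : i ∈ Set.Ico 1 n
  swap
  · exact .inl (parity_zero_of_not_mem v hi)
  by_cases hj : i + 1 ∈ Set.Ico 1 n
  swap
  · exact .inr (parity_zero_of_not_mem v hj)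
  have hne : (⟨i, hi⟩ : Node n) ≠ ⟨i + 1, hj⟩ := fun e => by
    have := congrArg Subtype.val e
    simp at this
  have := hpar ⟨i, hi⟩ ⟨i + 1, hj⟩ hne
  simpa [cartan, hne] using this

/-- The extension by zero lets the end nodes follow the same formula as the inner ones. -/
lemma vartheta_eq (v : Node n → ℕ) (i : Node n) :
    vartheta v i = max (parity v i) (max (parity v ((i : ℕ) - 1)) (parity v ((i : ℕ) + 1))) := by
  obtain ⟨i, hi⟩ := i
  rw [vartheta, dif_pos hi]
  apply le_antisymm
  · refine Finset.sup_le fun j hj => ?_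
    have hj := (Finset.mem_filter.1 hj).2
    simp only [cartan] at hj
    split_ifs at hj with h1 h2
    · rw [← h1]; exact le_max_left _ _
    · rcases h2 with h2 | h2
      · rw [← h2]; exact (le_max_right _ _).trans (le_max_right _ _)
      · have : (j : ℕ) = i - 1 := by omega
        rw [this]; exact (le_max_left _ _).trans (le_max_right _ _)
    · exact absurd rfl hj
  · have key : ∀ k : ℕ, (k = i ∨ k = i - 1 ∨ k = i + 1) → parity v k ≤
        (Finset.univ.filter fun j : Node n => cartan ⟨i, hi⟩ j ≠ 0).sup fun j => parity v j := by
      intro k hk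
      by_cases hkn : k ∈ Set.Ico 1 n
      swap
      · rw [parity_zero_of_not_mem v hkn]; exact Nat.zero_le _
      refine Finset.le_sup (f := fun j : Node n => parity v j) (b := ⟨k, hkn⟩) ?_
      refine Finset.mem_filter.2 ⟨Finset.mem_univ _, ?_⟩
      have := hi.1
      have := hkn.1
      simp only [cartan, Subtype.mk.injEq]
      split_ifs with h1 h2 <;> simp
      omega
    exact max_le (key _ (.inl rfl)) (max_le (key _ (.inr (.inl rfl))) (key _ (.inr (.inr rfl))))

/-- One has `⟨μ, α_i⟩ = w_i - 2 v_i + v_{i-1} + v_{i+1}`, and `μ` is even. -/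
lemma parity_balance (hdom : IsDominant lam) (heven : IsEven mu)
    (hv : lam - mu = ∑ i, v i • simpleCoroot i) (i : Node n) :
    Even (parity (weightVec lam) i + parity v ((i : ℕ) - 1) + parity v ((i : ℕ) + 1)) := by
  have h1 := congrFun hv (lo i)
  have h2 := congrFun hv (hi i)
  rw [sum_smul_simpleCoroot_apply, Pi.sub_apply] at h1 h2
  have h3 := extZero_weightVec hdom i
  have h4 := heven i
  rw [alphaPair] at h4
  have e1 : ((lo i : Idx n) : ℕ) = i := rfl
  have e2 : ((hi i : Idx n) : ℕ) = i + 1 := rfl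
  rw [e1] at h1
  rw [e2, Nat.add_sub_cancel] at h2
  obtain ⟨k, hk⟩ := h4
  simp only [parity]
  rw [Nat.even_iff]
  omega

lemma parityCase (hdom : IsDominant lam) (heven : IsEven mu)
    (hv : lam - mu = ∑ i, v i • simpleCoroot i)
    (hpar : ∀ i j : Node n, i ≠ j → cartan i j * (parity v i : ℤ) * (parity v j : ℤ) = 0)
    (i : Node n) : ParityCase v (weightVec lam) i := by
  have h1 := vartheta_eq v i
  have h2 := Nat.even_iff.1 (parity_balance hdom heven hv i)
  have h3 := parity_adjacent hpar i
  have h4 := parity_adjacent hpar ((i : ℕ) - 1)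
  rw [Nat.sub_add_cancel (Node.one_le i)] at h4
  have h5 := parity_le_one v i
  have h6 := parity_le_one v ((i : ℕ) - 1)
  have h7 := parity_le_one v ((i : ℕ) + 1)
  have h8 := parity_le_one (weightVec lam) i
  rw [ParityCase]
  omega

lemma sum_weightVec (hdom : IsDominant lam) {k : ℕ} (hk : k + 1 ∈ Set.Icc 1 n)
    (h1 : 1 ∈ Set.Icc 1 n) :
    lam ⟨k + 1, hk⟩ = lam ⟨1, h1⟩ + ∑ j : Fin k, -(extZero (weightVec lam) (j + 1) : ℤ) := by
  induction k with
  | zero => simp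
  | succ k ih =>
    have hk' : k + 1 ∈ Set.Ico 1 n := ⟨Nat.le_add_left 1 k, hk.2⟩
    rw [Fin.sum_univ_castSucc]
    have e := extZero_weightVec hdom ⟨k + 1, hk'⟩
    simp only [lo, hi] at e
    simp only [Fin.val_castSucc, Fin.val_last]
    rw [e, ← add_assoc, ← ih ⟨hk'.1, hk'.2.le⟩]
    ring

/-- The sum of the `w_j` telescopes to `⟨λ, ε_1 - ε_i⟩`, and `v_i - v_{i-1}` accounts for `λ - μ`.
The condition on `Z_0` supplies `⟨λ, ε_1⟩`. -/
lemma monicOf_fD_coweight (hdom : IsDominant lam) (hv : lam - mu = ∑ i, v i • simpleCoroot i)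
    {m : ℂ →₀ ℤ} (h1 : 1 ∈ Set.Icc 1 n)
    (hm : lam ⟨1, h1⟩ = (parity v 1 : ℤ) - 2 * m.sum fun _ k => k)
    {K : Type} [Field K] [CharZero K] [Algebra ℂ K] (ω : ∀ i, Fin (half v i) → K)
    (ζ : ∀ i, Fin (half (weightVec lam) i) → K) (i : Idx n) :
    MonicOf (mu i) (fD v (weightVec lam) ω ζ m i) := by
  convert monicOf_fD v (weightVec lam) ω ζ m i using 1
  have e1 := congrFun hv i
  rw [sum_smul_simpleCoroot_apply, Pi.sub_apply] at e1
  obtain ⟨_ | k, hi⟩ := i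
  · exact absurd hi.1 (by norm_num)
  have e2 := sum_weightVec hdom hi h1
  simp only [Nat.add_sub_cancel] at e1
  change mu ⟨k + 1, hi⟩ = -(extZero v (k + 1) : ℤ) + extZero v k +
    (parity v 1 - 2 * m.sum fun _ k => k) + ∑ j : Fin k, -(extZero (weightVec lam) (j + 1) : ℤ)
  linarith

end Weights

/-! ### Skew monoid algebras and change of coefficients. -/

section SkewMap

variable {G R K : Type} [Monoid G] [CommRing R] [CommRing K] [Algebra ℂ R] [Algebra ℂ K]
  [MulSemiringAction G R] [MulSemiringAction G K] [SMulCommClass G ℂ R] [SMulCommClass G ℂ K]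

/-- The inclusion of the coefficients in a skew monoid algebra. -/
def skewC (G R : Type) [Monoid G] [CommRing R] [Algebra ℂ R] [MulSemiringAction G R]
    [SMulCommClass G ℂ R] : R →ₐ[ℂ] SkewMonoidAlgebra R G where
  __ := SkewMonoidAlgebra.singleOneRingHom
  commutes' _ := rfl

lemma skewC_apply (x : R) : skewC G R x = SkewMonoidAlgebra.single 1 x := rfl

lemma of_mul_skewC (g : G) (x : R) :
    SkewMonoidAlgebra.of R G g * skewC G R x = skewC G R (g • x) * SkewMonoidAlgebra.of R G g := by
  simp [skewC_apply, SkewMonoidAlgebra.of_apply, SkewMonoidAlgebra.single_mul_single]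

/-- The map of skew monoid algebras induced by an equivariant map of the coefficients. -/
def skewMap (φ : R →ₐ[ℂ] K) (hφ : ∀ (g : G) x, φ (g • x) = g • φ x) :
    SkewMonoidAlgebra R G →ₐ[ℂ] SkewMonoidAlgebra K G :=
  SkewMonoidAlgebra.liftNCAlgHom ((skewC G K).comp φ) (SkewMonoidAlgebra.of K G) fun {x y} => by
    rw [AlgHom.comp_apply, AlgHom.comp_apply, of_mul_skewC, hφ]

variable (φ : R →ₐ[ℂ] K) (hφ : ∀ (g : G) x, φ (g • x) = g • φ x)

lemma skewMap_single (g : G) (x : R) :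
    skewMap φ hφ (SkewMonoidAlgebra.single g x) = SkewMonoidAlgebra.single g (φ x) := by
  change SkewMonoidAlgebra.liftNC _ _ _ = _
  rw [SkewMonoidAlgebra.liftNC_single]
  change skewC G K (φ x) * SkewMonoidAlgebra.of K G g = _
  simp [skewC_apply, SkewMonoidAlgebra.of_apply, SkewMonoidAlgebra.single_mul_single]

lemma coeff_skewMap (f : SkewMonoidAlgebra R G) (g : G) :
    (skewMap φ hφ f).coeff g = φ (f.coeff g) := by
  classical
  induction f using SkewMonoidAlgebra.induction_on with
  | zero => simp
  | single h x =>
    rw [skewMap_single, SkewMonoidAlgebra.coeff_single_apply, SkewMonoidAlgebra.coeff_single_apply]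
    split_ifs <;> simp
  | add f f' h h' => simp [h, h']

lemma skewMap_injective (h : Function.Injective φ) : Function.Injective (skewMap φ hφ) := by
  intro f f' hf
  refine SkewMonoidAlgebra.ext fun g => h ?_
  rw [← coeff_skewMap φ hφ, ← coeff_skewMap φ hφ, hf]

end SkewMap

/-! ### Localization at the polynomials that become invertible. -/

section Loc

variable {P A : Type} [CommRing P] [IsDomain P] [Algebra ℂ P] [Ring A] [Algebra ℂ A]
  (ev : P →ₐ[ℂ] A)

/-- The nonzero elements which become invertible under a homomorphism. -/
def evUnits : Submonoid P where
  carrier := {p | p ≠ 0 ∧ IsUnit (ev p)}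
  one_mem' := ⟨one_ne_zero, by rw [map_one]; exact isUnit_one⟩
  mul_mem' h h' := ⟨mul_ne_zero h.1 h'.1, by rw [map_mul]; exact h.2.mul h'.2⟩

/-- Nonvanishing is built into the submonoid because the evaluation is not known to be injective,
nor its target nonzero. It keeps the localization a domain in every case. -/
lemma evUnits_le : evUnits ev ≤ nonZeroDivisors P :=
  fun _ h => mem_nonZeroDivisors_of_ne_zero h.1

/-- The localization at the elements which become invertible under a homomorphism. -/
abbrev EvLoc : Type := Localization (evUnits ev)

instance : IsDomain (EvLoc ev) := IsLocalization.isDomain_localization (evUnits_le ev)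

/-- The extension of a homomorphism to the localization, as a homomorphism of rings. -/
def evLiftRingHom : EvLoc ev →+* A :=
  -- The target is noncommutative, so the universal property is used in its Ore form.
  OreLocalization.universalHom (ev : P →+* A)
    (IsUnit.liftRight ((ev : P →* A).comp (evUnits ev).subtype)
      fun x => (show x.1 ≠ 0 ∧ IsUnit (ev x.1) from x.2).2) fun _ => rfl

lemma evLiftRingHom_algebraMap (p : P) : evLiftRingHom ev (algebraMap P (EvLoc ev) p) = ev p :=
  OreLocalization.universalHom_commutes (R := P) (ev : P →+* A) _ _

/-- The extension of a homomorphism to the localization. -/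
def evLift : EvLoc ev →ₐ[ℂ] A where
  __ := evLiftRingHom ev
  commutes' c := by
    change evLiftRingHom ev _ = _
    rw [IsScalarTower.algebraMap_apply ℂ P (EvLoc ev), evLiftRingHom_algebraMap]
    exact ev.commutes c

lemma evLift_algebraMap (p : P) : evLift ev (algebraMap P (EvLoc ev) p) = ev p :=
  evLiftRingHom_algebraMap ev p

variable {G : Type} [Group G] [MulSemiringAction G P] (u : G →* A)

/-- In the target the action is conjugation by a unit, which preserves units. -/
lemma evUnits_smul (hu : ∀ g p, u g * ev p = ev (g • p) * u g) (g : G) :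
    evUnits ev ≤ (evUnits ev).comap (MulSemiringAction.toRingHom G P g) := by
  intro p hp
  refine ⟨fun h => hp.1 ((smul_eq_zero_iff_eq g).1 h), ?_⟩
  have hug : u g * u g⁻¹ = 1 := by rw [← map_mul, mul_inv_cancel, map_one]
  have hug' : u g⁻¹ * u g = 1 := by rw [← map_mul, inv_mul_cancel, map_one]
  have e : ev (g • p) = u g * ev p * u g⁻¹ := by rw [hu, mul_assoc, hug, mul_one]
  change IsUnit (ev (g • p))
  rw [e]
  have h1 : IsUnit (u g) := ⟨⟨_, _, hug, hug'⟩, rfl⟩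
  have h2 : IsUnit (u g⁻¹) := ⟨⟨_, _, hug', hug⟩, rfl⟩
  exact (h1.mul hp.2).mul h2

/-- The automorphisms of the localization. -/
def locMap (hu : ∀ g p, u g * ev p = ev (g • p) * u g) (g : G) : EvLoc ev →+* EvLoc ev :=
  IsLocalization.map (EvLoc ev) (MulSemiringAction.toRingHom G P g) (evUnits_smul ev u hu g)

lemma locMap_algebraMap (hu : ∀ g p, u g * ev p = ev (g • p) * u g) (g : G) (p : P) :
    locMap ev u hu g (algebraMap P (EvLoc ev) p) = algebraMap P (EvLoc ev) (g • p) :=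
  IsLocalization.map_eq _ p

lemma locMap_one (hu : ∀ g p, u g * ev p = ev (g • p) * u g) :
    locMap ev u hu 1 = RingHom.id _ :=
  IsLocalization.ringHom_ext (evUnits ev) (RingHom.ext fun p => by
    rw [RingHom.comp_apply, locMap_algebraMap, one_smul]
    rfl)

lemma locMap_mul (hu : ∀ g p, u g * ev p = ev (g • p) * u g) (g h : G) :
    locMap ev u hu (g * h) = (locMap ev u hu g).comp (locMap ev u hu h) :=
  IsLocalization.ringHom_ext (evUnits ev) (RingHom.ext fun p => by
    simp only [RingHom.comp_apply, locMap_algebraMap, mul_smul])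

/-- The extension of a group action to the localization. -/
@[reducible]
def locAction (hu : ∀ g p, u g * ev p = ev (g • p) * u g) : MulSemiringAction G (EvLoc ev) where
  smul g x := locMap ev u hu g x
  one_smul x := DFunLike.congr_fun (locMap_one ev u hu) x
  mul_smul g h x := DFunLike.congr_fun (locMap_mul ev u hu g h) x
  smul_zero g := map_zero (locMap ev u hu g)
  smul_add g := map_add (locMap ev u hu g)
  smul_one g := map_one (locMap ev u hu g)
  smul_mul g := map_mul (locMap ev u hu g)

lemma locAction_algebraMap (hu : ∀ g p, u g * ev p = ev (g • p) * u g) (g : G) (p : P) :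
    letI := locAction ev u hu
    g • algebraMap P (EvLoc ev) p = algebraMap P (EvLoc ev) (g • p) :=
  locMap_algebraMap ev u hu g p

lemma mul_evLift (hu : ∀ g p, u g * ev p = ev (g • p) * u g) (g : G) (x : EvLoc ev) :
    letI := locAction ev u hu
    u g * evLift ev x = evLift ev (g • x) * u g := by
  let := locAction ev u hu
  have hug : u g * u g⁻¹ = 1 := by rw [← map_mul, mul_inv_cancel, map_one]
  have hug' : u g⁻¹ * u g = 1 := by rw [← map_mul, inv_mul_cancel, map_one]
  let a : Aˣ := ⟨u g, u g⁻¹, hug, hug'⟩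
  -- Conjugation by `u g` and the action of `g` give two ring homomorphisms from the localization;
  -- it suffices to compare them on `P`.
  have key : (ConjAct.toConjAct a • evLift ev x : A) = evLift ev (g • x) := by
    refine DFunLike.congr_fun (f := (MulSemiringAction.toRingHom _ A (ConjAct.toConjAct a)).comp
      (evLift ev : EvLoc ev →+* A)) (g := (evLift ev : EvLoc ev →+* A).comp
        (MulSemiringAction.toRingHom G (EvLoc ev) g)) ?_ x
    refine IsLocalization.ringHom_ext (evUnits ev) (RingHom.ext fun p => ?_)
    change ConjAct.toConjAct a • evLift ev (algebraMap P (EvLoc ev) p) =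
      evLift ev (g • algebraMap P (EvLoc ev) p)
    rw [locAction_algebraMap, evLift_algebraMap, evLift_algebraMap, ConjAct.units_smul_def]
    change u g * ev p * u g⁻¹ = _
    rw [hu, mul_assoc, hug, mul_one]
  rw [← key, ConjAct.units_smul_def]
  change _ = u g * evLift ev x * u g⁻¹ * u g
  rw [mul_assoc, hug', mul_one]

lemma locAction_smulCommClass (hu : ∀ g p, u g * ev p = ev (g • p) * u g) [SMulCommClass G ℂ P] :
    letI := locAction ev u hu
    SMulCommClass G ℂ (EvLoc ev) :=
  letI := locAction ev u hu
  ⟨fun g c x => by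
    have h : ∀ y : ℂ, g • algebraMap ℂ (EvLoc ev) y = algebraMap ℂ (EvLoc ev) y := fun y => by
      rw [IsScalarTower.algebraMap_apply ℂ P (EvLoc ev), locAction_algebraMap, smul_algebraMap]
    rw [Algebra.smul_def, Algebra.smul_def, smul_mul', h]⟩

end Loc

/-! ### The group of normalizing units and its skew group algebras. -/

section EvGrp

variable {P A : Type} [CommRing P] [Algebra ℂ P] [Ring A] [Algebra ℂ A]

/-- The invertible elements which normalize a homomorphism, together with the automorphisms they
induce. -/
def EvGrp (ev : P →ₐ[ℂ] A) : Subgroup (Aˣ × (P ≃ₐ[ℂ] P)) where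
  carrier := {x | ∀ p, x.1 * ev p = ev (x.2 p) * x.1}
  one_mem' p := by simp
  mul_mem' {x y} hx hy p := by
    have hx' := hx (y.2 p)
    have hy' := hy p
    simp only [Prod.fst_mul, Prod.snd_mul, Units.val_mul, AlgEquiv.mul_apply]
    rw [mul_assoc, hy', ← mul_assoc, hx', mul_assoc]
  inv_mem' {x} hx p := by
    have hx' := hx (x.2.symm p)
    rw [AlgEquiv.apply_symm_apply] at hx'
    change ((x.1⁻¹ : Aˣ) : A) * ev p = ev (x.2.symm p) * ((x.1⁻¹ : Aˣ) : A)
    rw [Units.inv_mul_eq_iff_eq_mul, ← mul_assoc, hx', mul_assoc, Units.mul_inv, mul_one]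

variable (ev : P →ₐ[ℂ] A)

/-- The underlying invertible element. -/
def EvGrp.toRing : EvGrp ev →* A :=
  (Units.coeHom A).comp ((MonoidHom.fst _ _).comp (EvGrp ev).subtype)

instance : MulSemiringAction (EvGrp ev) P :=
  MulSemiringAction.compHom P ((MonoidHom.snd Aˣ (P ≃ₐ[ℂ] P)).comp (EvGrp ev).subtype)

instance : SMulCommClass (EvGrp ev) ℂ P :=
  ⟨fun g c p => map_smul g.1.2 c p⟩

/-- This holds by construction. The automorphism is recorded along with the unit because the unit
alone need not determine it. -/
lemma EvGrp.toRing_mul (g : EvGrp ev) (p : P) :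
    EvGrp.toRing ev g * ev p = ev (g • p) * EvGrp.toRing ev g := g.2 p

variable [IsDomain P]

instance : MulSemiringAction (EvGrp ev) (EvLoc ev) :=
  locAction ev (EvGrp.toRing ev) (EvGrp.toRing_mul ev)

instance : SMulCommClass (EvGrp ev) ℂ (EvLoc ev) :=
  locAction_smulCommClass ev (EvGrp.toRing ev) (EvGrp.toRing_mul ev)

lemma EvGrp.smul_algebraMap (g : EvGrp ev) (p : P) :
    g • algebraMap P (EvLoc ev) p = algebraMap P (EvLoc ev) (g • p) :=
  locAction_algebraMap ev (EvGrp.toRing ev) (EvGrp.toRing_mul ev) g p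

/-- The field of fractions. -/
abbrev EvFrac : Type := FractionRing (EvLoc ev)

instance : MulSemiringAction (EvGrp ev) (EvFrac ev) :=
  IsFractionRing.mulSemiringAction (EvGrp ev) (EvLoc ev) (EvFrac ev)

/-- The inclusion in the field of fractions. -/
def fracMap : EvLoc ev →ₐ[ℂ] EvFrac ev := IsScalarTower.toAlgHom ℂ (EvLoc ev) (EvFrac ev)

lemma fracMap_injective : Function.Injective (fracMap ev) :=
  IsFractionRing.injective (EvLoc ev) (EvFrac ev)

lemma fracMap_smul (g : EvGrp ev) (x : EvLoc ev) : fracMap ev (g • x) = g • fracMap ev x :=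
  algebraMap.coe_smul' g x (EvFrac ev)

instance : SMulCommClass (EvGrp ev) ℂ (EvFrac ev) :=
  ⟨fun g c x => by
    have h : g • algebraMap ℂ (EvFrac ev) c = algebraMap ℂ (EvFrac ev) c := by
      rw [← (fracMap ev).commutes, ← fracMap_smul, smul_algebraMap]
    rw [Algebra.smul_def, Algebra.smul_def, smul_mul', h]⟩

/-- The skew monoid algebra over the localization. -/
abbrev EvSkew : Type := SkewMonoidAlgebra (EvLoc ev) (EvGrp ev)

/-- The skew monoid algebra over the field of fractions. -/
abbrev EvFracSkew : Type := SkewMonoidAlgebra (EvFrac ev) (EvGrp ev)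

/-- The inclusion of skew monoid algebras. -/
def skewFracMap : EvSkew ev →ₐ[ℂ] EvFracSkew ev := skewMap (fracMap ev) (fracMap_smul ev)

lemma skewFracMap_injective : Function.Injective (skewFracMap ev) :=
  skewMap_injective _ _ (fracMap_injective ev)

/-- The evaluation of the skew monoid algebra. -/
def skewEval : EvSkew ev →ₐ[ℂ] A :=
  SkewMonoidAlgebra.liftNCAlgHom (evLift ev) (EvGrp.toRing ev) fun {x y} =>
    (mul_evLift ev (EvGrp.toRing ev) (EvGrp.toRing_mul ev) y x).symm

lemma skewEval_single (g : EvGrp ev) (x : EvLoc ev) :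
    skewEval ev (SkewMonoidAlgebra.single g x) = evLift ev x * EvGrp.toRing ev g :=
  SkewMonoidAlgebra.liftNC_single _ _ _ _

lemma skewEval_C (x : EvLoc ev) : skewEval ev (skewC _ _ x) = evLift ev x := by
  rw [skewC_apply, skewEval_single, map_one, mul_one]

lemma skewEval_of (g : EvGrp ev) :
    skewEval ev (SkewMonoidAlgebra.of _ _ g) = EvGrp.toRing ev g := by
  rw [SkewMonoidAlgebra.of_apply, skewEval_single, map_one, one_mul]

lemma skewFracMap_C (x : EvLoc ev) :
    skewFracMap ev (skewC _ _ x) = skewC _ _ (fracMap ev x) := skewMap_single _ _ _ _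

lemma skewFracMap_of (g : EvGrp ev) :
    skewFracMap ev (SkewMonoidAlgebra.of _ _ g) = SkewMonoidAlgebra.of _ _ g := by
  rw [SkewMonoidAlgebra.of_apply, SkewMonoidAlgebra.of_apply, skewFracMap, skewMap_single, map_one]

end EvGrp

/-! ### Evaluation of polynomials at commuting elements, and translations of variables. -/

section CommAeval

variable {A σ : Type} [Ring A] [Algebra ℂ A]

lemma isMulCommutative_adjoin_range (x : σ → A) (h : ∀ a b, x a * x b = x b * x a) :
    IsMulCommutative (Algebra.adjoin ℂ (Set.range x)) :=
  Algebra.isMulCommutative_adjoin ℂ (by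
    rintro _ ⟨a, rfl⟩ _ ⟨b, rfl⟩
    exact h a b)

/-- The subalgebra generated by a family of commuting elements is commutative. -/
@[reducible]
def adjoinRangeCommRing (x : σ → A) (h : ∀ a b, x a * x b = x b * x a) :
    CommRing (Algebra.adjoin ℂ (Set.range x)) where
  __ := (Algebra.adjoin ℂ (Set.range x)).toRing
  mul_comm := (isMulCommutative_adjoin_range x h).is_comm.comm

/-- The evaluation of polynomials at a family of commuting elements. -/
def commAeval (x : σ → A) (h : ∀ a b, x a * x b = x b * x a) : MvPolynomial σ ℂ →ₐ[ℂ] A :=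
  -- Evaluation passes through the commutative subalgebra generated by the given elements.
  letI := adjoinRangeCommRing x h
  (Algebra.adjoin ℂ (Set.range x)).val.comp
    (MvPolynomial.aeval fun a => ⟨x a, Algebra.subset_adjoin ⟨a, rfl⟩⟩)

lemma commAeval_X (x : σ → A) (h : ∀ a b, x a * x b = x b * x a) (a : σ) :
    commAeval x h (MvPolynomial.X a) = x a := by
  let := adjoinRangeCommRing x h
  rw [commAeval, AlgHom.comp_apply, MvPolynomial.aeval_X]
  rfl

end CommAeval

section ShiftAut

variable {σ : Type}

lemma X_add_C_ne (a : σ) (c : ℂ) : (MvPolynomial.X a + MvPolynomial.C c : MvPolynomial σ ℂ) ≠ 0 := by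
  intro h
  -- The value at this point is `1`.
  have := congrArg (MvPolynomial.eval fun _ => 1 - c) h
  simp at this

variable [DecidableEq σ]

/-- The substitution `x_a ↦ x_a + k`. -/
def shiftHom (a : σ) (k : ℂ) : MvPolynomial σ ℂ →ₐ[ℂ] MvPolynomial σ ℂ :=
  MvPolynomial.aeval fun b => if b = a then MvPolynomial.X b + MvPolynomial.C k else MvPolynomial.X b

lemma shiftHom_self (a : σ) (k : ℂ) :
    shiftHom a k (MvPolynomial.X a) = MvPolynomial.X a + MvPolynomial.C k := by
  rw [shiftHom, MvPolynomial.aeval_X, if_pos rfl]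

lemma shiftHom_ne {a b : σ} (k : ℂ) (h : b ≠ a) :
    shiftHom a k (MvPolynomial.X b) = MvPolynomial.X b := by
  rw [shiftHom, MvPolynomial.aeval_X, if_neg h]

lemma shiftHom_C (a : σ) (k c : ℂ) : shiftHom a k (MvPolynomial.C c) = MvPolynomial.C c :=
  (shiftHom a k).commutes c

lemma shiftHom_comp_neg (a : σ) {k l : ℂ} (h : k + l = 0) :
    (shiftHom a k).comp (shiftHom a l) = AlgHom.id ℂ _ := by
  refine MvPolynomial.algHom_ext fun b => ?_
  by_cases hb : b = a
  · subst hb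
    rw [AlgHom.comp_apply, shiftHom_self, map_add, shiftHom_self, shiftHom_C, add_assoc, ← map_add,
      h, map_zero, add_zero]
    rfl
  · rw [AlgHom.comp_apply, shiftHom_ne _ hb, shiftHom_ne _ hb]
    rfl

lemma shiftHom_comm (a b : σ) (k l : ℂ) :
    (shiftHom a k).comp (shiftHom b l) = (shiftHom b l).comp (shiftHom a k) := by
  refine MvPolynomial.algHom_ext fun d => ?_
  by_cases ha : d = a <;> by_cases hb : d = b
  · subst ha; subst hb
    simp only [AlgHom.comp_apply, shiftHom_self, map_add, shiftHom_C]
    ring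
  · subst ha
    simp only [AlgHom.comp_apply, shiftHom_self, map_add, shiftHom_C, shiftHom_ne _ hb]
  · subst hb
    simp only [AlgHom.comp_apply, shiftHom_self, map_add, shiftHom_C, shiftHom_ne _ ha]
  · simp only [AlgHom.comp_apply, shiftHom_ne _ ha, shiftHom_ne _ hb]

/-- The automorphism `x_a ↦ x_a + k`. -/
def shiftAut (a : σ) (k : ℂ) : MvPolynomial σ ℂ ≃ₐ[ℂ] MvPolynomial σ ℂ :=
  AlgEquiv.ofAlgHom (shiftHom a k) (shiftHom a (-k)) (shiftHom_comp_neg a (add_neg_cancel k))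
    (shiftHom_comp_neg a (neg_add_cancel k))

lemma shiftAut_comm (a b : σ) (k l : ℂ) :
    shiftAut a k * shiftAut b l = shiftAut b l * shiftAut a k :=
  AlgEquiv.ext fun p => DFunLike.congr_fun (shiftHom_comm a b k l) p

lemma X_sub_X_add_C_ne {a b : σ} (hab : a ≠ b) (c : ℂ) :
    (MvPolynomial.X a - MvPolynomial.X b + MvPolynomial.C c : MvPolynomial σ ℂ) ≠ 0 := by
  intro h
  have := congrArg (MvPolynomial.eval fun t => if t = a then 1 - c else 0) h
  simp [hab.symm] at this

lemma X_add_X_add_C_ne {a b : σ} (hab : a ≠ b) (c : ℂ) :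
    (MvPolynomial.X a + MvPolynomial.X b + MvPolynomial.C c : MvPolynomial σ ℂ) ≠ 0 := by
  intro h
  have := congrArg (MvPolynomial.eval fun t => if t = a then 1 - c else 0) h
  simp [hab.symm] at this

end ShiftAut

/-! ### The algebra of difference operators as a target of these constructions. -/

section Concrete

variable {n : ℕ} (v w : Node n → ℕ)

lemma A.mk_rel {a b : AFree v w} (h : ARel v w a b) : A.mk v w a = A.mk v w b :=
  RingQuot.mkAlgHom_rel _ h

lemma algHom_comm {k R S : Type} [CommRing k] [Ring R] [Ring S] [Algebra k R] [Algebra k S]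
    (f : R →ₐ[k] S) (a b : R) : f (comm a b) = comm (f a) (f b) := by
  simp only [comm, map_sub, map_mul]

lemma A.eth_mul_self (i : ℕ) (r : Fin (half v i)) :
    A.eth v w i r * A.wv v w i r = (A.wv v w i r + 1) * A.eth v w i r := by
  have h := A.mk_rel v w (.eth_w_same i r)
  rw [algHom_comm, comm, sub_eq_iff_eq_add] at h
  rw [add_mul, one_mul, add_comm]
  exact h

lemma A.eth_mul_ne (i j : ℕ) (r : Fin (half v i)) (s : Fin (half v j))
    (h : (⟨i, r⟩ : Σ i : ℕ, Fin (half v i)) ≠ ⟨j, s⟩) :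
    A.eth v w i r * A.wv v w j s = A.wv v w j s * A.eth v w i r := by
  have h := A.mk_rel v w (.eth_w_ne i j r s h)
  rw [algHom_comm, comm, map_zero, sub_eq_zero] at h
  exact h

lemma A.wv_comm (i j : ℕ) (r : Fin (half v i)) (s : Fin (half v j)) :
    A.wv v w i r * A.wv v w j s = A.wv v w j s * A.wv v w i r := by
  have h := A.mk_rel v w (.w_w i j r s)
  rw [algHom_comm, comm, map_zero, sub_eq_zero] at h
  exact h

lemma A.eth_comm (i j : ℕ) (r : Fin (half v i)) (s : Fin (half v j)) :
    A.eth v w i r * A.eth v w j s = A.eth v w j s * A.eth v w i r := by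
  have h := A.mk_rel v w (.eth_eth i j r s)
  rw [algHom_comm, comm, map_zero, sub_eq_zero] at h
  exact h

lemma A.z_comm (i : ℕ) (s : Fin (half w i)) (x : A v w) : A.z v w i s * x = x * A.z v w i s :=
  Algebra.commutes _ _

/-- `ð_{i,r}` as a unit. -/
def A.ethUnit (i : ℕ) (r : Fin (half v i)) : (A v w)ˣ where
  val := A.eth v w i r
  inv := A.ethInv v w i r
  val_inv := by
    have h := A.mk_rel v w (.eth_ethInv i r)
    rwa [map_mul, map_one] at h
  inv_val := by
    have h := A.mk_rel v w (.ethInv_eth i r)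
    rwa [map_mul, map_one] at h

lemma isUnit_of_mk_rel {a b : AFree v w} (h : ARel v w (a * b) 1) (h' : ARel v w (b * a) 1) :
    IsUnit (A.mk v w a) := by
  have h := A.mk_rel v w h
  have h' := A.mk_rel v w h'
  rw [map_mul, map_one] at h h'
  exact ⟨⟨_, _, h, h'⟩, rfl⟩

instance : IsScalarTower ℂ (MvPolynomial (ZIdx w) ℂ) (A v w) :=
  inferInstanceAs (IsScalarTower ℂ (MvPolynomial (ZIdx w) ℂ) (RingQuot (ARel v w)))

lemma A.mk_sc (c : ℂ) : A.mk v w (algebraMap ℂ (AFree v w) c) = sc c := by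
  rw [IsScalarTower.algebraMap_apply ℂ (MvPolynomial (ZIdx w) ℂ) (AFree v w), AlgHom.commutes,
    ← IsScalarTower.algebraMap_apply]
  rfl

lemma A.isUnit_add (i : ℕ) (r r' : Fin (half v i)) (h : r ≠ r') (m : ℤ) :
    IsUnit (A.wv v w i r + A.wv v w i r' + sc (m : ℂ)) := by
  have := isUnit_of_mk_rel v w (.add_addInv i r r' h m) (.addInv_add i r r' h m)
  rwa [map_add, map_add, A.mk_sc] at this

lemma A.isUnit_sub (i : ℕ) (r r' : Fin (half v i)) (h : r ≠ r') (m : ℤ) :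
    IsUnit (A.wv v w i r - A.wv v w i r' + sc (m : ℂ)) := by
  have := isUnit_of_mk_rel v w (.sub_subInv i r r' h m) (.subInv_sub i r r' h m)
  rwa [map_add, map_sub, A.mk_sc] at this

lemma A.isUnit_half (i : ℕ) (r : Fin (half v i)) (m : ℤ) :
    IsUnit (A.wv v w i r + sc ((m : ℂ) / 2)) := by
  have := isUnit_of_mk_rel v w (.half_halfInv i r m) (.halfInv_half i r m)
  rwa [map_add, A.mk_sc] at this

/-- The variables `w_{i,r}` and `z_{i,s}`. -/
abbrev Var : Type := (Σ i : ℕ, Fin (half v i)) ⊕ ZIdx w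

/-- The elements `w_{i,r}` and `z_{i,s}`. -/
def A.var : Var v w → A v w
  | .inl a => A.wv v w a.1 a.2
  | .inr a => A.z v w a.1 a.2

lemma A.var_comm (a b : Var v w) : A.var v w a * A.var v w b = A.var v w b * A.var v w a := by
  rcases a with a | a
  · rcases b with b | b
    · exact A.wv_comm v w _ _ _ _
    · exact (A.z_comm v w _ _ _).symm
  · exact A.z_comm v w _ _ _

/-- The evaluation of polynomials in `𝒜`. -/
def polyEv : MvPolynomial (Var v w) ℂ →ₐ[ℂ] A v w := commAeval (A.var v w) (A.var_comm v w)

lemma polyEv_X (a : Var v w) : polyEv v w (MvPolynomial.X a) = A.var v w a := commAeval_X _ _ a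

lemma polyEv_C (c : ℂ) : polyEv v w (MvPolynomial.C c) = sc c := (polyEv v w).commutes c

/-- The shift of a variable. -/
def genPair (i : ℕ) (r : Fin (half v i)) :
    (A v w)ˣ × (MvPolynomial (Var v w) ℂ ≃ₐ[ℂ] MvPolynomial (Var v w) ℂ) :=
  (A.ethUnit v w i r, shiftAut (.inl ⟨i, r⟩) 1)

/-- The defining commutators say `ð w = (w + 1) ð` for the own variable and that `ð` commutes with
the others; induction on polynomials does the rest. -/
lemma genPair_mem (i : ℕ) (r : Fin (half v i)) : genPair v w i r ∈ EvGrp (polyEv v w) := by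
  intro p
  change A.eth v w i r * polyEv v w p = polyEv v w (shiftHom (.inl ⟨i, r⟩) 1 p) * A.eth v w i r
  induction p using MvPolynomial.induction_on with
  | C c =>
    rw [shiftHom_C, polyEv_C]
    exact (Algebra.commutes _ _).symm
  | add p q hp hq => simp only [map_add, mul_add, add_mul, hp, hq]
  | mul_X p a hp =>
    have ha : A.eth v w i r * polyEv v w (MvPolynomial.X a) =
        polyEv v w (shiftHom (.inl ⟨i, r⟩) 1 (MvPolynomial.X a)) * A.eth v w i r := by
      by_cases h : a = .inl ⟨i, r⟩
      · subst h
        rw [shiftHom_self, map_add, polyEv_X, map_one, map_one]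
        exact A.eth_mul_self v w i r
      · rw [shiftHom_ne _ h, polyEv_X]
        rcases a with a | a
        · exact A.eth_mul_ne v w _ _ _ _ fun e => h (congrArg Sum.inl e.symm)
        · exact (A.z_comm v w _ _ _).symm
    rw [map_mul, map_mul, map_mul, ← mul_assoc, hp, mul_assoc, ha, mul_assoc]

/-- The group element attached to `ð_{i,r}⁻¹` or `ð_{i,r}`. -/
def grpGen (i : ℕ) (r : Fin (half v i)) : Bool → EvGrp (polyEv v w)
  | true => ⟨genPair v w i r, genPair_mem v w i r⟩⁻¹
  | false => ⟨genPair v w i r, genPair_mem v w i r⟩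

lemma grpGen_comm (i : ℕ) (r : Fin (half v i)) (b : Bool) (j : ℕ) (s : Fin (half v j)) (b' : Bool) :
    grpGen v w i r b * grpGen v w j s b' = grpGen v w j s b' * grpGen v w i r b := by
  have h : Commute (⟨genPair v w i r, genPair_mem v w i r⟩ : EvGrp (polyEv v w))
      ⟨genPair v w j s, genPair_mem v w j s⟩ := by
    refine Subtype.ext (Prod.ext (Units.ext ?_) ?_)
    · exact A.eth_comm v w i j r s
    · exact shiftAut_comm _ _ _ _
  cases b <;> cases b'
  · exact h
  · exact h.inv_right
  · exact h.inv_left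
  · exact h.inv_inv

lemma grpGen_inv (i : ℕ) (r : Fin (half v i)) (b : Bool) :
    grpGen v w i r b * grpGen v w i r (!b) = 1 := by
  cases b
  · exact mul_inv_cancel _
  · exact inv_mul_cancel _

lemma grpGen_false_smul (i : ℕ) (r : Fin (half v i)) (p : MvPolynomial (Var v w) ℂ) :
    grpGen v w i r false • p = shiftHom (.inl ⟨i, r⟩) 1 p := rfl

lemma grpGen_true_smul (i : ℕ) (r : Fin (half v i)) (p : MvPolynomial (Var v w) ℂ) :
    grpGen v w i r true • p = shiftHom (.inl ⟨i, r⟩) (-1) p := rfl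

/-- The localized polynomial ring. -/
abbrev Loc : Type := EvLoc (polyEv v w)

/-- Its field of fractions. -/
abbrev Frac : Type := EvFrac (polyEv v w)

/-- The inclusion of the polynomials in the localization. -/
def polyLoc : MvPolynomial (Var v w) ℂ →ₐ[ℂ] Loc v w := IsScalarTower.toAlgHom ℂ _ _

/-- The inclusion of the polynomials in the field of fractions. -/
def polyFrac : MvPolynomial (Var v w) ℂ →ₐ[ℂ] Frac v w := (fracMap _).comp (polyLoc v w)

lemma polyFrac_ne {p : MvPolynomial (Var v w) ℂ} (hp : p ≠ 0) : polyFrac v w p ≠ 0 := by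
  have h1 : Function.Injective (polyLoc v w) :=
    IsLocalization.injective (Loc v w) (evUnits_le (polyEv v w))
  have h2 : Function.Injective (polyFrac v w) := (fracMap_injective (polyEv v w)).comp h1
  exact (map_ne_zero_iff _ h2).2 hp

lemma polyFrac_smul (g : EvGrp (polyEv v w)) (p : MvPolynomial (Var v w) ℂ) :
    g • polyFrac v w p = polyFrac v w (g • p) := by
  change g • fracMap _ _ = fracMap _ (algebraMap _ (Loc v w) (g • p))
  rw [← EvGrp.smul_algebraMap, fracMap_smul]
  rfl

/-- The parameters `w_{i,r}` in the localization. -/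
def locW (i : ℕ) (r : Fin (half v i)) : Loc v w := polyLoc v w (.X (.inl ⟨i, r⟩))

/-- The parameters `z_{i,s}` in the localization. -/
def locZ (i : ℕ) (s : Fin (half w i)) : Loc v w := polyLoc v w (.X (.inr ⟨i, s⟩))

/-- The shift of a parameter, as an automorphism of the field of fractions. -/
def shiftFrac (i : ℕ) (r : Fin (half v i)) (b : Bool) : Frac v w →ₐ[ℂ] Frac v w :=
  MulSemiringAction.toAlgHom ℂ (Frac v w) (grpGen v w i r b)

lemma shiftFrac_polyFrac (i : ℕ) (r : Fin (half v i)) (b : Bool) (p : MvPolynomial (Var v w) ℂ) :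
    shiftFrac v w i r b (polyFrac v w p) = polyFrac v w (grpGen v w i r b • p) :=
  polyFrac_smul v w _ p

/-- The shift operators over the field of rational functions. -/
def shiftRing : ShiftRing v w (Frac v w) (EvFracSkew (polyEv v w)) where
  ω i r := fracMap _ (locW v w i r)
  ζ i s := fracMap _ (locZ v w i s)
  shift := shiftFrac v w
  ι := skewC _ _
  δ i r b := SkewMonoidAlgebra.of _ _ (grpGen v w i r b)
  shift_true i r := by
    refine (shiftFrac_polyFrac v w i r true _).trans ?_
    rw [grpGen_true_smul, shiftHom_self, map_neg, map_one, ← sub_eq_add_neg, map_sub, map_one]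
    rfl
  shift_false i r := by
    refine (shiftFrac_polyFrac v w i r false _).trans ?_
    rw [grpGen_false_smul, shiftHom_self, map_one, map_add, map_one]
    rfl
  shift_ne i r b j s h := by
    refine (shiftFrac_polyFrac v w i r b _).trans ?_
    cases b
    · rw [grpGen_false_smul, shiftHom_ne _ fun e => h (Sum.inl_injective e)]
      rfl
    · rw [grpGen_true_smul, shiftHom_ne _ fun e => h (Sum.inl_injective e)]
      rfl
  shift_ζ i r b j s := by
    refine (shiftFrac_polyFrac v w i r b _).trans ?_
    cases b
    · rw [grpGen_false_smul, shiftHom_ne _ Sum.inr_ne_inl]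
      rfl
    · rw [grpGen_true_smul, shiftHom_ne _ Sum.inr_ne_inl]
      rfl
  ne_const i r c := by
    have := polyFrac_ne v w (X_add_C_ne (.inl ⟨i, r⟩) c)
    rwa [map_add, ← MvPolynomial.algebraMap_eq, AlgHom.commutes] at this
  ne_sub i r j s c h := by
    have := polyFrac_ne v w (X_sub_X_add_C_ne (fun e => h (Sum.inl_injective e)) c)
    rwa [map_add, ← MvPolynomial.algebraMap_eq, AlgHom.commutes, map_sub] at this
  ne_add i r j s c h := by
    have := polyFrac_ne v w (X_add_X_add_C_ne (fun e => h (Sum.inl_injective e)) c)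
    rwa [map_add, ← MvPolynomial.algebraMap_eq, AlgHom.commutes, map_add] at this
  δ_mul i r b f := of_mul_skewC _ _
  δ_comm i r b j s b' := by rw [← map_mul, grpGen_comm, map_mul]
  δ_inv i r b := by rw [← map_mul, grpGen_inv, map_one]

lemma evLift_polyLoc (p : MvPolynomial (Var v w) ℂ) :
    evLift (polyEv v w) (polyLoc v w p) = polyEv v w p := evLift_algebraMap _ p

lemma evLift_locW (i : ℕ) (r : Fin (half v i)) : evLift (polyEv v w) (locW v w i r) = A.wv v w i r :=
  (evLift_polyLoc v w _).trans (polyEv_X v w _)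

lemma evLift_locZ (i : ℕ) (s : Fin (half w i)) : evLift (polyEv v w) (locZ v w i s) = A.z v w i s :=
  (evLift_polyLoc v w _).trans (polyEv_X v w _)

lemma isUnit_polyLoc {p : MvPolynomial (Var v w) ℂ} (h0 : p ≠ 0) (h : IsUnit (polyEv v w p)) :
    IsUnit (polyLoc v w p) :=
  IsLocalization.map_units (Loc v w) (⟨p, h0, h⟩ : evUnits (polyEv v w))

lemma isUnit_locW_half (i : ℕ) (r : Fin (half v i)) (m : ℤ) :
    IsUnit (locW v w i r + sc ((m : ℂ) / 2)) := by
  have h := isUnit_polyLoc v w (X_add_C_ne (.inl ⟨i, r⟩) ((m : ℂ) / 2)) (by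
    rw [map_add, polyEv_X, polyEv_C]
    exact A.isUnit_half v w i r m)
  rwa [map_add, ← MvPolynomial.algebraMap_eq, AlgHom.commutes] at h

lemma isUnit_locW_add (i : ℕ) (r r' : Fin (half v i)) (hr : r ≠ r') :
    IsUnit (locW v w i r + locW v w i r') := by
  have hne : (.inl ⟨i, r⟩ : Var v w) ≠ .inl ⟨i, r'⟩ := by simpa using hr
  have h := isUnit_polyLoc v w (X_add_X_add_C_ne hne ((0 : ℤ) : ℂ)) (by
    rw [map_add, map_add, polyEv_X, polyEv_X, polyEv_C]
    exact A.isUnit_add v w i r r' hr 0)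
  rwa [Int.cast_zero, map_zero, add_zero, map_add] at h

lemma isUnit_locW_sub (i : ℕ) (r r' : Fin (half v i)) (hr : r ≠ r') :
    IsUnit (locW v w i r - locW v w i r') := by
  have hne : (.inl ⟨i, r⟩ : Var v w) ≠ .inl ⟨i, r'⟩ := by simpa using hr
  have h := isUnit_polyLoc v w (X_sub_X_add_C_ne hne ((0 : ℤ) : ℂ)) (by
    rw [map_add, map_sub, polyEv_X, polyEv_X, polyEv_C]
    exact A.isUnit_sub v w i r r' hr 0)
  rwa [Int.cast_zero, map_zero, add_zero, map_sub] at h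

end Concrete

lemma VanishBelow.of_mapL {B C : Type} [Ring B] [Ring C] {φ : B →+* C} (hφ : Function.Injective φ)
    {N : ℤ} {f : LaurentSeries B} (h : VanishBelow N (IGKLO.mapL φ f)) : VanishBelow N f :=
  fun r hr => hφ (by rw [map_zero, ← coeff_mapL, h r hr])

lemma MonicOf.of_mapL {B C : Type} [Ring B] [Ring C] {φ : B →+* C} (hφ : Function.Injective φ)
    {N : ℤ} {f : LaurentSeries B} (h : MonicOf N (IGKLO.mapL φ f)) : MonicOf N f :=
  ⟨h.1.of_mapL hφ, hφ (by rw [map_one, ← coeff_mapL, h.2])⟩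

/-! ### Transport of the formula for `E_i(u)` between the coefficient rings. -/

section ImageOfE

variable {n : ℕ} (v w : Node n → ℕ) {R T T' : Type} [CommRing R] [Algebra ℂ R] [Ring T]
  [Ring T'] (j : R →+* T) (ω : ∀ i, Fin (half v i) → R) (ζ : ∀ i, Fin (half w i) → R)
  (δ : ∀ i, Fin (half v i) → Bool → T)

/-- The image of `E_i(u)`. -/
def fE (c : ℂ) (i : ℕ) : LaurentSeries T :=
  -(∑ r, mapL j (Ring.inverse (fU R (-(((i : ℂ) - 1) / 2)) - HahnSeries.C (ω i r))) *
      HahnSeries.C (j (fMinus v ω i r) * δ i r true)) -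
    (∑ r, mapL j (Ring.inverse (fU R (-(((i : ℂ) - 1) / 2)) + HahnSeries.C (ω i r))) *
      HahnSeries.C (j (fPlus v w ω ζ i r) * δ i r false)) +
    mapL j (Ring.inverse (fU R (-((i : ℂ) / 2)))) * HahnSeries.C (j (fZero v w ω ζ c i))

lemma mapL_fE (θ : T →+* T') (c : ℂ) (i : ℕ) :
    mapL θ (fE v w j ω ζ δ c i) =
      fE v w (θ.comp j) ω ζ (fun i r b => θ (δ i r b)) c i := by
  have h : ∀ f, mapL θ (mapL j f) = mapL (θ.comp j) f := fun f => mapL_mapL _ _ _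
  simp only [fE, map_add, map_sub, map_neg, map_sum, map_mul, mapL_C, h, RingHom.comp_apply]

end ImageOfE

section Params

variable {n : ℕ} (v w : Node n → ℕ)

/-- The expressions which occur in denominators are invertible. -/
structure UnitParams {R : Type} [CommRing R] [Algebra ℂ R] (ω : ∀ i, Fin (half v i) → R) :
    Prop where
  add_half : ∀ i r (m : ℤ), IsUnit (ω i r + sc ((m : ℂ) / 2))
  add : ∀ i r s, r ≠ s → IsUnit (ω i r + ω i s)
  sub : ∀ i r s, r ≠ s → IsUnit (ω i r - ω i s)

namespace UnitParams

variable {v} {R : Type} [CommRing R] [Algebra ℂ R] {ω : ∀ i, Fin (half v i) → R}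
  (h : UnitParams v ω)

lemma isUnit_sc {c : ℂ} (hc : c ≠ 0) : IsUnit (sc c : R) :=
  (isUnit_iff_ne_zero.2 hc).map (algebraMap ℂ R)

lemma two_eq : (2 : R) = sc 2 := (map_ofNat (algebraMap ℂ R) 2).symm

lemma isUnit_param (h : UnitParams v ω) (i : ℕ) (r : Fin (half v i)) : IsUnit (ω i r) := by
  have := h.add_half i r 0
  rwa [Int.cast_zero, zero_div, sc, map_zero, add_zero] at this

lemma isUnit_two_mul (h : UnitParams v ω) (i : ℕ) (r : Fin (half v i)) : IsUnit (2 * ω i r) := by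
  rw [two_eq]
  exact (isUnit_sc two_ne_zero).mul (h.isUnit_param i r)

lemma isUnit_add_half (h : UnitParams v ω) (i : ℕ) (r : Fin (half v i)) :
    IsUnit (ω i r + sc (1 / 2)) := by
  have := h.add_half i r 1
  rwa [Int.cast_one] at this

lemma isUnit_sub_half (h : UnitParams v ω) (i : ℕ) (r : Fin (half v i)) :
    IsUnit (ω i r - sc (1 / 2)) := by
  have := h.add_half i r (-1)
  rwa [Int.cast_neg, Int.cast_one, neg_div, sc, map_neg, ← sub_eq_add_neg] at this

lemma two_mul_sc_half : (2 : R) * sc (1 / 2) = 1 := by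
  rw [two_eq, sc, sc, ← map_mul, ← map_one (algebraMap ℂ R)]
  norm_num

/-- Indeed `2x ϰ(x) = 2 (x - 1/2)`. -/
lemma isUnit_kap_of {x : R} (h2 : IsUnit (2 * x)) (hx : IsUnit (x - sc (1 / 2))) :
    IsUnit (kap x) := by
  have e : 2 * x * kap x = 2 * (x - sc (1 / 2)) := by
    rw [kap, mul_sub, Ring.mul_inverse_cancel _ h2, mul_sub, two_mul_sc_half, mul_one]
  have h1 : IsUnit (2 * x * kap x) := by
    rw [e, two_eq]
    exact (isUnit_sc two_ne_zero).mul hx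
  exact isUnit_of_mul_isUnit_right h1

lemma isUnit_kap (h : UnitParams v ω) (i : ℕ) (r : Fin (half v i)) : IsUnit (kap (ω i r)) :=
  isUnit_kap_of (h.isUnit_two_mul i r) (h.isUnit_sub_half i r)

lemma isUnit_kap_neg (h : UnitParams v ω) (i : ℕ) (r : Fin (half v i)) : IsUnit (kap (-ω i r)) := by
  refine isUnit_kap_of (mul_neg (2 : R) _ ▸ (h.isUnit_two_mul i r).neg) ?_
  have := (h.isUnit_add_half i r).neg
  rwa [neg_add'] at this

lemma isUnit_fWr (h : UnitParams v ω) (i : ℕ) (r : Fin (half v i)) :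
    IsUnit (fWr v ω i r (ω i r)) := by
  rw [fWr, ← two_mul, List.prod_ofFn]
  refine (((h.isUnit_param i r).pow _).mul (h.isUnit_two_mul i r)).mul
    (IsUnit.prod_univ_iff.2 fun s => ?_)
  split_ifs with hs
  · exact isUnit_one
  · rw [sq_sub_sq]
    exact (h.add i r s (Ne.symm hs)).mul (h.sub i r s (Ne.symm hs))

lemma isUnit_prod_half (h : UnitParams v ω) (i : ℕ) :
    IsUnit (List.ofFn fun r => sc (1 / 2) ^ 2 - ω i r ^ 2).prod := by
  rw [List.prod_ofFn]
  refine IsUnit.prod_univ_iff.2 fun r => ?_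
  rw [sq_sub_sq, add_comm, ← neg_sub (ω i r)]
  exact (h.isUnit_add_half i r).mul (h.isUnit_sub_half i r).neg

variable {R' : Type} [Ring R'] [Algebra ℂ R'] (ζ : ∀ i, Fin (half w i) → R)

lemma map_inverse (f : R →ₐ[ℂ] R') {x : R} (hx : IsUnit x) :
    f (Ring.inverse x) = Ring.inverse (f x) := map_ringInverse_of_isUnit (f : R →+* R') hx

lemma map_minus (h : UnitParams v ω) (f : R →ₐ[ℂ] R') (i : ℕ) (r : Fin (half v i)) :
    f (fMinus v ω i r) = fMinus v (fun i r => f (ω i r)) i r :=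
  map_fMinus v ω f i r (map_inverse f (h.isUnit_two_mul i r)) (map_inverse f (h.isUnit_kap i r))
    (map_inverse f (h.isUnit_fWr i r))

lemma map_plus (h : UnitParams v ω) (f : R →ₐ[ℂ] R') (i : ℕ) (r : Fin (half v i)) :
    f (fPlus v w ω ζ i r) = fPlus v w (fun i r => f (ω i r)) (fun i r => f (ζ i r)) i r :=
  map_fPlus v w ω ζ f i r (map_inverse f (mul_neg (2 : R) _ ▸ (h.isUnit_two_mul i r).neg))
    (map_inverse f (h.isUnit_kap_neg i r)) (map_inverse f (h.isUnit_fWr i r))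

lemma map_zero (h : UnitParams v ω) (f : R →ₐ[ℂ] R') (c : ℂ) (i : ℕ) :
    f (fZero v w ω ζ c i) = fZero v w (fun i r => f (ω i r)) (fun i r => f (ζ i r)) c i :=
  map_fZero v w ω ζ f c i (map_inverse f (h.isUnit_prod_half i))

end UnitParams

lemma unitParams_locW : UnitParams v (locW v w) where
  add_half := isUnit_locW_half v w
  add := isUnit_locW_add v w
  sub := isUnit_locW_sub v w

section Poles

section

variable {R : Type} [CommRing R] [Algebra ℂ R]

lemma fU_add_C (c : ℂ) (x : R) : fU R c + HahnSeries.C x = lin (sc c + x) := by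
  rw [fU, lin, lin, add_assoc, map_add]

lemma fU_sub_C (c : ℂ) (x : R) : fU R c - HahnSeries.C x = lin (sc c - x) := by
  rw [fU, lin, lin, add_sub_assoc, map_sub]

end

variable {R R' : Type} [CommRing R] [IsDomain R] [Algebra ℂ R] [Ring R'] [Algebra ℂ R']
  (f : R →ₐ[ℂ] R')

lemma mapL_inverse_fU_add (c : ℂ) (x : R) :
    mapL (f : R →+* R') (Ring.inverse (fU R c + HahnSeries.C x)) =
      Ring.inverse (fU R' c + HahnSeries.C (f x)) := by
  rw [map_ringInverse_of_isUnit _ (fU_add_C c x ▸ (monicOf_lin _).isUnit), map_add, mapL_fU, mapL_C]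
  rfl

lemma mapL_inverse_fU_sub (c : ℂ) (x : R) :
    mapL (f : R →+* R') (Ring.inverse (fU R c - HahnSeries.C x)) =
      Ring.inverse (fU R' c - HahnSeries.C (f x)) := by
  rw [map_ringInverse_of_isUnit _ (fU_sub_C c x ▸ (monicOf_lin _).isUnit), map_sub, mapL_fU, mapL_C]
  rfl

lemma mapL_inverse_fU (c : ℂ) :
    mapL (f : R →+* R') (Ring.inverse (fU R c)) = Ring.inverse (fU R' c) := by
  rw [map_ringInverse_of_isUnit _ (monicOf_fU c).isUnit, mapL_fU]

end Poles

/-- The image of `E_i(u)` in the algebra of difference operators. -/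
lemma fE_evLift (c : ℂ) (i : ℕ) :
    fE v w (evLift (polyEv v w) : Loc v w →+* A v w) (locW v w) (locZ v w)
      (fun i r b => EvGrp.toRing _ (grpGen v w i r b)) c i = imageE v w c i := by
  have h := unitParams_locW v w
  have e1 := fun i r => evLift_locW v w i r
  have e2 := fun i r => evLift_locZ v w i r
  simp only [fE, mapL_inverse_fU_add, mapL_inverse_fU_sub, mapL_inverse_fU, AlgHom.coe_toRingHom,
    h.map_minus, h.map_plus, h.map_zero, e1, e2]
  rfl

/-- The three sums of the formula are regrouped as one sum over the poles. The denominator `u - i/2`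
is `X - 1/2`, which is the reason for giving the extra pole the parameter `1/2`. -/
lemma fE_data {K S : Type} [Field K] [Algebra ℂ K] [Ring S] [Algebra ℂ S] (G : ShiftRing v w K S)
    {R : Type} [CommRing R] [IsDomain R] [Algebra ℂ R] {ω : ∀ i, Fin (half v i) → R}
    (h : UnitParams v ω) (ζ : ∀ i, Fin (half w i) → R) (f : R →ₐ[ℂ] K)
    (hω : ∀ i r, f (ω i r) = G.ω i r) (hζ : ∀ i r, f (ζ i r) = G.ζ i r) (c : ℂ) {i : ℕ}
    (hi : 1 ≤ i) :
    fE v w ((G.ι : K →+* S).comp (f : R →+* K)) ω ζ G.δ c i =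
      (G.data c hi).series.E (fU K (-(((i : ℕ) - 1 : ℂ) / 2))) := by
  have hm : ∀ g, mapL ((G.ι : K →+* S).comp (f : R →+* K)) g =
      mapL (G.ι : K →+* S) (mapL (f : R →+* K) g) := fun g => (mapL_mapL _ _ _).symm
  have hpole : fU K (-((i : ℂ) / 2)) = fU K (-(((i : ℕ) - 1 : ℂ) / 2)) - HahnSeries.C 2⁻¹ := by
    rw [fU_sub_C, ← sc_half, sc, sc, ← map_sub, fU]
    congr 2
    ring
  have hω' : (fun i r => f (ω i r)) = G.ω := funext fun i => funext fun r => hω i r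
  have hζ' : (fun i r => f (ζ i r)) = G.ζ := funext fun i => funext fun r => hζ i r
  have e1 : ∀ r, f (fMinus v ω i r) = fMinus v G.ω i r := fun r => by rw [h.map_minus, hω']
  have e2 : ∀ r, f (fPlus v w ω ζ i r) = fPlus v w G.ω G.ζ i r := fun r => by
    rw [h.map_plus, hω', hζ']
  have e3 : f (fZero v w ω ζ c i) = fZero v w G.ω G.ζ c i := by rw [h.map_zero, hω', hζ']
  simp only [fE, hm, mapL_inverse_fU_add, mapL_inverse_fU_sub, mapL_inverse_fU, AlgHom.coe_toRingHom,
    RingHom.comp_apply, e1, e2, e3, hω, Ring.inverse_eq_inv']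
  rw [ShiftData.E, Fintype.sum_option, Fintype.sum_prod_type, hpole]
  simp only [Fintype.sum_bool]
  rw [Finset.sum_add_distrib]
  have e1 : ∀ r, (G.data c hi).series.ι ((fU K (-(((i : ℕ) - 1 : ℂ) / 2)) -
        (G.data c hi).series.w (some (r, true)))⁻¹) * (G.data c hi).series.χ (some (r, true)) =
      -(mapL (G.ι : K →+* S) ((fU K (-(((i : ℕ) - 1 : ℂ) / 2)) - HahnSeries.C (G.ω i r))⁻¹) *
        HahnSeries.C (G.ι (fMinus v G.ω i r) * G.δ i r true)) := by
    intro r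
    change mapL (G.ι : K →+* S) _ * HahnSeries.C (G.ι (-fMinus v G.ω i r) * G.δ i r true) = _
    rw [map_neg, neg_mul, map_neg, mul_neg]
    rfl
  have e2 : ∀ r, (G.data c hi).series.ι ((fU K (-(((i : ℕ) - 1 : ℂ) / 2)) -
        (G.data c hi).series.w (some (r, false)))⁻¹) * (G.data c hi).series.χ (some (r, false)) =
      -(mapL (G.ι : K →+* S) ((fU K (-(((i : ℕ) - 1 : ℂ) / 2)) + HahnSeries.C (G.ω i r))⁻¹) *
        HahnSeries.C (G.ι (fPlus v w G.ω G.ζ i r) * G.δ i r false)) := by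
    intro r
    change mapL (G.ι : K →+* S) (_ - HahnSeries.C (-G.ω i r))⁻¹ *
      HahnSeries.C (G.ι (-fPlus v w G.ω G.ζ i r) * G.δ i r false) = _
    rw [map_neg G.ι, neg_mul, map_neg, map_neg, sub_neg_eq_add, mul_neg]
  have e3 : (G.data c hi).series.ι ((fU K (-(((i : ℕ) - 1 : ℂ) / 2)) -
        (G.data c hi).series.w none)⁻¹) * (G.data c hi).series.χ none =
      mapL (G.ι : K →+* S) ((fU K (-(((i : ℕ) - 1 : ℂ) / 2)) - HahnSeries.C 2⁻¹)⁻¹) *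
        HahnSeries.C (G.ι (fZero v w G.ω G.ζ c i)) := by
    change mapL (G.ι : K →+* S) _ * HahnSeries.C (G.ι (fZero v w G.ω G.ζ c i) * 1) = _
    rw [mul_one]
    rfl
  simp only [e1, e2, e3, Finset.sum_neg_distrib]
  change _ = _ + (-_ + -_)
  rw [← sub_eq_add_neg, add_comm]

end Params

lemma mapL_seriesFrom {B C : Type} [Ring B] [Ring C] [Algebra ℂ B] (φ : B →+* C) {d : ℤ}
    {a : ℕ → B} {f : LaurentSeries C} (hf : VanishBelow d f) (h : ∀ k : ℕ, φ (a k) = f.coeff (d + k)) :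
    mapL φ (seriesFrom d a) = f := by
  ext r
  rw [coeff_mapL]
  change φ (if d ≤ r then a (r - d).toNat else 0) = _
  split_ifs with hr
  · rw [h, Int.toNat_of_nonneg (sub_nonneg.2 hr), add_sub_cancel]
  · rw [map_zero, hf r (not_le.1 hr)]

lemma coeff_seriesFrom {B : Type} [Ring B] [Algebra ℂ B] (d : ℤ) (a : ℕ → B) (k : ℕ) :
    (seriesFrom d a).coeff (d + k) = a k := by
  change (if d ≤ d + k then a (d + k - d).toNat else 0) = _
  rw [if_pos (by omega)]
  congr 1
  omega

lemma mapL_algHom_comp {B C D : Type} [Ring B] [Ring C] [Ring D] [Algebra ℂ B] [Algebra ℂ C]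
    [Algebra ℂ D] (g : C →ₐ[ℂ] D) (f : B →ₐ[ℂ] C) (x : LaurentSeries B) :
    mapL (g.comp f : B →+* D) x = mapL (g : C →+* D) (mapL (f : B →+* C) x) := rfl

/-! ### The lifted homomorphism, and the descent of the relations. -/

section Lift

variable {n : ℕ} (v w : Node n → ℕ) (mu : Coweight n) (m : ℂ →₀ ℤ) (c : Node n → ℂ)

/-- The inclusion of the localization in its skew monoid algebra. -/
def locC : Loc v w →ₐ[ℂ] EvSkew (polyEv v w) := skewC (EvGrp (polyEv v w)) (Loc v w)

/-- The image of `D_i(u)` over the localization. -/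
abbrev locD (i : ℕ) : LaurentSeries (Loc v w) := fD v w (locW v w) (locZ v w) m i

/-- The image of `E_i(u)` in the skew monoid algebra over the localization. -/
abbrev locE (c : ℂ) (i : ℕ) : LaurentSeries (EvSkew (polyEv v w)) :=
  fE v w (locC v w : Loc v w →+* EvSkew (polyEv v w)) (locW v w) (locZ v w)
    (fun i r b => SkewMonoidAlgebra.of _ _ (grpGen v w i r b)) c i

/-- The images of the generators in the skew monoid algebra over the localization. -/
def genImage : YGen n → EvSkew (polyEv v w)
  | .D i k => locC v w ((locD v w m i).coeff (mu i + k))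
  | .Dt i k => locC v w ((Ring.inverse (locD v w m i)).coeff (-mu i + k))
  | .E i k => (locE v w (c i) i).coeff (1 + k)

/-- The homomorphism from the free algebra to the skew monoid algebra over the localization. -/
def freeLift : YFree n →ₐ[ℂ] EvSkew (polyEv v w) := FreeAlgebra.lift ℂ (genImage v w mu m c)

lemma freeLift_ι (x : YGen n) :
    freeLift v w mu m c (FreeAlgebra.ι ℂ x) = genImage v w mu m c x :=
  FreeAlgebra.lift_ι_apply _ _

lemma mapL_fracMap_locD (i : ℕ) : mapL (fracMap (polyEv v w) : Loc v w →+* Frac v w) (locD v w m i) =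
    fD v w (shiftRing v w).ω (shiftRing v w).ζ m i := mapL_fD v w _ _ _ m i

lemma mapL_skewFracMap_locE (c : ℂ) {i : ℕ} (hi : 1 ≤ i) :
    mapL (skewFracMap (polyEv v w) : EvSkew (polyEv v w) →+* EvFracSkew (polyEv v w))
        (locE v w c i) =
      ((shiftRing v w).data c hi).series.E (fU (Frac v w) (-(((i : ℕ) - 1 : ℂ) / 2))) := by
  rw [← fE_data v w (shiftRing v w) (unitParams_locW v w) (locZ v w) (fracMap (polyEv v w))
    (fun _ _ => rfl) (fun _ _ => rfl), locE, mapL_fE]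
  congr 1
  · exact RingHom.ext fun x => skewFracMap_C _ x
  · funext i r b
    exact skewFracMap_of _ _

variable {v w mu m}

/-- The homomorphism from the free algebra to the skew monoid algebra over the field of fractions. -/
abbrev freeFracLift (v w : Node n → ℕ) (mu : Coweight n) (m : ℂ →₀ ℤ) (c : Node n → ℂ) :
    YFree n →ₐ[ℂ] EvFracSkew (polyEv v w) :=
  (skewFracMap (polyEv v w)).comp (freeLift v w mu m c)

lemma monicOf_locD {d : ℤ} {i : ℕ}
    (hmonic : MonicOf d (fD v w (shiftRing v w).ω (shiftRing v w).ζ m i)) :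
    MonicOf d (locD v w m i) :=
  MonicOf.of_mapL (φ := (fracMap (polyEv v w) : Loc v w →+* Frac v w)) (fracMap_injective _)
    (by rw [mapL_fracMap_locD]; exact hmonic)

lemma mapL_fracMap_inverse_locD {d : ℤ} {i : ℕ}
    (hmonic : MonicOf d (fD v w (shiftRing v w).ω (shiftRing v w).ζ m i)) :
    mapL (fracMap (polyEv v w) : Loc v w →+* Frac v w) (Ring.inverse (locD v w m i)) =
      (fD v w (shiftRing v w).ω (shiftRing v w).ζ m i)⁻¹ := by
  rw [map_ringInverse_of_isUnit _ (monicOf_locD hmonic).isUnit, mapL_fracMap_locD,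
    Ring.inverse_eq_inv']

/-- Orders can be read off after the injective passage to the field, where the uniform sum over
poles is available. -/
lemma vanishBelow_locE (c : ℂ) {i : ℕ} (hi : 1 ≤ i) : VanishBelow 1 (locE v w c i) := by
  refine VanishBelow.of_mapL
    (φ := (skewFracMap (polyEv v w) : EvSkew (polyEv v w) →+* EvFracSkew (polyEv v w)))
    (skewFracMap_injective _) ?_
  rw [mapL_skewFracMap_locE v w c hi]
  exact ShiftData.vanishBelow_E _ _ fun p => ShiftRing.IsImage.monicOf_cen_sub i _

lemma mapL_freeLift_D
    (hmonic : ∀ i : Idx n, MonicOf (mu i) (fD v w (shiftRing v w).ω (shiftRing v w).ζ m i))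
    (i : Idx n) : mapL (freeLift v w mu m c : YFree n →+* EvSkew (polyEv v w)) (freeD mu i) =
      mapL (locC v w : Loc v w →+* EvSkew (polyEv v w)) (locD v w m i) :=
  mapL_seriesFrom _ ((monicOf_locD (hmonic i)).1.mapL _) fun _ => freeLift_ι v w mu m c _

lemma mapL_freeLift_Dt
    (hmonic : ∀ i : Idx n, MonicOf (mu i) (fD v w (shiftRing v w).ω (shiftRing v w).ζ m i))
    (i : Idx n) : mapL (freeLift v w mu m c : YFree n →+* EvSkew (polyEv v w)) (freeDt mu i) =
      mapL (locC v w : Loc v w →+* EvSkew (polyEv v w)) (Ring.inverse (locD v w m i)) := by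
  have h : VanishBelow (-mu i) (Ring.inverse (locD v w m i)) := by
    refine VanishBelow.of_mapL (φ := (fracMap (polyEv v w) : Loc v w →+* Frac v w))
      (fracMap_injective _) ?_
    rw [mapL_fracMap_inverse_locD (hmonic i)]
    exact (hmonic i).inv.1
  exact mapL_seriesFrom _ (h.mapL _) fun _ => freeLift_ι v w mu m c _

lemma mapL_freeLift_E (i : Node n) :
    mapL (freeLift v w mu m c : YFree n →+* EvSkew (polyEv v w)) (freeE i) = locE v w (c i) i :=
  mapL_seriesFrom _ (vanishBelow_locE (c i) (Node.one_le i)) fun _ => freeLift_ι v w mu m c _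

lemma isImage_freeFracLift
    (hmonic : ∀ i : Idx n, MonicOf (mu i) (fD v w (shiftRing v w).ω (shiftRing v w).ζ m i))
    (hcase : ∀ i : Node n, ParityCase v w i)
    (hadj : ∀ i j : Node n, (j : ℕ) = i + 1 → parity v i = 0 ∨ parity v j = 0)
    (hsq : ∀ i : Node n, c i ^ 2 = (-1) ^ (half w i + half v (i - 1) + half v (i + 1))) :
    (shiftRing v w).IsImage mu m c (freeFracLift v w mu m c) := by
  have hcomp : ∀ f, mapL (freeFracLift v w mu m c : YFree n →+* EvFracSkew (polyEv v w)) f =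
      mapL (skewFracMap (polyEv v w) : EvSkew (polyEv v w) →+* EvFracSkew (polyEv v w))
        (mapL (freeLift v w mu m c : YFree n →+* EvSkew (polyEv v w)) f) :=
    fun f => mapL_algHom_comp _ _ f
  have hC : ∀ f, mapL (skewFracMap (polyEv v w) : EvSkew (polyEv v w) →+* EvFracSkew (polyEv v w))
        (mapL (locC v w : Loc v w →+* EvSkew (polyEv v w)) f) =
      mapL ((shiftRing v w).ι : Frac v w →+* EvFracSkew (polyEv v w))
        (mapL (fracMap (polyEv v w) : Loc v w →+* Frac v w) f) := fun f => by
    rw [mapL_mapL, mapL_mapL]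
    congr 2
    exact RingHom.ext fun x => skewFracMap_C _ x
  exact
    { D := fun i => by
        rw [hcomp, mapL_freeLift_D c hmonic, hC, mapL_fracMap_locD]
      Dt := fun i => by
        rw [hcomp, mapL_freeLift_Dt c hmonic, hC, mapL_fracMap_inverse_locD (hmonic i)]
      E := fun i => by
        rw [hcomp, mapL_freeLift_E, mapL_skewFracMap_locE v w (c i) (Node.one_le i)]
      monic := hmonic
      parityCase := hcase
      adjacent := hadj
      sq := hsq }

/-- The homomorphism from the free algebra to the algebra of difference operators. -/
abbrev diffLift (v w : Node n → ℕ) (mu : Coweight n) (m : ℂ →₀ ℤ) (c : Node n → ℂ) :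
    YFree n →ₐ[ℂ] A v w :=
  (skewEval (polyEv v w)).comp (freeLift v w mu m c)

lemma mapL_diffLift (f : LaurentSeries (YFree n)) :
    mapL (diffLift v w mu m c : YFree n →+* A v w) f =
      mapL (skewEval (polyEv v w) : EvSkew (polyEv v w) →+* A v w)
        (mapL (freeLift v w mu m c : YFree n →+* EvSkew (polyEv v w)) f) :=
  mapL_algHom_comp _ _ f

lemma mapL_skewEval_C (f : LaurentSeries (Loc v w)) :
    mapL (skewEval (polyEv v w) : EvSkew (polyEv v w) →+* A v w)
        (mapL (locC v w : Loc v w →+* EvSkew (polyEv v w)) f) =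
      mapL (evLift (polyEv v w) : Loc v w →+* A v w) f := by
  rw [mapL_mapL]
  congr 2
  exact RingHom.ext fun x => skewEval_C _ x

lemma mapL_evLift_locD (i : ℕ) :
    mapL (evLift (polyEv v w) : Loc v w →+* A v w) (locD v w m i) = imageD v w m i := by
  rw [imageD_eq, locD, mapL_fD]
  congr 1
  · funext i r
    exact evLift_locW v w i r
  · funext i r
    exact evLift_locZ v w i r

lemma mapL_diffLift_D
    (hmonic : ∀ i : Idx n, MonicOf (mu i) (fD v w (shiftRing v w).ω (shiftRing v w).ζ m i))
    (i : Idx n) :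
    mapL (diffLift v w mu m c : YFree n →+* A v w) (freeD mu i) = imageD v w m i := by
  rw [mapL_diffLift, mapL_freeLift_D c hmonic, mapL_skewEval_C, mapL_evLift_locD]

lemma mapL_diffLift_Dt
    (hmonic : ∀ i : Idx n, MonicOf (mu i) (fD v w (shiftRing v w).ω (shiftRing v w).ζ m i))
    (i : Idx n) :
    mapL (diffLift v w mu m c : YFree n →+* A v w) (freeDt mu i) * imageD v w m i = 1 ∧
      imageD v w m i * mapL (diffLift v w mu m c : YFree n →+* A v w) (freeDt mu i) = 1 := by
  have h := (monicOf_locD (hmonic i)).isUnit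
  rw [mapL_diffLift, mapL_freeLift_Dt c hmonic, mapL_skewEval_C, ← mapL_evLift_locD, ← map_mul,
    ← map_mul, Ring.inverse_mul_cancel _ h, Ring.mul_inverse_cancel _ h, map_one]
  exact ⟨rfl, rfl⟩

lemma mapL_diffLift_E (i : Node n) :
    mapL (diffLift v w mu m c : YFree n →+* A v w) (freeE i) = imageE v w (c i) i := by
  rw [mapL_diffLift, mapL_freeLift_E, locE, mapL_fE, ← fE_evLift]
  congr 1
  · exact RingHom.ext fun x => skewEval_C _ x
  · funext i r b
    exact skewEval_of _ _

/-- The relation holds over the field of fractions, hence over the localization by injectivity,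
hence in `𝒜` after evaluation. -/
lemma diffLift_rel
    (hmonic : ∀ i : Idx n, MonicOf (mu i) (fD v w (shiftRing v w).ω (shiftRing v w).ζ m i))
    (hcase : ∀ i : Node n, ParityCase v w i)
    (hadj : ∀ i j : Node n, (j : ℕ) = i + 1 → parity v i = 0 ∨ parity v j = 0)
    (hsq : ∀ i : Node n, c i ^ 2 = (-1) ^ (half w i + half v (i - 1) + half v (i + 1)))
    {a b : YFree n} (hab : YRel n mu a b) : diffLift v w mu m c a = diffLift v w mu m c b := by
  have h := (isImage_freeFracLift c hmonic hcase hadj hsq).rel hab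
  exact congrArg (skewEval (polyEv v w)) (skewFracMap_injective (polyEv v w) h)

end Lift

/-! ### Uniqueness and the conclusion. -/

section Main

variable {n : ℕ} {v w : Node n → ℕ} {mu : Coweight n}

lemma algHom_ext_Y {B : Type} [Ring B] [Algebra ℂ B] {f g : Y n mu →ₐ[ℂ] B}
    (hD : ∀ i, mapSeries f (Y.D mu i) = mapSeries g (Y.D mu i))
    (hDt : ∀ i, mapSeries f (Y.Dt mu i) = mapSeries g (Y.Dt mu i))
    (hE : ∀ i, mapSeries f (Y.E mu i) = mapSeries g (Y.E mu i)) : f = g := by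
  have key : ∀ (d : ℤ) (a : ℕ → YFree n),
      mapSeries f (mapSeries (Y.mk n mu) (seriesFrom d a)) =
        mapSeries g (mapSeries (Y.mk n mu) (seriesFrom d a)) →
      ∀ k, f (Y.mk n mu (a k)) = g (Y.mk n mu (a k)) := by
    intro d a h k
    have h := congrArg (fun x => HahnSeries.coeff x (d + k)) h
    change f (Y.mk n mu ((seriesFrom d a).coeff (d + k))) =
      g (Y.mk n mu ((seriesFrom d a).coeff (d + k))) at h
    rwa [coeff_seriesFrom] at h
  refine RingQuot.ringQuot_ext' ℂ f g (FreeAlgebra.hom_ext (funext fun x => ?_))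
  cases x with
  | D i k => exact key _ _ (hD i) k
  | Dt i k => exact key _ _ (hDt i) k
  | E i k => exact key _ _ (hE i) k

lemma algHom_ext_tensor {B C D : Type} [Ring B] [Algebra ℂ B] [CommRing C] [Algebra ℂ C] [Ring D]
    [Algebra ℂ D] {f g : B ⊗[ℂ] C →ₐ[ℂ] D}
    (hB : f.comp Algebra.TensorProduct.includeLeft = g.comp Algebra.TensorProduct.includeLeft)
    (hC : ∀ p, f (1 ⊗ₜ[ℂ] p) = g (1 ⊗ₜ[ℂ] p)) : f = g :=
  Algebra.TensorProduct.ext hB (AlgHom.ext hC)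

end Main

end IGKLO

end

open IGKLO in
theorem theorem3 (n : ℕ) (hn : 1 ≤ n)
    (lam mu : IGKLO.Coweight n) (hdom : IGKLO.IsDominant lam) (heven : IGKLO.IsEven mu)
    (v : IGKLO.Node n → ℕ) (hv : lam - mu = ∑ i, v i • IGKLO.simpleCoroot i)
    (hpar : ∀ i j : IGKLO.Node n, i ≠ j →
      IGKLO.cartan i j * (IGKLO.parity v i : ℤ) * (IGKLO.parity v j : ℤ) = 0)
    (m : ℂ →₀ ℤ)
    (hm : lam ⟨1, le_rfl, hn⟩ = (IGKLO.parity v 1 : ℤ) - 2 * m.sum fun _ k => k)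
    (c : IGKLO.Node n → ℂ)
    (hc : ∀ i : IGKLO.Node n, c i ^ 2 = (-1) ^ (IGKLO.half (IGKLO.weightVec lam) i +
      IGKLO.half v (i - 1) + IGKLO.half v (i + 1))) :
    ∃! Φ : IGKLO.Y n mu ⊗[ℂ] MvPolynomial (IGKLO.ZIdx (IGKLO.weightVec lam)) ℂ →ₐ[ℂ]
        IGKLO.A v (IGKLO.weightVec lam),
      (∀ p, Φ (1 ⊗ₜ[ℂ] p) = algebraMap _ (IGKLO.A v (IGKLO.weightVec lam)) p) ∧
      (∀ i : IGKLO.Idx n,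
        IGKLO.mapSeries (Φ.comp Algebra.TensorProduct.includeLeft) (IGKLO.Y.D mu i) =
          IGKLO.imageD v (IGKLO.weightVec lam) m i) ∧
      (∀ i : IGKLO.Idx n,
        IGKLO.mapSeries (Φ.comp Algebra.TensorProduct.includeLeft) (IGKLO.Y.Dt mu i) *
            IGKLO.imageD v (IGKLO.weightVec lam) m i = 1 ∧
          IGKLO.imageD v (IGKLO.weightVec lam) m i *
            IGKLO.mapSeries (Φ.comp Algebra.TensorProduct.includeLeft) (IGKLO.Y.Dt mu i) = 1) ∧
      (∀ i : IGKLO.Node n,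
        IGKLO.mapSeries (Φ.comp Algebra.TensorProduct.includeLeft) (IGKLO.Y.E mu i) =
          IGKLO.imageE v (IGKLO.weightVec lam) (c i) i) := by
  have h1 : 1 ∈ Set.Icc 1 n := ⟨le_rfl, hn⟩
  have hmonic : ∀ i : Idx n, MonicOf (mu i) (fD v (weightVec lam) (shiftRing v (weightVec lam)).ω
      (shiftRing v (weightVec lam)).ζ m i) := by
    have := (shiftRing v (weightVec lam)).charZero
    exact fun i => monicOf_fD_coweight hdom hv h1 hm _ _ i
  have hrel : ∀ ⦃a b⦄, YRel n mu a b →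
      diffLift v (weightVec lam) mu m c a = diffLift v (weightVec lam) mu m c b := fun a b hab =>
    diffLift_rel c hmonic (parityCase hdom heven hv hpar) (fun i j hij => by
      have := parity_adjacent hpar i
      rwa [← hij] at this) hc hab
  let Ψ : Y n mu →ₐ[ℂ] A v (weightVec lam) :=
    RingQuot.liftAlgHom ℂ ⟨diffLift v (weightVec lam) mu m c, hrel⟩
  have hΨ : ∀ f, mapSeries Ψ (mapSeries (Y.mk n mu) f) =
      mapL (diffLift v (weightVec lam) mu m c : YFree n →+* A v (weightVec lam)) f := fun f => by
    ext r
    exact RingQuot.liftAlgHom_mkAlgHom_apply ℂ _ hrel _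
  let ζ : MvPolynomial (ZIdx (weightVec lam)) ℂ →ₐ[ℂ] A v (weightVec lam) :=
    IsScalarTower.toAlgHom ℂ _ _
  let Φ : Y n mu ⊗[ℂ] MvPolynomial (ZIdx (weightVec lam)) ℂ →ₐ[ℂ] A v (weightVec lam) :=
    -- The two homomorphisms have commuting images because `ℂ[z]` is central in `𝒜`.
    Algebra.TensorProduct.lift Ψ ζ fun x p => (Algebra.commutes p (Ψ x)).symm
  have hΦ : Φ.comp Algebra.TensorProduct.includeLeft = Ψ :=
    Algebra.TensorProduct.lift_comp_includeLeft _ _ _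
  have hΦp : ∀ p, Φ (1 ⊗ₜ[ℂ] p) = ζ p := fun p =>
    (Algebra.TensorProduct.lift_tmul _ _ _ _ _).trans (by rw [map_one, one_mul])
  refine ⟨Φ, ⟨hΦp, fun i => ?_, fun i => ?_, fun i => ?_⟩, ?_⟩
  · rw [hΦ]
    exact (hΨ _).trans (mapL_diffLift_D c hmonic i)
  · rw [hΦ]
    have := hΨ (freeDt mu i)
    rw [Y.Dt, this]
    exact mapL_diffLift_Dt c hmonic i
  · rw [hΦ]
    exact (hΨ _).trans (mapL_diffLift_E c i)
  · rintro Φ' ⟨hp, hD, hDt, hE⟩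
    refine algHom_ext_tensor (algHom_ext_Y (fun i => ?_) (fun i => ?_) fun i => ?_) fun p => ?_
    · rw [hD, hΦ]
      exact ((hΨ _).trans (mapL_diffLift_D c hmonic i)).symm
    -- A left inverse and a right inverse of the image of `D_i(u)` coincide, so the image of
    -- `D̃_i(u)` is determined.
    · have h2 : imageD v (weightVec lam) m i * mapSeries Ψ (Y.Dt mu i) = 1 := by
        rw [Y.Dt, hΨ]
        exact (mapL_diffLift_Dt c hmonic i).2
      rw [hΦ]
      exact left_inv_eq_right_inv (hDt i).1 h2
    · rw [hE, hΦ]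
      exact ((hΨ _).trans (mapL_diffLift_E c i)).symm
    · exact (hp p).trans (hΦp p).symm
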